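/- Let $\mathcal O=[0,2\pi]^2$ with periodic boundary conditions. Let $\mathbf H$ be the space of mean-zero, (weakly) divergence-free periodic vector fields in $\mathbf L^2(\mathcal O)$, with the $\mathbf L^2$ inner product $(\cdot,\cdot)$ and norm $|\cdot|$, and let $\mathbf V=\mathbf H^1\cap\mathbf H$ with norm $\lVert u\rVert=|\nabla u|$, where $\mathbf H^m$ denotes the periodic Sobolev space of order $m$ based on $\mathbf L^2$. Let $\Pi:\mathbf L^2(\mathcal O)\to\mathbf H$ be the Helmholtz--Leray (orthogonal) projection, $\mathrm A=-\Pi\Delta$ the Stokes operator with domain $D(\mathrm A)=\mathbf H^2\cap\mathbf H$, and $B(u,v)=\Pi(u\cdot\nabla v)$. Let $\mathrm K$ be a separable real Hilbert space and let $G:\mathbf H\to\mathscr L_2(\mathrm K,\mathbf H)\cap\mathscr L_2(\mathrm K,\mathbf V)$ (Hilbert--Schmidt operators) satisfy, for some constant $c>0$ and all $u,v\in\mathbf H$, $$\|G(u)-G(v)\|_{\mathscr L_2(\mathrm K,\mathbf V)}+\|G(u)-G(v)\|_{\mathscr L_2(\mathrm K,\mathbf H)}\le c|u-v|,\qquad \|G(u)\|_{\mathscr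 L_2(\mathrm K,\mathbf V)}+\|G(u)\|_{\mathscr L_2(\mathrm K,\mathbf H)}\le c(1+|u|).$$ Then there is a function $(M,r)\mapsto C(M,r)\in(0,\infty)$ (depending on the fixed data $\mathrm K$ and $G$, but not on $T$, $\delta$, $h$, nor on $\xi$ except through $\lVert\xi\rVert$) such that the following holds for every $T\in(0,\infty)$ and every $\xi\in\mathbf V$. (0) The Navier--Stokes equation $\frac{d}{dt}\mathbf u+\mathrm A\mathbf u+B(\mathbf u,\mathbf u)=0$, $\mathbf u(0)=\xi$, has a unique solution $\mathbf u\in C([0,T];\mathbf V)\cap L^2(0,T;D(\mathrm A))$. (1) For every $\delta\in\{0,1\}$ and every $h\in L^2(0,T;\mathrm K)$, the controlled equation $$\frac{d}{dt}\mathbf y+\mathrm A\mathbf y+(1-\delta)B(\mathbf y,\mathbf y)+\delta B(\mathbf u,\mathbf y)+\delta B(\mathbf y,\mathbf u)=G(\delta\mathbf u+(1-\delta)\mathbf y)h,\qquad \mathbf y(0)=(1-\delta)\xi,$$ has a unique solution $\mathbf y=\mathbf y^\delta_h$ with values in $\mathbf V$ and $\mathbf y\in C([0,T];\mathbf H^1)\cap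 L^2(0,T;\mathbf H^2)$. (2) If moreover $M>0$ and $\int_0^T\|h(t)\|_{\mathrm K}^2\,dt\le M$, then $$\sup_{t\in[0,T]}\left(|\mathbf y^\delta_h(t)|^2+\lVert\mathbf y^\delta_h(t)\rVert^2\right)+\int_0^T\left(\lVert\mathbf y^\delta_h(t)\rVert^2+|\mathrm A\mathbf y^\delta_h(t)|^2\right)dt\le C(M,\lVert\xi\rVert).$$ Here solutions are understood in the integrated form: the equations hold in $\mathbf H$ after integration over $[0,t]$ (Bochner integral) for every $t\in[0,T]$; uniqueness means equality at every $t\in[0,T]$. -/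

import Mathlib

open scoped ENNReal ContDiff

noncomputable section

namespace TorusNS

/-! ### Periodic vector fields on the square `[0, 2π]²` -/

abbrev Plane : Type := EuclideanSpace ℝ (Fin 2)

/-- The periodic cell `[0, 2π]²`. -/
def cell : Set Plane := {x | ∀ i, x i ∈ Set.Icc (0 : ℝ) (2 * Real.pi)}

/-- Lebesgue measure on the periodic cell. -/
def cellMeasure : MeasureTheory.Measure Plane := MeasureTheory.volume.restrict cell

/-- `𝐋²`: square integrable vector fields on the periodic cell. -/
abbrev L2 : Type := MeasureTheory.Lp Plane 2 cellMeasure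

/-- Smooth scalar functions on the plane, `2π`-periodic in each coordinate direction. -/
structure IsTest (φ : Plane → ℝ) : Prop where
  smooth : ContDiff ℝ ∞ φ
  periodic : ∀ (i : Fin 2) (x : Plane),
    φ (x + EuclideanSpace.single i (2 * Real.pi)) = φ x

/-- The classical partial derivative `∂ⱼ φ`. -/
def partialD (j : Fin 2) (φ : Plane → ℝ) (x : Plane) : ℝ :=
  fderiv ℝ φ x (EuclideanSpace.single j 1)

lemma isCompact_cell : IsCompact cell := by
  have h : cell = (EuclideanSpace.equiv (Fin 2) ℝ).toHomeomorph ⁻¹'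
      (Set.univ.pi fun _ => Set.Icc (0 : ℝ) (2 * Real.pi)) := by
    ext x
    simp only [cell, Set.mem_preimage, Set.mem_univ_pi]
    rfl
  rw [h]
  exact (EuclideanSpace.equiv (Fin 2) ℝ).toHomeomorph.isCompact_preimage.2
    (isCompact_univ_pi fun _ => isCompact_Icc)

instance : MeasureTheory.IsFiniteMeasure cellMeasure := by
  refine ⟨?_⟩
  simpa [cellMeasure] using isCompact_cell.measure_lt_top

lemma memLp_of_continuous {f : Plane → Plane} (hf : Continuous f) :
    MeasureTheory.MemLp f 2 cellMeasure := by
  obtain ⟨c, hc⟩ := isCompact_cell.exists_bound_of_continuousOn hf.continuousOn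
  refine MeasureTheory.MemLp.of_bound hf.aestronglyMeasurable c ?_
  exact MeasureTheory.ae_restrict_of_forall_mem isCompact_cell.measurableSet hc

/-- The classical gradient of a scalar function. -/
def gradField (φ : Plane → ℝ) (x : Plane) : Plane := WithLp.toLp 2 fun j => partialD j φ x

lemma IsTest.continuous_gradField {φ : Plane → ℝ} (hφ : IsTest φ) :
    Continuous (gradField φ) := by
  have h : Continuous (fderiv ℝ φ) := hφ.smooth.continuous_fderiv (by simp)
  unfold gradField partialD
  fun_prop

lemma inner_toLp {f : Plane → Plane} (hf : Continuous f) (u : L2) :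
    inner ℝ ((memLp_of_continuous hf).toLp f) u = ∫ x, inner ℝ (f x) (u x) ∂cellMeasure := by
  rw [MeasureTheory.L2.inner_def]
  refine MeasureTheory.integral_congr_ae ?_
  filter_upwards [(memLp_of_continuous hf).coeFn_toLp] with x hx
  rw [hx]

/-- Mean zero, and divergence free in the sense of periodic distributions. -/
def IsSolenoidal (u : L2) : Prop :=
  ∫ x, u x ∂cellMeasure = 0 ∧
    ∀ φ : Plane → ℝ, IsTest φ → ∫ x, inner ℝ (gradField φ x) (u x) ∂cellMeasure = 0

lemma isSolenoidal_iff (u : L2) : IsSolenoidal u ↔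
    (∀ c : Plane, inner ℝ ((memLp_of_continuous (continuous_const (y := c))).toLp _) u = 0) ∧
    (∀ (φ : Plane → ℝ) (hφ : IsTest φ),
      inner ℝ ((memLp_of_continuous hφ.continuous_gradField).toLp _) u = 0) := by
  have hu : MeasureTheory.Integrable u cellMeasure :=
    (MeasureTheory.Lp.memLp u).integrable (by norm_num)
  unfold IsSolenoidal
  refine and_congr ?_ ?_
  · constructor
    · intro h c
      rw [inner_toLp continuous_const, integral_inner hu, h, inner_zero_right]
    · intro h
      have := h (∫ x, u x ∂cellMeasure)
      rw [inner_toLp continuous_const, integral_inner hu] at this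
      exact inner_self_eq_zero.1 this
  · exact forall₂_congr fun φ hφ => by rw [inner_toLp hφ.continuous_gradField]

/-- The space `𝐇` of mean zero, divergence free fields in `𝐋²`, with the `𝐋²` inner product. -/
def H : Submodule ℝ L2 where
  carrier := {u | IsSolenoidal u}
  zero_mem' := by simp [isSolenoidal_iff]
  add_mem' := by
    intro a b ha hb
    simp only [Set.mem_ofPred_eq, isSolenoidal_iff] at *
    exact ⟨fun c => by rw [inner_add_right, ha.1, hb.1, add_zero],
      fun φ hφ => by rw [inner_add_right, ha.2 φ hφ, hb.2 φ hφ, add_zero]⟩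
  smul_mem' := by
    intro r a ha
    simp only [Set.mem_ofPred_eq, isSolenoidal_iff] at *
    exact ⟨fun c => by rw [inner_smul_right, ha.1, mul_zero],
      fun φ hφ => by rw [inner_smul_right, ha.2 φ hφ, mul_zero]⟩

lemma isClosed_H : IsClosed (H : Set L2) := by
  have h : (H : Set L2) = {u | IsSolenoidal u} := rfl
  simp only [h, isSolenoidal_iff, Set.ofPred_and, Set.ofPred_forall]
  refine IsClosed.inter ?_ ?_
  · exact isClosed_iInter fun c => isClosed_eq (by fun_prop) continuous_const
  · exact isClosed_iInter fun φ => isClosed_iInter fun hφ =>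
      isClosed_eq (by fun_prop) continuous_const

instance : CompleteSpace H := isClosed_H.completeSpace_coe

/-- The Helmholtz–Leray projection: the orthogonal projection of `𝐋²` onto `𝐇`. -/
def leray : L2 →L[ℝ] H := H.orthogonalProjectionOnto

/-! ### Periodic Sobolev spaces -/

/-- `g` is the weak derivative `∂ⱼ f`, tested against smooth periodic functions. -/
def HasWeakPartial (j : Fin 2) (f g : L2) : Prop :=
  ∀ φ : Plane → ℝ, IsTest φ →
    ∫ x, partialD j φ x • f x ∂cellMeasure = -∫ x, φ x • g x ∂cellMeasure

/-- The weak derivative `∂ⱼ f` (unique when it exists; `0` by convention when there is none). -/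
def weakPartial (j : Fin 2) (f : L2) : L2 :=
  open Classical in if h : ∃ g, HasWeakPartial j f g then h.choose else 0

/-- Membership in the periodic Sobolev space `𝐇¹`. -/
def MemH1 (f : L2) : Prop := ∀ j, ∃ g, HasWeakPartial j f g

/-- Membership in the periodic Sobolev space `𝐇²`. -/
def MemH2 (f : L2) : Prop := MemH1 f ∧ ∀ j, MemH1 (weakPartial j f)

/-- The norm `‖u‖ = |∇u|` of `𝐕 = 𝐇¹ ∩ 𝐇`. -/
def normV (u : H) : ℝ := Real.sqrt (∑ j, ‖weakPartial j (u : L2)‖ ^ 2)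

/-- The Stokes operator `A u = -P Δ u`, with `P` the Leray projection, for `u ∈ 𝐇² ∩ 𝐇`. -/
def stokes (u : H) : H := -leray (∑ j, weakPartial j (weakPartial j (u : L2)))

/-- The vector field `(u · ∇) v`. -/
def convection (u v : H) (x : Plane) : Plane :=
  ∑ j, ((u : L2) x) j • (weakPartial j (v : L2)) x

/-- `B(u, v)`, the Leray projection of `(u · ∇) v`. The field `(u · ∇) v` is square integrable for
`u ∈ 𝐕` and `v ∈ 𝐇² ∩ 𝐇`, the only case in which `B` is used. -/
def B (u v : H) : H :=
  open Classical in
  if h : MeasureTheory.MemLp (convection u v) 2 cellMeasure then leray (h.toLp _) else 0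

/-! ### The noise coefficient -/

section Noise

variable {K : Type*} [NormedAddCommGroup K] [InnerProductSpace ℝ K] [CompleteSpace K]

/-- The index set of an orthonormal basis of `K`. -/
def basisSet (K : Type*) [NormedAddCommGroup K] [InnerProductSpace ℝ K] [CompleteSpace K] :
    Set K := (exists_hilbertBasis ℝ K).choose

/-- An orthonormal basis of `K`. -/
def onb (K : Type*) [NormedAddCommGroup K] [InnerProductSpace ℝ K] [CompleteSpace K] :
    HilbertBasis (basisSet K) ℝ K := (exists_hilbertBasis ℝ K).choose_spec.choose

/-- The Hilbert–Schmidt norm `(∑ₖ p(S eₖ)²)^{1/2}` of `S`, where the target carries the Hilbertian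
norm `p` (it does not depend on the orthonormal basis); it is `∞` if `S` is not Hilbert–Schmidt. -/
def hsNorm (p : H → ℝ) (S : K →L[ℝ] H) : ℝ≥0∞ :=
  (∑' i, ENNReal.ofReal (p (S (onb K i))) ^ 2) ^ (1 / 2 : ℝ)

/-- The standing assumption on the noise coefficient: `G` maps `𝐇` into
`ℒ₂(K, 𝐇) ∩ ℒ₂(K, 𝐕)`, is Lipschitz and has linear growth. -/
def NoiseAssumption (G : H → K →L[ℝ] H) : Prop :=
  (∀ u x, MemH1 (G u x : L2)) ∧
  ∃ c : ℝ, 0 < c ∧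
    (∀ u v, hsNorm normV (G u - G v) + hsNorm norm (G u - G v) ≤ ENNReal.ofReal (c * ‖u - v‖)) ∧
    (∀ u, hsNorm normV (G u) + hsNorm norm (G u) ≤ ENNReal.ofReal (c * (1 + ‖u‖)))

end Noise

/-! ### The equations -/

/-- `y ∈ C([0,T]; 𝐕) ∩ L²(0,T; 𝐇²)`. -/
structure InSolutionSpace (T : ℝ) (y : ℝ → H) : Prop where
  memH1 : ∀ t ∈ Set.Icc 0 T, MemH1 (y t : L2)
  continuousOn : ContinuousOn y (Set.Icc 0 T)
  continuousOn_partial : ∀ j, ContinuousOn (fun t => weakPartial j (y t : L2)) (Set.Icc 0 T)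
  memH2 : ∀ᵐ t ∂MeasureTheory.volume.restrict (Set.Ioo 0 T), MemH2 (y t : L2)
  memLp_second : ∀ i j, MeasureTheory.MemLp (fun t => weakPartial i (weakPartial j (y t : L2))) 2
    (MeasureTheory.volume.restrict (Set.Ioo 0 T))

/-- `y' = F` on `[0,T]`, `y(0) = y₀`, in integrated form in `𝐇`. -/
def IsIntegralSolution (T : ℝ) (y₀ : H) (F : ℝ → H) (y : ℝ → H) : Prop :=
  IntervalIntegrable F MeasureTheory.volume 0 T ∧
    ∀ t ∈ Set.Icc 0 T, y t = y₀ + ∫ s in (0 : ℝ)..t, F s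

/-- `u` solves the Navier–Stokes equation `u' + A u + B(u, u) = 0`, `u(0) = ξ`, on `[0,T]`. -/
structure IsNSESolution (T : ℝ) (ξ : H) (u : ℝ → H) : Prop where
  space : InSolutionSpace T u
  equation : IsIntegralSolution T ξ (fun s => -stokes (u s) - B (u s) (u s)) u

/-- `y` solves the controlled equation
`y' + A y + (1-δ) B(y,y) + δ B(u,y) + δ B(y,u) = G(δ u + (1-δ) y) h`, `y(0) = (1-δ) ξ`. -/
structure IsControlledSolution {K : Type*} [NormedAddCommGroup K] [InnerProductSpace ℝ K]
    (G : H → K →L[ℝ] H) (T δ : ℝ) (ξ : H) (u : ℝ → H) (h : ℝ → K) (y : ℝ → H) : Prop where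
  space : InSolutionSpace T y
  equation : IsIntegralSolution T ((1 - δ) • ξ)
    (fun s => G (δ • u s + (1 - δ) • y s) (h s) - stokes (y s)
      - (1 - δ) • B (y s) (y s) - δ • B (u s) (y s) - δ • B (y s) (u s)) y

end TorusNS

end

/-!
The Stokes operator `A` on the torus is diagonal in the orthonormal basis of fields
`(cos (k · x) + sin (k · x)) k^⊥ / (2π|k|)`, `0 ≠ k ∈ ℤ²`, with eigenvalues `|k|²` (`modeBasis`). Hence
`S = A^{-1/2}` is a bounded diagonal operator (`invSqrtStokes`), `𝐕` is its range and `D(A)` is the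
range of `S²`: by Bessel's inequality, square integrable weak derivatives make the coefficients
`|k| uₖ` square summable (`memH1_iff`, `memH2_iff`). A path in `C([0,T]; 𝐕) ∩ L²(0,T; D(A))` is thus a
continuous `v = A^{1/2} y` together with a square integrable `g = A y`, both with values in `𝐇`
(`IsLift`), and the whole problem can be treated for these two unknowns
(`isControlledSolution_iff`).

The linear equation `y' + A y = f` satisfies the energy identity
`‖v(t)‖² + 2 ∫ ‖g‖² = ‖v₀‖² + 2 ∫ (f, g)`, obtained mode by mode (`IsLinearSolution.energy_eq`).
Consequently the data for which the equation is solvable form a closed space; since it contains all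
single modes, it is everything (`exists_isLinearSolution`). For a nonlinear right-hand side, the
contraction principle continues a solution over a time step whose length only depends on an a priori
bound, so that such a bound yields a global solution (`exists_nonlinear_solution`).

Two properties of the convective term are needed (`IsConvective`). The estimate
`|B(u, v)|² ≤ C ‖u‖ |A u| ‖v‖²` follows from `|u|_∞² ≤ C ‖u‖ |A u|`, which is the Cauchy–Schwarz
inequality for the coefficients of `u` and the convergence of `∑ |k|⁻³` (`ae_norm_le`). The enstrophy
balance `(B(u, u), A u) = 0`, special to two dimensions and periodic boundary conditions, is an
integration by parts for trigonometric polynomials, extended by density (`inner_convectiveMap`).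

For `δ = 0` the enstrophy balance removes the convective term from the energy identity, and
Gronwall's inequality with the coefficient `‖h‖²` gives the bound (`bound_of_controlForce_zero`). For
`δ = 1` the convective terms are absorbed by Young's inequality (`IsConvective.two_inner_le`), and
Gronwall's inequality is used with a multiple of `|A u|²` (`bound_of_controlForce_one`); by the case
`δ = 0`, `h = 0`, which is the Navier–Stokes equation, the integral of `|A u|²` and the supremum of
`‖u‖²` are at most `‖ξ‖²`. Neither bound involves `T`. The difference of two solutions solves a
linearised equation without data, and the same argument gives uniqueness (`eqOn_of_controlForce`).
Of the noise coefficient, only the Lipschitz and growth conditions in the operator norm from the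
control space to `𝐇` enter.
-/

noncomputable section

namespace TorusNS

open MeasureTheory Set Filter Topology

/-! ### Calculus of absolutely continuous functions -/

lemma absolutelyContinuousOnInterval_lipschitz_comp {f φ : ℝ → ℝ} {a b : ℝ} {s : Set ℝ}
    {L : NNReal} (hφ : LipschitzOnWith L φ s) (hf : AbsolutelyContinuousOnInterval f a b)
    (hs : ∀ t ∈ uIcc a b, f t ∈ s) : AbsolutelyContinuousOnInterval (fun t => φ (f t)) a b := by
  rw [absolutelyContinuousOnInterval_iff] at hf ⊢
  intro ε hε
  obtain ⟨δ, hδ, h⟩ := hf (ε / (L + 1)) (by positivity)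
  refine ⟨δ, hδ, fun J hJ hlt => ?_⟩
  have h1 := h J hJ hlt
  have h2 : ∑ i ∈ Finset.range J.1, dist (φ (f (J.2 i).1)) (φ (f (J.2 i).2)) ≤
      ∑ i ∈ Finset.range J.1, L * dist (f (J.2 i).1) (f (J.2 i).2) := by
    refine Finset.sum_le_sum fun i hi => ?_
    have := hJ.1 i hi
    exact hφ.dist_le_mul _ (hs _ this.1) _ (hs _ this.2)
  rw [← Finset.mul_sum] at h2
  rw [lt_div_iff₀ (by positivity)] at h1
  have h3 : 0 ≤ ∑ i ∈ Finset.range J.1, dist (f (J.2 i).1) (f (J.2 i).2) :=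
    Finset.sum_nonneg fun _ _ => dist_nonneg
  nlinarith

/-- Product rule for indefinite integrals of integrable functions. The functions `x` and `y` are only
known on `[0, T]`. -/
lemma mul_eq_add_integral {p q x y : ℝ → ℝ} {x₀ y₀ T : ℝ}
    (hp : IntervalIntegrable p volume 0 T) (hq : IntervalIntegrable q volume 0 T)
    (hx : ∀ t ∈ Icc 0 T, x t = x₀ + ∫ s in (0 : ℝ)..t, p s)
    (hy : ∀ t ∈ Icc 0 T, y t = y₀ + ∫ s in (0 : ℝ)..t, q s) :
    ∀ t ∈ Icc 0 T, x t * y t = x₀ * y₀ + ∫ s in (0 : ℝ)..t, (p s * y s + x s * q s) := by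
  intro t ht
  have hsub : uIcc 0 t ⊆ uIcc 0 T := by
    rw [uIcc_of_le ht.1, uIcc_of_le (ht.1.trans ht.2)]; exact Icc_subset_Icc_right ht.2
  have hp' := hp.mono_set hsub
  have hq' := hq.mono_set hsub
  have hX : AbsolutelyContinuousOnInterval (fun t => x₀ + ∫ s in (0 : ℝ)..t, p s) 0 t :=
    ((LipschitzWith.const x₀).lipschitzOnWith).absolutelyContinuousOnInterval.fun_add
      (hp'.absolutelyContinuousOnInterval_intervalIntegral (by simp))
  have hY : AbsolutelyContinuousOnInterval (fun t => y₀ + ∫ s in (0 : ℝ)..t, q s) 0 t :=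
    ((LipschitzWith.const y₀).lipschitzOnWith).absolutelyContinuousOnInterval.fun_add
      (hq'.absolutelyContinuousOnInterval_intervalIntegral (by simp))
  have h := hX.integral_deriv_mul_eq_sub hY
  simp only [intervalIntegral.integral_same, add_zero] at h
  rw [← hx t ht, ← hy t ht] at h
  rw [← sub_eq_iff_eq_add', ← h]
  refine intervalIntegral.integral_congr_ae ?_
  filter_upwards [hp'.ae_hasDerivAt_integral, hq'.ae_hasDerivAt_integral] with s h1 h2 hs
  have hs' : s ∈ uIcc 0 t := uIoc_subset_uIcc hs
  have hsI : s ∈ Icc 0 T := by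
    have := hsub hs'; rwa [uIcc_of_le (ht.1.trans ht.2)] at this
  rw [((h1 hs' 0 (by simp)).const_add x₀).deriv, ((h2 hs' 0 (by simp)).const_add y₀).deriv,
    ← hx s hsI, ← hy s hsI]

/-- Gronwall's inequality with an integrable coefficient. The product of `a + ∫ β φ` with
`exp (-∫ β)` is absolutely continuous and nonincreasing. -/
lemma gronwall_integrable {φ β : ℝ → ℝ} {a T : ℝ} (hφ : ContinuousOn φ (Icc 0 T))
    (hβ : IntervalIntegrable β volume 0 T) (hβ0 : ∀ t, 0 ≤ β t)
    (h : ∀ t ∈ Icc 0 T, φ t ≤ a + ∫ s in (0 : ℝ)..t, β s * φ s) :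
    ∀ t ∈ Icc 0 T, φ t ≤ a * Real.exp (∫ s in (0 : ℝ)..t, β s) := by
  intro t ht
  have hT : 0 ≤ T := ht.1.trans ht.2
  have hB0 : ∀ s ∈ Icc 0 T, 0 ≤ ∫ r in (0 : ℝ)..s, β r := fun s hs =>
    intervalIntegral.integral_nonneg hs.1 fun r _ => hβ0 r
  -- `exp (-∫ β)` is absolutely continuous, because `exp (-x)` is Lipschitz for `x ≥ 0`
  have hlip : LipschitzOnWith 1 (fun x : ℝ => Real.exp (-x)) (Ici 0) := by
    refine (convex_Ici 0).lipschitzOnWith_of_nnnorm_hasDerivWithin_le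
      (f' := fun x => -Real.exp (-x)) ?_ ?_
    · intro x _
      simpa using ((hasDerivAt_neg x).exp).hasDerivWithinAt
    · intro x hx
      rw [← NNReal.coe_le_coe, coe_nnnorm]
      simpa [abs_of_pos (Real.exp_pos _)] using hx
  have hBac := hβ.absolutelyContinuousOnInterval_intervalIntegral (c := 0) (by simp)
  have hEac := absolutelyContinuousOnInterval_lipschitz_comp hlip hBac (fun s hs => by
    rw [uIcc_of_le hT] at hs; exact hB0 s hs)
  have hE : ∀ s ∈ Icc 0 T, Real.exp (-∫ r in (0 : ℝ)..s, β r) =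
      1 + ∫ r in (0 : ℝ)..s, -(β r * Real.exp (-∫ q in (0 : ℝ)..r, β q)) := by
    intro s hs
    have hsub : uIcc 0 s ⊆ uIcc 0 T := by
      rw [uIcc_of_le hs.1, uIcc_of_le hT]; exact Icc_subset_Icc_right hs.2
    have h1 := (hEac.mono hsub).integral_deriv_eq_sub
    simp only [intervalIntegral.integral_same, neg_zero, Real.exp_zero] at h1
    rw [← sub_eq_iff_eq_add', ← h1]
    refine intervalIntegral.integral_congr_ae ?_
    filter_upwards [(hβ.mono_set hsub).ae_hasDerivAt_integral] with r h2 hr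
    refine ((h2 (uIoc_subset_uIcc hr) 0 (by simp)).neg.exp).deriv.trans ?_
    simp only [Pi.neg_apply]
    ring
  have hEc : ContinuousOn (fun s => Real.exp (-∫ r in (0 : ℝ)..s, β r)) (uIcc 0 T) :=
    hEac.continuousOn
  have hβφ : IntervalIntegrable (fun s => β s * φ s) volume 0 T :=
    hβ.mul_continuousOn (by rwa [uIcc_of_le hT])
  have hβE : IntervalIntegrable (fun r => -(β r * Real.exp (-∫ q in (0 : ℝ)..r, β q)))
      volume 0 T := (hβ.mul_continuousOn hEc).neg
  have key := mul_eq_add_integral (x := fun t => a + ∫ s in (0 : ℝ)..t, β s * φ s)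
    hβφ hβE (fun _ _ => rfl) hE t ht
  have hle : ∫ s in (0 : ℝ)..t, (β s * φ s * Real.exp (-∫ r in (0 : ℝ)..s, β r) +
      (a + ∫ r in (0 : ℝ)..s, β r * φ r) * -(β s * Real.exp (-∫ q in (0 : ℝ)..s, β q))) ≤ 0 := by
    rw [intervalIntegral.integral_of_le ht.1]
    refine setIntegral_nonpos measurableSet_Ioc fun s hs => ?_
    have := h s ⟨hs.1.le, hs.2.trans ht.2⟩
    have h3 := mul_nonneg (hβ0 s) (Real.exp_pos (-∫ r in (0 : ℝ)..s, β r)).le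
    nlinarith [mul_nonneg h3 (sub_nonneg.2 this)]
  have h5 : (a + ∫ s in (0 : ℝ)..t, β s * φ s) * Real.exp (-∫ r in (0 : ℝ)..t, β r) ≤ a := by
    linarith
  rw [Real.exp_neg, ← div_eq_mul_inv, div_le_iff₀ (Real.exp_pos _)] at h5
  exact (h t ht).trans h5

/-! ### The linear evolution equation -/

section Linear

variable {E : Type*} [NormedAddCommGroup E] [InnerProductSpace ℝ E]
variable {ι : Type*}

lemma norm_sq_eq_integral {α : Type*} [MeasurableSpace α] {μ : Measure α} (f : Lp E 2 μ) :
    ‖f‖ ^ 2 = ∫ x, ‖f x‖ ^ 2 ∂μ := by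
  rw [← real_inner_self_eq_norm_sq, L2.inner_def]
  simp

lemma norm_toLp_sq {α : Type*} [MeasurableSpace α] {μ : Measure α} {f : α → E}
    (hf : MemLp f 2 μ) : ‖hf.toLp f‖ ^ 2 = ∫ x, ‖f x‖ ^ 2 ∂μ := by
  rw [norm_sq_eq_integral]
  refine integral_congr_ae ?_
  filter_upwards [hf.coeFn_toLp] with x hx
  rw [hx]

lemma memLp_smul_const {α : Type*} [MeasurableSpace α] {ν : Measure α} {φ : α → ℝ}
    (hφ : MemLp φ 2 ν) (x : E) : MemLp (fun t => φ t • x) 2 ν :=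
  (ContinuousLinearMap.toSpanSingleton ℝ x).comp_memLp' hφ

lemma intervalIntegrable_of_Ioo {F : Type*} [NormedAddCommGroup F] {f : ℝ → F} {T t : ℝ}
    (hf : Integrable f (volume.restrict (Ioo 0 T))) (ht : t ∈ Icc 0 T) :
    IntervalIntegrable f volume 0 t := by
  rw [intervalIntegrable_iff_integrableOn_Ioo_of_le ht.1]
  exact hf.mono_measure (Measure.restrict_mono (Ioo_subset_Ioo_right ht.2) le_rfl)

lemma intervalIntegral_eq_of_ae_Ioo {F : Type*} [NormedAddCommGroup F] [NormedSpace ℝ F]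
    {f g : ℝ → F} {T t : ℝ} (ht : t ∈ Icc 0 T)
    (h : ∀ᵐ s ∂volume.restrict (Ioo 0 T), s ≤ t → f s = g s) :
    ∫ s in (0 : ℝ)..t, f s = ∫ s in (0 : ℝ)..t, g s := by
  rw [intervalIntegral.integral_of_le ht.1, intervalIntegral.integral_of_le ht.1,
    integral_Ioc_eq_integral_Ioo, integral_Ioc_eq_integral_Ioo]
  refine integral_congr_ae ?_
  have h2 := ae_restrict_of_ae_restrict_of_subset (Ioo_subset_Ioo_right ht.2) h
  filter_upwards [h2, ae_restrict_mem measurableSet_Ioo] with s hs h3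
  exact hs h3.2.le

lemma intervalIntegral_mono_of_ae_Ioo {f g : ℝ → ℝ} {T t : ℝ} (ht : t ∈ Icc 0 T)
    (hf : Integrable f (volume.restrict (Ioo 0 T))) (hg : Integrable g (volume.restrict (Ioo 0 T)))
    (h : ∀ᵐ s ∂volume.restrict (Ioo 0 T), f s ≤ g s) :
    ∫ s in (0 : ℝ)..t, f s ≤ ∫ s in (0 : ℝ)..t, g s := by
  have hs : Ioo 0 t ⊆ Ioo 0 T := Ioo_subset_Ioo_right ht.2
  rw [intervalIntegral.integral_of_le ht.1, intervalIntegral.integral_of_le ht.1,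
    integral_Ioc_eq_integral_Ioo, integral_Ioc_eq_integral_Ioo]
  exact integral_mono_ae (IntegrableOn.mono_set hf hs) (IntegrableOn.mono_set hg hs)
    (ae_restrict_of_ae_restrict_of_subset hs h)

lemma intervalIntegral_le_integral_Ioo {f : ℝ → ℝ} {T t : ℝ} (ht : t ∈ Icc 0 T)
    (hf : Integrable f (volume.restrict (Ioo 0 T))) (hf0 : ∀ s, 0 ≤ f s) :
    ∫ s in (0 : ℝ)..t, f s ≤ ∫ s in Ioo 0 T, f s := by
  rw [intervalIntegral.integral_of_le ht.1, integral_Ioc_eq_integral_Ioo]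
  exact setIntegral_mono_set hf (Eventually.of_forall hf0)
    (Ioo_subset_Ioo_right ht.2).eventuallyLE

lemma MemLp.integrable_of_Ioo {F : Type*} [NormedAddCommGroup F] {f : ℝ → F} {T : ℝ}
    (hf : MemLp f 2 (volume.restrict (Ioo 0 T))) :
    Integrable f (volume.restrict (Ioo 0 T)) := hf.integrable (by norm_num)

/-- `S` is diagonal in the orthonormal basis `e`, with eigenvalues `μ i ∈ (0, 1]`. It plays the role
of the inverse square root of the Stokes operator. -/
structure IsDiagonal (S : E →L[ℝ] E) (e : HilbertBasis ι ℝ E) (μ : ι → ℝ) : Prop where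
  pos : ∀ i, 0 < μ i
  le_one : ∀ i, μ i ≤ 1
  inner_apply : ∀ i x, inner ℝ (e i) (S x) = μ i * inner ℝ (e i) x

lemma eq_of_inner_basis (e : HilbertBasis ι ℝ E) {x y : E}
    (h : ∀ i, inner ℝ (e i) x = inner ℝ (e i) y) : x = y := by
  apply e.repr.injective
  ext i
  rw [e.repr_apply_apply, e.repr_apply_apply, h]

lemma hasSum_inner_mul (e : HilbertBasis ι ℝ E) (x y : E) :
    HasSum (fun i => inner ℝ (e i) x * inner ℝ (e i) y) (inner ℝ x y) := by
  simpa [real_inner_comm] using e.hasSum_inner_mul_inner x y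

lemma hasSum_inner_sq (e : HilbertBasis ι ℝ E) (x : E) :
    HasSum (fun i => inner ℝ (e i) x ^ 2) (‖x‖ ^ 2) := by
  simpa [sq, real_inner_self_eq_norm_sq] using hasSum_inner_mul e x x

namespace IsDiagonal

variable {S : E →L[ℝ] E} {e : HilbertBasis ι ℝ E} {μ : ι → ℝ}

lemma norm_apply_le (hS : IsDiagonal S e μ) (x : E) : ‖S x‖ ≤ ‖x‖ := by
  rw [← sq_le_sq₀ (norm_nonneg _) (norm_nonneg _)]
  refine hasSum_le (fun i => ?_) (hasSum_inner_sq e (S x)) (hasSum_inner_sq e x)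
  rw [hS.inner_apply, mul_pow]
  have h1 := (hS.pos i).le
  have h2 := hS.le_one i
  exact mul_le_of_le_one_left (sq_nonneg _) (pow_le_one₀ h1 h2)

lemma apply_basis (hS : IsDiagonal S e μ) (i : ι) : S (e i) = μ i • e i := by
  classical
  refine eq_of_inner_basis e fun j => ?_
  rw [hS.inner_apply, inner_smul_right, orthonormal_iff_ite.1 e.orthonormal j i]
  split_ifs with h <;> simp [h]

end IsDiagonal

/-- The linear equation `y' + A y = f`, `y(0) = y₀` in integrated form, where `A = S⁻²`, in the
unknowns `v = A^{1/2} y` and `g = A y`: thus `y = S v` on `[0, T]` and `v = S g` almost everywhere.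
Membership of `y` in `C([0,T]; D(A^{1/2})) ∩ L²(0,T; D(A))` is continuity of `v` together with
square integrability of `g`. -/
structure IsLinearSolution (S : E →L[ℝ] E) (T : ℝ) (v₀ : E) (f v g : ℝ → E) : Prop where
  continuousOn : ContinuousOn v (Icc 0 T)
  memLp_forcing : MemLp f 2 (volume.restrict (Ioo 0 T))
  memLp_top : MemLp g 2 (volume.restrict (Ioo 0 T))
  equation : ∀ t ∈ Icc 0 T, S (v t) = S v₀ + ∫ s in (0 : ℝ)..t, (f s - g s)
  ae_eq : ∀ᵐ t ∂volume.restrict (Ioo 0 T), v t = S (g t)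

namespace IsLinearSolution

variable {S : E →L[ℝ] E} {e : HilbertBasis ι ℝ E} {μ : ι → ℝ} {T : ℝ} {v₀ : E} {f v g : ℝ → E}

lemma integrable_sub (h : IsLinearSolution S T v₀ f v g) :
    Integrable (fun s => f s - g s) (volume.restrict (Ioo 0 T)) :=
  MemLp.integrable_of_Ioo (h.memLp_forcing.sub h.memLp_top)

lemma sub {v₀' : E} {f' v' g' : ℝ → E}
    (h : IsLinearSolution S T v₀ f v g) (h' : IsLinearSolution S T v₀' f' v' g') :
    IsLinearSolution S T (v₀ - v₀') (fun t => f t - f' t) (fun t => v t - v' t)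
      (fun t => g t - g' t) where
  continuousOn := h.continuousOn.sub h'.continuousOn
  memLp_forcing := h.memLp_forcing.sub h'.memLp_forcing
  memLp_top := h.memLp_top.sub h'.memLp_top
  equation t ht := by
    rw [map_sub, map_sub, h.equation t ht, h'.equation t ht, add_sub_add_comm,
      ← intervalIntegral.integral_sub (intervalIntegrable_of_Ioo h.integrable_sub ht)
        (intervalIntegrable_of_Ioo h'.integrable_sub ht)]
    congr 1
    refine intervalIntegral.integral_congr fun s _ => ?_
    abel
  ae_eq := by
    filter_upwards [h.ae_eq, h'.ae_eq] with t h1 h2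
    rw [map_sub, h1, h2]

lemma mono {T' : ℝ} (h : IsLinearSolution S T v₀ f v g) (hT : T' ≤ T) :
    IsLinearSolution S T' v₀ f v g where
  continuousOn := h.continuousOn.mono (Icc_subset_Icc_right hT)
  memLp_forcing := h.memLp_forcing.mono_measure
    (Measure.restrict_mono (Ioo_subset_Ioo_right hT) le_rfl)
  memLp_top := h.memLp_top.mono_measure
    (Measure.restrict_mono (Ioo_subset_Ioo_right hT) le_rfl)
  equation t ht := h.equation t ⟨ht.1, ht.2.trans hT⟩
  ae_eq := ae_restrict_of_ae_restrict_of_subset (Ioo_subset_Ioo_right hT) h.ae_eq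

lemma integrable_norm_sq (h : IsLinearSolution S T v₀ f v g) :
    Integrable (fun s => ‖g s‖ ^ 2) (volume.restrict (Ioo 0 T)) :=
  h.memLp_top.integrable_norm_pow (p := 2) (by norm_num)

lemma integrable_inner (h : IsLinearSolution S T v₀ f v g) :
    Integrable (fun s => inner ℝ (f s) (g s)) (volume.restrict (Ioo 0 T)) := by
  have := h.memLp_forcing.integrable_norm_pow (p := 2) (by norm_num)
  refine (this.add h.integrable_norm_sq).mono'
    (h.memLp_forcing.1.inner h.memLp_top.1) (Eventually.of_forall fun s => ?_)
  have h1 := abs_real_inner_le_norm (f s) (g s)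
  simp only [Real.norm_eq_abs, Pi.add_apply]
  nlinarith [sq_nonneg (‖f s‖ - ‖g s‖), sq_nonneg (‖f s‖), sq_nonneg (‖g s‖)]

/-- The energy identity, at the level of `A^{1/2} y`. It is the sum over the basis of the identities
for the coefficients, which are scalar absolutely continuous functions: no chain rule in a Gelfand
triple is involved. -/
theorem energy_eq [CompleteSpace E] [Countable ι] (hS : IsDiagonal S e μ)
    (h : IsLinearSolution S T v₀ f v g) {t : ℝ} (ht : t ∈ Icc 0 T) :
    ‖v t‖ ^ 2 + 2 * ∫ s in (0 : ℝ)..t, ‖g s‖ ^ 2 =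
      ‖v₀‖ ^ 2 + 2 * ∫ s in (0 : ℝ)..t, inner ℝ (f s) (g s) := by
  have hT : (0 : ℝ) ≤ T := ht.1.trans ht.2
  -- the identity for a single coefficient
  have hmode : ∀ i, inner ℝ (e i) (v t) ^ 2 - inner ℝ (e i) v₀ ^ 2 =
      ∫ s in (0 : ℝ)..t, 2 * (inner ℝ (e i) (f s - g s) * inner ℝ (e i) (g s)) := by
    intro i
    have hp : Integrable (fun s => (μ i)⁻¹ * inner ℝ (e i) (f s - g s))
        (volume.restrict (Ioo 0 T)) := (h.integrable_sub.const_inner (e i)).const_mul _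
    have hp' := intervalIntegrable_of_Ioo hp (right_mem_Icc.2 hT)
    have hx : ∀ r ∈ Icc 0 T, inner ℝ (e i) (v r) = inner ℝ (e i) v₀ +
        ∫ s in (0 : ℝ)..r, (μ i)⁻¹ * inner ℝ (e i) (f s - g s) := by
      intro r hr
      have h1 := congrArg (inner ℝ (e i)) (h.equation r hr)
      rw [inner_add_right, hS.inner_apply, hS.inner_apply,
        intervalIntegral.integral_of_le hr.1,
        ← integral_inner ((intervalIntegrable_of_Ioo h.integrable_sub hr).1),
        ← intervalIntegral.integral_of_le hr.1] at h1
      rw [intervalIntegral.integral_const_mul]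
      have := (hS.pos i).ne'
      field_simp
      linarith
    have h2 := mul_eq_add_integral hp' hp' hx hx t ht
    rw [sq, sq, h2, add_sub_cancel_left]
    refine intervalIntegral_eq_of_ae_Ioo ht ?_
    filter_upwards [h.ae_eq] with s hs _
    rw [hs, hS.inner_apply]
    have := (hS.pos i).ne'
    field_simp
    ring
  -- sum over the basis; dominated convergence allows exchanging sum and integral
  have hL : HasSum (fun i => inner ℝ (e i) (v t) ^ 2 - inner ℝ (e i) v₀ ^ 2)
      (‖v t‖ ^ 2 - ‖v₀‖ ^ 2) := (hasSum_inner_sq e _).sub (hasSum_inner_sq e _)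
  have hfg := h.memLp_forcing.sub h.memLp_top
  have hbi : Integrable (fun s => ‖f s - g s‖ ^ 2 + ‖g s‖ ^ 2) (volume.restrict (Ioo 0 T)) :=
    (hfg.integrable_norm_pow (p := 2) (by norm_num)).add h.integrable_norm_sq
  have hR : HasSum (fun i => ∫ s in (0 : ℝ)..t,
      2 * (inner ℝ (e i) (f s - g s) * inner ℝ (e i) (g s)))
      (∫ s in (0 : ℝ)..t, 2 * inner ℝ (f s - g s) (g s)) := by
    refine intervalIntegral.hasSum_integral_of_dominated_convergence
      (fun i s => inner ℝ (e i) (f s - g s) ^ 2 + inner ℝ (e i) (g s) ^ 2) ?_ ?_ ?_ ?_ ?_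
    · intro i
      have h1 : AEStronglyMeasurable (fun s => inner ℝ (e i) (f s - g s))
        (volume.restrict (Ioo 0 T)) := aestronglyMeasurable_const.inner hfg.1
      have h2 : AEStronglyMeasurable (fun s => inner ℝ (e i) (g s))
        (volume.restrict (Ioo 0 T)) := aestronglyMeasurable_const.inner h.memLp_top.1
      have h3 := (h1.mul h2).const_mul 2
      rw [uIoc_of_le ht.1, restrict_Ioo_eq_restrict_Ioc.symm]
      exact h3.mono_measure (Measure.restrict_mono (Ioo_subset_Ioo_right ht.2) le_rfl)
    · intro i
      refine Eventually.of_forall fun s _ => ?_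
      rw [Real.norm_eq_abs, abs_le]
      constructor <;> nlinarith [sq_nonneg (inner ℝ (e i) (f s - g s) + inner ℝ (e i) (g s)),
        sq_nonneg (inner ℝ (e i) (f s - g s) - inner ℝ (e i) (g s))]
    · exact Eventually.of_forall fun s _ =>
        ((hasSum_inner_sq e (f s - g s)).add (hasSum_inner_sq e (g s))).summable
    · refine (intervalIntegrable_of_Ioo hbi ht).congr ?_
      exact fun s _ => (((hasSum_inner_sq e (f s - g s)).add (hasSum_inner_sq e (g s))).tsum_eq).symm
    · exact Eventually.of_forall fun s _ => (hasSum_inner_mul e _ _).mul_left 2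
  simp only [hmode] at hL
  have h3 := hL.unique hR
  have h4 : ∫ s in (0 : ℝ)..t, 2 * inner ℝ (f s - g s) (g s) =
      2 * (∫ s in (0 : ℝ)..t, inner ℝ (f s) (g s)) - 2 * ∫ s in (0 : ℝ)..t, ‖g s‖ ^ 2 := by
    rw [intervalIntegral.integral_const_mul, ← mul_sub, ← intervalIntegral.integral_sub
      (intervalIntegrable_of_Ioo h.integrable_inner ht)
      (intervalIntegrable_of_Ioo h.integrable_norm_sq ht)]
    simp only [inner_sub_left, real_inner_self_eq_norm_sq]
  linarith

/-- Differential inequalities for `‖v‖²` in integrated form, by Gronwall's lemma. -/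
theorem energy_le [CompleteSpace E] [Countable ι] (hS : IsDiagonal S e μ)
    (h : IsLinearSolution S T v₀ f v g) {α β : ℝ → ℝ}
    (hα : Integrable α (volume.restrict (Ioo 0 T))) (hα0 : ∀ t, 0 ≤ α t)
    (hβ : Integrable β (volume.restrict (Ioo 0 T))) (hβ0 : ∀ t, 0 ≤ β t)
    (hle : ∀ᵐ t ∂volume.restrict (Ioo 0 T),
      2 * inner ℝ (f t) (g t) ≤ ‖g t‖ ^ 2 + α t + β t * ‖v t‖ ^ 2) {t : ℝ} (ht : t ∈ Icc 0 T) :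
    ‖v t‖ ^ 2 + ∫ s in (0 : ℝ)..t, ‖g s‖ ^ 2 ≤
      (‖v₀‖ ^ 2 + ∫ s in Ioo 0 T, α s) * Real.exp (∫ s in Ioo 0 T, β s) := by
  have hT : (0 : ℝ) ≤ T := ht.1.trans ht.2
  have hTm : T ∈ Icc 0 T := right_mem_Icc.2 hT
  set φ : ℝ → ℝ := fun t => ‖v t‖ ^ 2 + ∫ s in (0 : ℝ)..t, ‖g s‖ ^ 2 with hφ
  have hgc : ContinuousOn (fun t => ∫ s in (0 : ℝ)..t, ‖g s‖ ^ 2) (Icc 0 T) := by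
    have := intervalIntegral.continuousOn_primitive_interval
      ((intervalIntegrable_iff_integrableOn_Icc_of_le hT).1
        (intervalIntegrable_of_Ioo h.integrable_norm_sq hTm) |>.mono_set (uIcc_of_le hT).subset)
    rwa [uIcc_of_le hT] at this
  have hφc : ContinuousOn φ (Icc 0 T) := (h.continuousOn.norm.pow 2).add hgc
  have hβ' := intervalIntegrable_of_Ioo hβ hTm
  have hβφ : Integrable (fun s => β s * φ s) (volume.restrict (Ioo 0 T)) := by
    have := hβ'.mul_continuousOn (by rwa [uIcc_of_le hT])
    exact (intervalIntegrable_iff_integrableOn_Ioo_of_le hT).1 this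
  have hβv : Integrable (fun s => β s * ‖v s‖ ^ 2) (volume.restrict (Ioo 0 T)) := by
    have := hβ'.mul_continuousOn (g := fun s => ‖v s‖ ^ 2)
      (by rw [uIcc_of_le hT]; exact h.continuousOn.norm.pow 2)
    exact (intervalIntegrable_iff_integrableOn_Ioo_of_le hT).1 this
  have hmain : ∀ t ∈ Icc 0 T, φ t ≤ (‖v₀‖ ^ 2 + ∫ s in Ioo 0 T, α s) +
      ∫ s in (0 : ℝ)..t, β s * φ s := by
    intro t ht
    have h1 := h.energy_eq hS ht
    have hgα : Integrable (fun s => ‖g s‖ ^ 2 + α s) (volume.restrict (Ioo 0 T)) :=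
      h.integrable_norm_sq.add hα
    have h2 := intervalIntegral_mono_of_ae_Ioo ht (h.integrable_inner.const_mul 2)
      (hgα.add hβv) hle
    simp only [Pi.add_apply] at h2
    rw [intervalIntegral.integral_const_mul, intervalIntegral.integral_add
      (intervalIntegrable_of_Ioo hgα ht)
      (intervalIntegrable_of_Ioo hβv ht), intervalIntegral.integral_add
      (intervalIntegrable_of_Ioo h.integrable_norm_sq ht) (intervalIntegrable_of_Ioo hα ht)] at h2
    have h3 := intervalIntegral_le_integral_Ioo ht hα hα0
    have h4 : ∫ s in (0 : ℝ)..t, β s * ‖v s‖ ^ 2 ≤ ∫ s in (0 : ℝ)..t, β s * φ s := by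
      refine intervalIntegral_mono_of_ae_Ioo ht hβv hβφ ?_
      filter_upwards [ae_restrict_mem measurableSet_Ioo] with s hs
      refine mul_le_mul_of_nonneg_left ?_ (hβ0 s)
      have := intervalIntegral.integral_nonneg (μ := volume) hs.1.le
        (fun r _ => sq_nonneg ‖g r‖)
      simp only [hφ]; linarith
    simp only [hφ] at *
    linarith
  have h5 := gronwall_integrable hφc hβ' hβ0 hmain t ht
  refine h5.trans (mul_le_mul_of_nonneg_left ?_ ?_)
  · exact Real.exp_le_exp.2 (intervalIntegral_le_integral_Ioo ht hβ hβ0)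
  · have : 0 ≤ ∫ s in Ioo 0 T, α s := integral_nonneg hα0
    positivity

/-- Maximal regularity: the solution is controlled by the data. -/
theorem energy_le_forcing [CompleteSpace E] [Countable ι] (hS : IsDiagonal S e μ)
    (h : IsLinearSolution S T v₀ f v g) {t : ℝ} (ht : t ∈ Icc 0 T) :
    ‖v t‖ ^ 2 + ∫ s in (0 : ℝ)..t, ‖g s‖ ^ 2 ≤ ‖v₀‖ ^ 2 + ∫ s in Ioo 0 T, ‖f s‖ ^ 2 := by
  have := h.energy_le hS (α := fun t => ‖f t‖ ^ 2) (β := 0)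
    (h.memLp_forcing.integrable_norm_pow (p := 2) (by norm_num)) (fun t => sq_nonneg _)
    (integrable_zero _ _ _) (fun t => le_rfl) (Eventually.of_forall fun t => by
      have := real_inner_le_norm (f t) (g t)
      simp only [Pi.zero_apply]
      nlinarith [sq_nonneg (‖f t‖ - ‖g t‖)]) ht
  simpa using this

end IsLinearSolution

end Linear

/-! ### Solvability of the linear equation -/

section LinearExistence

open scoped BoundedContinuousFunction

variable {E : Type*} [NormedAddCommGroup E] [InnerProductSpace ℝ E]
variable {ι : Type*} {S : E →L[ℝ] E} {e : HilbertBasis ι ℝ E} {μ : ι → ℝ} {T : ℝ}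

/-- The variation of constants formula solves a single mode `y' + κ y = φ`. -/
lemma exists_scalar_linear (κ y₀ : ℝ) {φ : ℝ → ℝ} (hT : 0 ≤ T)
    (hφ : IntervalIntegrable φ volume 0 T) :
    ∃ y : ℝ → ℝ, ContinuousOn y (Icc 0 T) ∧
      ∀ t ∈ Icc 0 T, y t = y₀ + ∫ s in (0 : ℝ)..t, (φ s - κ * y s) := by
  have hE : ∀ t ∈ Icc 0 T, Real.exp (-κ * t) =
      1 + ∫ s in (0 : ℝ)..t, -κ * Real.exp (-κ * s) := by
    intro t _
    have hd : ∀ s ∈ uIcc 0 t, HasDerivAt (fun s => Real.exp (-κ * s))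
        (-κ * Real.exp (-κ * s)) s := by
      intro s _
      have := ((hasDerivAt_id s).const_mul (-κ)).exp
      simpa [mul_comm] using this
    rw [intervalIntegral.integral_eq_sub_of_hasDerivAt hd
      (Continuous.intervalIntegrable (by fun_prop) _ _)]
    simp
  have hp : IntervalIntegrable (fun s => Real.exp (κ * s) * φ s) volume 0 T :=
    hφ.continuousOn_mul (by fun_prop)
  have hq : IntervalIntegrable (fun s => -κ * Real.exp (-κ * s)) volume 0 T :=
    Continuous.intervalIntegrable (by fun_prop) _ _
  have hm := mul_eq_add_integral
    (x := fun t => y₀ + ∫ s in (0 : ℝ)..t, Real.exp (κ * s) * φ s) hp hq (fun _ _ => rfl) hE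
  refine ⟨fun t => (y₀ + ∫ s in (0 : ℝ)..t, Real.exp (κ * s) * φ s) * Real.exp (-κ * t), ?_, ?_⟩
  · have := intervalIntegral.continuousOn_primitive_interval
      ((intervalIntegrable_iff_integrableOn_Icc_of_le hT).1 hp
        |>.mono_set (uIcc_of_le hT).subset)
    rw [uIcc_of_le hT] at this
    exact (continuousOn_const.add this).mul (by fun_prop)
  · intro t ht
    beta_reduce
    rw [hm t ht, mul_one]
    congr 1
    refine intervalIntegral.integral_congr fun s _ => ?_
    have h1 : Real.exp (κ * s) * Real.exp (-κ * s) = 1 := by rw [← Real.exp_add]; simp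
    linear_combination φ s * h1

/-- The solutions of the linear equation, as a subspace of the space of tuples `(v₀, f, v, g)`; the
function `v` is extended to the whole line by its values at the end points. The equation is tested against
constant vectors on `[0, t]`, which makes closedness evident. -/
def linearSolutions (S : E →L[ℝ] E) (T : ℝ) :
    Submodule ℝ (E × Lp E 2 (volume.restrict (Ioo 0 T)) × (ℝ →ᵇ E) ×
      Lp E 2 (volume.restrict (Ioo 0 T))) where
  carrier := {x | (∀ t ∈ Icc 0 T, ∀ c, inner ℝ c (S (x.2.2.1 t)) = inner ℝ c (S x.1) +
      inner ℝ (indicatorConstLp 2 (measurableSet_Ioo (a := 0) (b := t)) (by finiteness) c :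
        Lp E 2 (volume.restrict (Ioo 0 T))) (x.2.1 - x.2.2.2)) ∧
    (∀ t, x.2.2.1 t = x.2.2.1 (max 0 (min T t))) ∧
    BoundedContinuousFunction.toLp (E := E) 2 (volume.restrict (Ioo 0 T)) ℝ x.2.2.1 =
      S.compLpL 2 (volume.restrict (Ioo 0 T)) x.2.2.2}
  zero_mem' := by simp
  add_mem' := by
    rintro x y ⟨hx1, hx2, hx3⟩ ⟨hy1, hy2, hy3⟩
    refine ⟨fun t ht c => ?_, fun t => ?_, ?_⟩
    · simp only [Prod.snd_add, Prod.fst_add, BoundedContinuousFunction.coe_add, Pi.add_apply,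
        map_add, inner_add_right, hx1 t ht, hy1 t ht, add_sub_add_comm]
      ring
    · simp only [Prod.snd_add, Prod.fst_add, BoundedContinuousFunction.coe_add, Pi.add_apply]
      rw [hx2, hy2]
    · simp only [Prod.snd_add, Prod.fst_add, map_add, hx3, hy3]
  smul_mem' := by
    rintro r x ⟨hx1, hx2, hx3⟩
    refine ⟨fun t ht c => ?_, fun t => ?_, ?_⟩
    · simp only [Prod.smul_snd, Prod.smul_fst, BoundedContinuousFunction.coe_smul, map_smul,
        inner_smul_right, hx1 t ht, ← smul_sub]
      ring
    · simp only [Prod.smul_snd, Prod.smul_fst, BoundedContinuousFunction.coe_smul]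
      rw [hx2]
    · simp only [Prod.smul_snd, Prod.smul_fst, map_smul, hx3]

lemma isClosed_linearSolutions (S : E →L[ℝ] E) (T : ℝ) :
    IsClosed (linearSolutions S T : Set (E × Lp E 2 (volume.restrict (Ioo 0 T)) × (ℝ →ᵇ E) ×
      Lp E 2 (volume.restrict (Ioo 0 T)))) := by
  have hev : ∀ t, Continuous fun x : E × Lp E 2 (volume.restrict (Ioo 0 T)) × (ℝ →ᵇ E) ×
      Lp E 2 (volume.restrict (Ioo 0 T)) => x.2.2.1 t := fun t =>
    (BoundedContinuousFunction.lipschitz_eval_const t).continuous.comp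
      (continuous_fst.comp (continuous_snd.comp continuous_snd))
  simp only [linearSolutions, Submodule.coe_set_mk, AddSubmonoid.coe_set_mk,
    AddSubsemigroup.coe_set_mk, Set.ofPred_and, Set.ofPred_forall]
  refine .inter ?_ (.inter ?_ ?_)
  · refine isClosed_iInter fun t => isClosed_iInter fun _ => isClosed_iInter fun c => ?_
    have := hev t
    exact isClosed_eq (by fun_prop) (by fun_prop)
  · exact isClosed_iInter fun t => isClosed_eq (hev _) (hev _)
  · exact isClosed_eq (by fun_prop) (by fun_prop)

lemma inner_indicatorConstLp_sub [CompleteSpace E] {t : ℝ} (ht : t ∈ Icc 0 T) (c : E)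
    (f g : Lp E 2 (volume.restrict (Ioo 0 T))) :
    inner ℝ (indicatorConstLp 2 (measurableSet_Ioo (a := 0) (b := t)) (by finiteness) c :
      Lp E 2 (volume.restrict (Ioo 0 T))) (f - g) =
    inner ℝ c (∫ s in (0 : ℝ)..t, (f s - g s)) := by
  rw [L2.inner_indicatorConstLp_eq_inner_setIntegral, intervalIntegral.integral_of_le ht.1,
    integral_Ioc_eq_integral_Ioo, Measure.restrict_restrict measurableSet_Ioo,
    inter_eq_left.2 (Ioo_subset_Ioo_right ht.2)]
  congr 1
  exact integral_congr_ae (ae_restrict_of_ae_restrict_of_subset (Ioo_subset_Ioo_right ht.2)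
    (Lp.coeFn_sub f g))

lemma IsLinearSolution.of_mem [CompleteSpace E] {v₀ : E}
    {f g : Lp E 2 (volume.restrict (Ioo 0 T))} {v : ℝ →ᵇ E}
    (h : (v₀, f, v, g) ∈ linearSolutions S T) : IsLinearSolution S T v₀ f v g where
  continuousOn := v.continuous.continuousOn
  memLp_forcing := Lp.memLp f
  memLp_top := Lp.memLp g
  equation t ht := by
    refine ext_inner_left ℝ fun c => ?_
    rw [h.1 t ht c, inner_add_right, inner_indicatorConstLp_sub ht]
  ae_eq := by
    have h1 := BoundedContinuousFunction.coeFn_toLp 2 (volume.restrict (Ioo 0 T)) ℝ v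
    rw [h.2.2] at h1
    filter_upwards [h1, S.coeFn_compLpL (p := 2) g] with t h2 h3
    rw [← h2, h3]

lemma IsLinearSolution.exists_mem [CompleteSpace E] {v₀ : E} {f v g : ℝ → E} (hT : 0 ≤ T)
    (h : IsLinearSolution S T v₀ f v g) :
    ∃ w : ℝ →ᵇ E, (v₀, h.memLp_forcing.toLp f, w, h.memLp_top.toLp g) ∈ linearSolutions S T := by
  have hproj : ∀ t, max 0 (min T t) ∈ Icc 0 T := fun t =>
    ⟨le_max_left _ _, max_le hT (min_le_left _ _)⟩
  have hid : ∀ t ∈ Icc 0 T, max 0 (min T t) = t := fun t ht => by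
    rw [min_eq_right ht.2, max_eq_right ht.1]
  have hc : Continuous fun t => v (max 0 (min T t)) :=
    h.continuousOn.comp_continuous (by fun_prop) hproj
  obtain ⟨C, hC⟩ := isCompact_Icc.exists_bound_of_continuousOn h.continuousOn
  refine ⟨.ofNormedAddCommGroup _ hc C fun t => hC _ (hproj t), ?_, ?_, ?_⟩
  · intro t ht c
    rw [inner_indicatorConstLp_sub ht]
    simp only [BoundedContinuousFunction.coe_ofNormedAddCommGroup, hid t ht, h.equation t ht,
      inner_add_right]
    congr 2
    refine intervalIntegral_eq_of_ae_Ioo ht ?_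
    filter_upwards [h.memLp_forcing.coeFn_toLp, h.memLp_top.coeFn_toLp] with s h1 h2 _
    rw [h1, h2]
  · intro t
    simp only [BoundedContinuousFunction.coe_ofNormedAddCommGroup, hid _ (hproj t)]
  · refine Lp.ext ?_
    filter_upwards [h.ae_eq, h.memLp_top.coeFn_toLp,
      BoundedContinuousFunction.coeFn_toLp 2 (volume.restrict (Ioo 0 T)) ℝ
        (.ofNormedAddCommGroup _ hc C fun t => hC _ (hproj t)),
      S.coeFn_compLpL (p := 2) (h.memLp_top.toLp g), ae_restrict_mem measurableSet_Ioo]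
      with t h1 h2 h3 h4 ht
    rw [h3, h4, h2, ← h1]
    simp only [BoundedContinuousFunction.coe_ofNormedAddCommGroup, hid t (Ioo_subset_Icc_self ht)]

/-- The energy estimate: a solution is controlled by its data, so that the map from solutions to data
is antilipschitz. -/
lemma norm_le_of_mem_linearSolutions [CompleteSpace E] [Countable ι] (hS : IsDiagonal S e μ)
    (hT : 0 ≤ T) {x : E × Lp E 2 (volume.restrict (Ioo 0 T)) × (ℝ →ᵇ E) ×
      Lp E 2 (volume.restrict (Ioo 0 T))} (hx : x ∈ linearSolutions S T) :
    ‖x‖ ≤ 2 * ‖(x.1, x.2.1)‖ := by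
  obtain ⟨v₀, f, v, g⟩ := x
  have h := IsLinearSolution.of_mem hx
  set m := ‖(v₀, f)‖ with hm
  have h1 : ‖v₀‖ ≤ m := le_max_left _ _
  have h2 : ‖f‖ ≤ m := le_max_right _ _
  have hm0 : 0 ≤ m := norm_nonneg _
  have hle : ∀ t ∈ Icc 0 T, ‖v t‖ ^ 2 + ∫ s in (0 : ℝ)..t, ‖g s‖ ^ 2 ≤ (2 * m) ^ 2 := by
    intro t ht
    have := h.energy_le_forcing hS ht
    rw [← norm_sq_eq_integral] at this
    nlinarith [norm_nonneg v₀, norm_nonneg f]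
  have hv : ‖v‖ ≤ 2 * m := by
    rw [BoundedContinuousFunction.norm_le (by positivity)]
    intro t
    have hp : max 0 (min T t) ∈ Icc 0 T := ⟨le_max_left _ _, max_le hT (min_le_left _ _)⟩
    have h3 := hle _ hp
    have h4 := hx.2.1 t
    simp only at h4
    rw [h4]
    have h5 := intervalIntegral.integral_nonneg (μ := volume) hp.1
      (fun r _ => sq_nonneg ‖g r‖)
    exact abs_le_of_sq_le_sq' (by linarith) (by positivity) |>.2
  have hg : ‖g‖ ≤ 2 * m := by
    have h3 := hle T (right_mem_Icc.2 hT)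
    rw [intervalIntegral.integral_of_le hT, integral_Ioc_eq_integral_Ioo,
      ← norm_sq_eq_integral] at h3
    exact abs_le_of_sq_le_sq' (by nlinarith [sq_nonneg ‖v T‖]) (by positivity) |>.2
  exact max_le (by linarith) (max_le (by linarith) (max_le hv hg))

lemma isLinearSolution_mode [CompleteSpace E] (hS : IsDiagonal S e μ) (hT : 0 ≤ T) (i : ι) (c : ℝ)
    {φ : ℝ → ℝ} (hφ : MemLp φ 2 (volume.restrict (Ioo 0 T))) :
    ∃ v g, IsLinearSolution S T (c • e i) (fun t => φ t • e i) v g := by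
  have hφi := intervalIntegrable_of_Ioo (MemLp.integrable_of_Ioo hφ) (right_mem_Icc.2 hT)
  obtain ⟨y, hy, hy'⟩ := exists_scalar_linear ((μ i)⁻¹ ^ 2) (μ i * c) hT hφi
  have hμ := (hS.pos i).ne'
  have hysub : ContinuousOn y (Ioo 0 T) := hy.mono Ioo_subset_Icc_self
  refine ⟨fun t => ((μ i)⁻¹ * y t) • e i, fun t => ((μ i)⁻¹ ^ 2 * y t) • e i, ?_, ?_, ?_, ?_, ?_⟩
  · fun_prop
  · exact memLp_smul_const hφ _
  · obtain ⟨C, hC⟩ := isCompact_Icc.exists_bound_of_continuousOn hy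
    have : MemLp y 2 (volume.restrict (Ioo 0 T)) :=
      MemLp.of_bound (hysub.aestronglyMeasurable measurableSet_Ioo) C
        (ae_restrict_of_forall_mem measurableSet_Ioo fun t ht => hC t (Ioo_subset_Icc_self ht))
    exact memLp_smul_const (this.const_mul _) _
  · intro t ht
    simp only [map_smul, hS.apply_basis, ← sub_smul]
    rw [intervalIntegral.integral_smul_const, smul_smul, smul_smul, ← add_smul, mul_comm c,
      ← hy' t ht]
    congr 1
    field_simp
  · refine Eventually.of_forall fun t => ?_
    simp only [map_smul, hS.apply_basis, smul_smul]
    congr 1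
    field_simp

/-- Solvability of the linear equation with square integrable forcing. The data for which it is
solvable form a closed subspace by the energy estimate, and it contains all single modes. -/
theorem exists_isLinearSolution [CompleteSpace E] [Countable ι] (hS : IsDiagonal S e μ)
    (hT : 0 ≤ T) (v₀ : E) (f : Lp E 2 (volume.restrict (Ioo 0 T))) :
    ∃ v g, IsLinearSolution S T v₀ f v g := by
  let W := linearSolutions S T
  let π : W →L[ℝ] E × Lp E 2 (volume.restrict (Ioo 0 T)) :=
    ((ContinuousLinearMap.fst ℝ _ _).prod
      ((ContinuousLinearMap.fst ℝ _ _).comp (ContinuousLinearMap.snd ℝ _ _))).comp W.subtypeL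
  have : CompleteSpace W := (isClosed_linearSolutions S T).completeSpace_coe
  have hπ : AntilipschitzWith 2 π := π.antilipschitz_of_bound fun x =>
    norm_le_of_mem_linearSolutions hS hT x.2
  have hcl : IsClosed (π.range : Set (E × Lp E 2 (volume.restrict (Ioo 0 T)))) := by
    exact hπ.isClosed_range π.uniformContinuous
  have hmode : ∀ i (c : ℝ) (φ : ℝ → ℝ) (hφ : MemLp φ 2 (volume.restrict (Ioo 0 T))),
      (c • e i, (memLp_smul_const hφ (e i)).toLp (fun t => φ t • e i)) ∈ π.range := by
    intro i c φ hφ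
    obtain ⟨v, g, h⟩ := isLinearSolution_mode hS hT i c hφ
    obtain ⟨w, hw⟩ := h.exists_mem hT
    exact ⟨⟨_, hw⟩, rfl⟩
  have h1 : ∀ x : E, (x, 0) ∈ π.range := by
    let R₁ : Submodule ℝ E := π.range.comap (LinearMap.inl ℝ E _)
    have hR₁ : IsClosed (R₁ : Set E) := hcl.preimage (f := fun x : E => (x, 0)) (by fun_prop)
    have : (⊤ : Submodule ℝ E) ≤ R₁ := by
      rw [← e.dense_span]
      refine Submodule.topologicalClosure_minimal _ (Submodule.span_le.2 ?_) hR₁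
      rintro _ ⟨i, rfl⟩
      have hz : MemLp (fun _ => (0 : ℝ)) 2 (volume.restrict (Ioo 0 T)) := MemLp.zero'
      have h0 : (memLp_smul_const hz (e i)).toLp (fun _ => (0 : ℝ) • e i) = 0 := by
        refine Lp.ext ?_
        filter_upwards [(memLp_smul_const hz (e i)).coeFn_toLp, Lp.coeFn_zero E 2 _] with t h1 h2
        rw [h1, h2, zero_smul, Pi.zero_apply]
      have := hmode i 1 _ hz
      rwa [one_smul, h0] at this
    exact fun x => this (Submodule.mem_top (x := x))
  have h2 : ∀ x : Lp E 2 (volume.restrict (Ioo 0 T)), (0, x) ∈ π.range := by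
    let R₂ : Submodule ℝ (Lp E 2 (volume.restrict (Ioo 0 T))) :=
      π.range.comap (LinearMap.inr ℝ E _)
    have hR₂ : IsClosed (R₂ : Set (Lp E 2 (volume.restrict (Ioo 0 T)))) :=
      hcl.preimage (f := fun x : Lp E 2 (volume.restrict (Ioo 0 T)) => ((0 : E), x))
        (by fun_prop)
    have : CompleteSpace R₂ := hR₂.completeSpace_coe
    have htop : R₂ = ⊤ := by
      rw [← Submodule.orthogonal_eq_bot_iff, eq_bot_iff]
      intro w hw
      rw [Submodule.mem_orthogonal] at hw
      -- test against the coefficients of `w` itself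
      have hi : ∀ i, ∀ᵐ t ∂volume.restrict (Ioo 0 T), inner ℝ (e i) (w t) = 0 := by
        intro i
        have hwi : MemLp (fun t => inner ℝ (e i) (w t)) 2 (volume.restrict (Ioo 0 T)) :=
          (Lp.memLp w).const_inner (e i)
        have hm := hmode i 0 _ hwi
        rw [zero_smul] at hm
        set F := (memLp_smul_const hwi (e i)).toLp (fun t => inner ℝ (e i) (w t) • e i) with hF
        have h3 : inner ℝ F w = 0 := hw F hm
        rw [L2.inner_def] at h3
        have h4 : ∫ t, inner ℝ (e i) (w t) ^ 2 ∂volume.restrict (Ioo 0 T) = 0 := by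
          refine Eq.trans ?_ h3
          refine integral_congr_ae ?_
          filter_upwards [(memLp_smul_const hwi (e i)).coeFn_toLp] with t ht
          rw [hF, ht, inner_smul_left]
          simp [sq]
        rw [integral_eq_zero_iff_of_nonneg (fun _ => sq_nonneg _) hwi.integrable_sq] at h4
        filter_upwards [h4] with t ht
        simpa using ht
      rw [Submodule.mem_bot]
      refine Lp.ext ?_
      filter_upwards [ae_all_iff.2 hi, Lp.coeFn_zero E 2 _] with t h5 h6
      rw [h6]
      exact eq_of_inner_basis e fun i => by simp [h5 i]
    intro x
    have : x ∈ R₂ := htop ▸ Submodule.mem_top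
    exact this
  have h3 : (v₀, f) ∈ π.range := by
    have := add_mem (h1 v₀) (h2 f)
    simpa using this
  obtain ⟨⟨⟨v₀', f', v, g⟩, hx⟩, hxe⟩ := h3
  obtain ⟨rfl, rfl⟩ := Prod.mk.inj hxe
  exact ⟨v, g, .of_mem hx⟩

end LinearExistence

/-! ### Continuation of solutions of the nonlinear equation -/

section Continuation

variable {E : Type*} [NormedAddCommGroup E] [InnerProductSpace ℝ E]
variable {ι : Type*} {S : E →L[ℝ] E} {e : HilbertBasis ι ℝ E} {μ : ι → ℝ} {T : ℝ}

lemma IsLinearSolution.congr_forcing {v₀ : E} {f f' v g : ℝ → E}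
    (h : IsLinearSolution S T v₀ f v g) (hf : ∀ᵐ t ∂volume.restrict (Ioo 0 T), f t = f' t) :
    IsLinearSolution S T v₀ f' v g where
  continuousOn := h.continuousOn
  memLp_forcing := h.memLp_forcing.ae_eq hf
  memLp_top := h.memLp_top
  equation t ht := by
    rw [h.equation t ht]
    congr 1
    refine intervalIntegral_eq_of_ae_Ioo ht ?_
    filter_upwards [hf] with s hs _
    rw [hs]
  ae_eq := h.ae_eq

lemma exists_isLinearSolution_of_memLp [CompleteSpace E] [Countable ι] (hS : IsDiagonal S e μ)
    (hT : 0 ≤ T) (v₀ : E) {f : ℝ → E} (hf : MemLp f 2 (volume.restrict (Ioo 0 T))) :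
    ∃ v g, IsLinearSolution S T v₀ f v g := by
  obtain ⟨v, g, h⟩ := exists_isLinearSolution hS hT v₀ (hf.toLp f)
  exact ⟨v, g, h.congr_forcing hf.coeFn_toLp⟩

/-- The solution of the linear equation depends on the forcing causally. -/
lemma IsLinearSolution.eq_of_forcing_eq [CompleteSpace E] [Countable ι] (hS : IsDiagonal S e μ)
    {v₀ : E} {f f' v v' g g' : ℝ → E} (h : IsLinearSolution S T v₀ f v g)
    (h' : IsLinearSolution S T v₀ f' v' g') {a : ℝ} (ha : a ∈ Icc 0 T)
    (hf : ∀ᵐ t ∂volume.restrict (Ioo 0 T), t < a → f t = f' t) :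
    (∀ t ∈ Icc 0 a, v t = v' t) ∧ ∀ᵐ t ∂volume.restrict (Ioo 0 T), t < a → g t = g' t := by
  have hd := (h.sub h').mono ha.2
  have hle : ∀ t ∈ Icc 0 a, ‖v t - v' t‖ ^ 2 + ∫ s in (0 : ℝ)..t, ‖g s - g' s‖ ^ 2 ≤ 0 := by
    intro t ht
    refine (hd.energy_le_forcing hS ht).trans (le_of_eq ?_)
    have h0 : ∫ s in Ioo 0 a, ‖f s - f' s‖ ^ 2 = 0 := by
      refine integral_eq_zero_of_ae ?_
      filter_upwards [ae_restrict_of_ae_restrict_of_subset (Ioo_subset_Ioo_right ha.2) hf,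
        ae_restrict_mem measurableSet_Ioo] with s h1 h2
      simp [h1 h2.2]
    simp [h0]
  have hint : ∀ t ∈ Icc 0 a, 0 ≤ ∫ s in (0 : ℝ)..t, ‖g s - g' s‖ ^ 2 := fun t ht =>
    intervalIntegral.integral_nonneg ht.1 fun _ _ => sq_nonneg _
  constructor
  · intro t ht
    have h1 := hle t ht
    have h2 := hint t ht
    have h3 : ‖v t - v' t‖ ^ 2 = 0 := le_antisymm (by linarith) (sq_nonneg _)
    exact sub_eq_zero.1 (norm_eq_zero.1 (pow_eq_zero_iff two_ne_zero |>.1 h3))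
  · have h1 := hle a (right_mem_Icc.2 ha.1)
    have h2 := hint a (right_mem_Icc.2 ha.1)
    have h3 : ∫ s in Ioo 0 a, ‖g s - g' s‖ ^ 2 = 0 := by
      rw [← integral_Ioc_eq_integral_Ioo, ← intervalIntegral.integral_of_le ha.1]
      nlinarith [sq_nonneg ‖v a - v' a‖]
    rw [integral_eq_zero_iff_of_nonneg (fun _ => sq_nonneg _) hd.integrable_norm_sq] at h3
    rw [EventuallyEq, ae_restrict_iff' measurableSet_Ioo] at h3
    rw [ae_restrict_iff' measurableSet_Ioo]
    filter_upwards [h3] with t ht ht1 ht2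
    simpa [sub_eq_zero] using ht ⟨ht1.1, ht2⟩

/-- Local Lipschitz and growth conditions on a nonlinearity `N t v g` which depends on
`v = A^{1/2} y` and `g = A y`, on the ball `‖v‖ ≤ R`. The powers of `‖g‖` are such that `N` is a small
perturbation over short time intervals. -/
structure IsAdmissible (S : E →L[ℝ] E) (T : ℝ) (N : ℝ → E → E → E) (k : ℝ → ℝ) (K R : ℝ) :
    Prop where
  nonneg : 0 ≤ K
  integrable : Integrable k (volume.restrict (Ioo 0 T))
  coeff_nonneg : ∀ t, 0 ≤ k t
  measurable : ∀ v g : ℝ → E, ContinuousOn v (Icc 0 T) → MemLp g 2 (volume.restrict (Ioo 0 T)) →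
    AEStronglyMeasurable (fun t => N t (v t) (g t)) (volume.restrict (Ioo 0 T))
  bound : ∀ᵐ t ∂volume.restrict (Ioo 0 T), ∀ g, ‖S g‖ ≤ R →
    ‖N t (S g) g‖ ^ 2 ≤ K * (k t + ‖g‖)
  lipschitz : ∀ᵐ t ∂volume.restrict (Ioo 0 T), ∀ g g', ‖S g‖ ≤ R → ‖S g'‖ ≤ R →
    ‖N t (S g) g - N t (S g') g'‖ ^ 2 ≤
      K * ((k t + ‖g'‖) * ‖S (g - g')‖ ^ 2 + ‖S (g - g')‖ * ‖g - g'‖)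

lemma IsAdmissible.memLp {N : ℝ → E → E → E} {k : ℝ → ℝ} {K R : ℝ} (hN : IsAdmissible S T N k K R)
    {v g : ℝ → E} (hv : ContinuousOn v (Icc 0 T)) (hg : MemLp g 2 (volume.restrict (Ioo 0 T)))
    (hvg : ∀ᵐ t ∂volume.restrict (Ioo 0 T), v t = S (g t)) (hR : ∀ t ∈ Icc 0 T, ‖v t‖ ≤ R) :
    MemLp (fun t => N t (v t) (g t)) 2 (volume.restrict (Ioo 0 T)) := by
  have hm := hN.measurable v g hv hg
  refine (memLp_two_iff_integrable_sq_norm hm).2 ?_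
  refine Integrable.mono' (g := fun t => K * (k t + ‖g t‖))
    ((hN.integrable.add (MemLp.integrable_of_Ioo hg).norm).const_mul K) (hm.norm.pow 2) ?_
  filter_upwards [hN.bound, hvg, ae_restrict_mem measurableSet_Ioo] with t h1 h2 h3
  rw [Real.norm_of_nonneg (sq_nonneg _), h2]
  exact h1 _ (h2 ▸ hR t (Ioo_subset_Icc_self h3))

lemma integral_norm_le_sqrt_mul {F : Type*} [NormedAddCommGroup F] {g : ℝ → F} {a b m : ℝ}
    (hg : MemLp g 2 (volume.restrict (Ioo 0 T)))
    (ha : 0 ≤ a) (hab : a ≤ b) (hb : b ≤ T) (hm : 0 ≤ m)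
    (hgm : ∫ s in Ioo 0 T, ‖g s‖ ^ 2 ≤ m ^ 2) :
    ∫ s in Ioo a b, ‖g s‖ ≤ √(b - a) * m := by
  have hφ := hg.norm
  have h1 := real_inner_le_norm (indicatorConstLp 2 (measurableSet_Ioo (a := a) (b := b))
    (by finiteness) (1 : ℝ) : Lp ℝ 2 (volume.restrict (Ioo 0 T))) (hφ.toLp _)
  have hsub : Ioo a b ⊆ Ioo 0 T := Ioo_subset_Ioo ha hb
  have h2 : ‖hφ.toLp _‖ ≤ m := by
    refine abs_le_of_sq_le_sq' ?_ hm |>.2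
    rw [norm_toLp_sq]
    simpa using hgm
  rw [L2.inner_indicatorConstLp_one, norm_indicatorConstLp (by simp) (by simp),
    Measure.restrict_restrict measurableSet_Ioo, inter_eq_left.2 hsub] at h1
  have h3 : ∫ s in Ioo a b, (hφ.toLp _) s = ∫ s in Ioo a b, ‖g s‖ :=
    integral_congr_ae (ae_restrict_of_ae_restrict_of_subset hsub hφ.coeFn_toLp)
  rw [h3, measureReal_restrict_apply measurableSet_Ioo, inter_eq_left.2 hsub,
    Real.volume_real_Ioo_of_le hab] at h1
  have h4 : (b - a) ^ (1 / (2 : ℝ≥0∞).toReal) = √(b - a) := by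
    rw [Real.sqrt_eq_rpow]; simp
  rw [h4, norm_one, one_mul] at h1
  exact h1.trans (mul_le_mul_of_nonneg_left h2 (Real.sqrt_nonneg _))

lemma add_norm_sq_integral_le {g g' : ℝ → E} {m m' : ℝ} {ν : Measure ℝ}
    (hg : MemLp g 2 ν) (hg' : MemLp g' 2 ν) (hm : 0 ≤ m) (hm' : 0 ≤ m')
    (h : ∫ s, ‖g s‖ ^ 2 ∂ν ≤ m ^ 2) (h' : ∫ s, ‖g' s - g s‖ ^ 2 ∂ν ≤ m' ^ 2) :
    ∫ s, ‖g' s‖ ^ 2 ∂ν ≤ (m + m') ^ 2 := by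
  have hd : MemLp (fun s => g' s - g s) 2 ν := hg'.sub hg
  have h1 : ‖hg.toLp g‖ ≤ m := abs_le_of_sq_le_sq' (by rwa [norm_toLp_sq]) hm |>.2
  have h2 : ‖hd.toLp _‖ ≤ m' := abs_le_of_sq_le_sq' (by rwa [norm_toLp_sq]) hm' |>.2
  have h3 : hg'.toLp g' = hg.toLp g + hd.toLp _ := by
    rw [← MemLp.toLp_add]
    congr 1
    ext s; simp
  rw [← norm_toLp_sq hg', h3]
  have h4 := norm_add_le (hg.toLp g) (hd.toLp _)
  exact pow_le_pow_left₀ (norm_nonneg _) (h4.trans (by linarith)) 2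

/-- One continuation step. A solution of the nonlinear equation up to time `a`, continued without
forcing, is modified on `(a, b)` by an additional forcing `d`; the equation up to time `b` is a fixed
point problem for `d`, which is contractive on the unit ball if `b - a` is small. -/
lemma exists_extension [CompleteSpace E] [Countable ι] (hS : IsDiagonal S e μ)
    {N : ℝ → E → E → E} {k : ℝ → ℝ} {K ρ : ℝ} (hρ : 0 ≤ ρ) (hN : IsAdmissible S T N k K (ρ + 1))
    {v₀ : E} {a b : ℝ} (ha : 0 ≤ a) (hab : a ≤ b) (hb : b ≤ T)
    (hsmall : K * ((∫ s in Ioo a b, k s) + √(b - a) * (ρ + 2)) ≤ 1 / 4)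
    {f₁ v₁ g₁ : ℝ → E} (h₁ : IsLinearSolution S T v₀ f₁ v₁ g₁)
    (hf₁ : ∀ᵐ t ∂volume.restrict (Ioo 0 T),
      (t < a → f₁ t = N t (v₁ t) (g₁ t)) ∧ (a ≤ t → f₁ t = 0))
    (hbd : ∀ t ∈ Icc 0 T, ‖v₁ t‖ ^ 2 + ∫ s in (0 : ℝ)..t, ‖g₁ s‖ ^ 2 ≤ ρ ^ 2) :
    ∃ f v g, IsLinearSolution S T v₀ f v g ∧ ∀ᵐ t ∂volume.restrict (Ioo 0 T),
      (t < b → f t = N t (v t) (g t)) ∧ (b ≤ t → f t = 0) := by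
  have hT : 0 ≤ T := ha.trans (hab.trans hb)
  have hTm : T ∈ Icc 0 T := right_mem_Icc.2 hT
  have hsub : Ioo a b ⊆ Ioo 0 T := Ioo_subset_Ioo ha hb
  -- the linear solution with the additional forcing `d` on `(a, b)`
  have hex : ∀ d : Lp E 2 (volume.restrict (Ioo 0 T)), ∃ v g,
      IsLinearSolution S T v₀ (fun t => f₁ t + (Ioo a b).indicator d t) v g := fun d =>
    exists_isLinearSolution_of_memLp hS hT v₀
      (h₁.memLp_forcing.add ((Lp.memLp d).indicator measurableSet_Ioo))
  choose V Γ hsol using hex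
  have hind : ∀ d : Lp E 2 (volume.restrict (Ioo 0 T)),
      ∫ s in Ioo 0 T, ‖(Ioo a b).indicator d s‖ ^ 2 ≤ ‖d‖ ^ 2 := by
    intro d
    rw [norm_sq_eq_integral]
    refine integral_mono_ae
      (((Lp.memLp d).indicator measurableSet_Ioo).integrable_norm_pow (p := 2) (by norm_num))
      ((Lp.memLp d).integrable_norm_pow (p := 2) (by norm_num)) (Eventually.of_forall fun s => ?_)
    exact pow_le_pow_left₀ (norm_nonneg _) (norm_indicator_le_norm_self _ _) 2
  have hdiff : ∀ d d' : Lp E 2 (volume.restrict (Ioo 0 T)), ∀ t ∈ Icc 0 T,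
      ‖V d t - V d' t‖ ^ 2 + ∫ s in (0 : ℝ)..t, ‖Γ d s - Γ d' s‖ ^ 2 ≤ ‖d - d'‖ ^ 2 := by
    intro d d' t ht
    have h2 := ((hsol d).sub (hsol d')).energy_le_forcing hS ht
    rw [sub_self, norm_zero, zero_pow two_ne_zero, zero_add] at h2
    refine h2.trans (le_trans (le_of_eq ?_) (hind (d - d')))
    refine integral_congr_ae ?_
    filter_upwards [Lp.coeFn_sub d d'] with s hs
    by_cases hsI : s ∈ Ioo a b
    · rw [indicator_of_mem hsI, indicator_of_mem hsI, indicator_of_mem hsI, hs, Pi.sub_apply,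
        add_sub_add_left_eq_sub]
    · simp [hsI]
  have hdiff₁ : ∀ d : Lp E 2 (volume.restrict (Ioo 0 T)), ∀ t ∈ Icc 0 T,
      ‖V d t - v₁ t‖ ^ 2 + ∫ s in (0 : ℝ)..t, ‖Γ d s - g₁ s‖ ^ 2 ≤ ‖d‖ ^ 2 := by
    intro d t ht
    have h2 := ((hsol d).sub h₁).energy_le_forcing hS ht
    rw [sub_self, norm_zero, zero_pow two_ne_zero, zero_add] at h2
    refine h2.trans (le_trans (le_of_eq ?_) (hind d))
    simp
  have hnn : ∀ (γ : ℝ → E) (t : ℝ), t ∈ Icc 0 T → 0 ≤ ∫ s in (0 : ℝ)..t, ‖γ s‖ ^ 2 :=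
    fun γ t ht => intervalIntegral.integral_nonneg ht.1 fun _ _ => sq_nonneg _
  have hconv : ∀ γ : ℝ → E, ∫ s in (0 : ℝ)..T, ‖γ s‖ ^ 2 = ∫ s in Ioo 0 T, ‖γ s‖ ^ 2 :=
    fun γ => by rw [intervalIntegral.integral_of_le hT, integral_Ioc_eq_integral_Ioo]
  have hVb : ∀ d : Lp E 2 (volume.restrict (Ioo 0 T)), ‖d‖ ≤ 1 → ∀ t ∈ Icc 0 T,
      ‖V d t‖ ≤ ρ + 1 := by
    intro d hd t ht
    have h2 : ‖V d t - v₁ t‖ ≤ ‖d‖ := abs_le_of_sq_le_sq'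
      (by linarith [hdiff₁ d t ht, hnn (fun s => Γ d s - g₁ s) t ht]) (norm_nonneg _) |>.2
    have h3 : ‖v₁ t‖ ≤ ρ := abs_le_of_sq_le_sq'
      (by linarith [hbd t ht, hnn g₁ t ht]) hρ |>.2
    have h4 := norm_add_le (V d t - v₁ t) (v₁ t)
    rw [sub_add_cancel] at h4
    linarith
  have hΓb : ∀ d : Lp E 2 (volume.restrict (Ioo 0 T)), ‖d‖ ≤ 1 →
      ∫ s in Ioo 0 T, ‖Γ d s‖ ^ 2 ≤ (ρ + 1) ^ 2 := by
    intro d hd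
    refine add_norm_sq_integral_le h₁.memLp_top (hsol d).memLp_top hρ zero_le_one ?_ ?_
    · rw [← hconv]
      nlinarith [hbd T hTm, sq_nonneg ‖v₁ T‖]
    · rw [← hconv fun s => Γ d s - g₁ s]
      nlinarith [hdiff₁ d T hTm, sq_nonneg ‖V d T - v₁ T‖, norm_nonneg d]
  -- integrated bounds for the nonlinearity on `(a, b)`
  have hkab : Integrable k (volume.restrict (Ioo a b)) := hN.integrable.mono_measure
    (Measure.restrict_mono hsub le_rfl)
  have hnormab : ∀ {γ : ℝ → E}, MemLp γ 2 (volume.restrict (Ioo 0 T)) →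
      Integrable (fun s => ‖γ s‖) (volume.restrict (Ioo a b)) := fun hγ =>
    ((MemLp.integrable_of_Ioo hγ).mono_measure (Measure.restrict_mono hsub le_rfl)).norm
  have hmeasN : ∀ d, AEStronglyMeasurable (fun t => N t (V d t) (Γ d t))
      (volume.restrict (Ioo 0 T)) := fun d =>
    hN.measurable _ _ (hsol d).continuousOn (hsol d).memLp_top
  have hptb : ∀ d : Lp E 2 (volume.restrict (Ioo 0 T)), ‖d‖ ≤ 1 →
      ∀ᵐ t ∂volume.restrict (Ioo 0 T), ‖N t (V d t) (Γ d t)‖ ^ 2 ≤ K * (k t + ‖Γ d t‖) := by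
    intro d hd
    filter_upwards [hN.bound, (hsol d).ae_eq, ae_restrict_mem measurableSet_Ioo] with t h2 h3 ht
    have h4 := hVb d hd t (Ioo_subset_Icc_self ht)
    rw [h3] at h4 ⊢
    exact h2 _ h4
  have hmem : ∀ d : Lp E 2 (volume.restrict (Ioo 0 T)), ‖d‖ ≤ 1 →
      MemLp ((Ioo a b).indicator fun t => N t (V d t) (Γ d t)) 2 (volume.restrict (Ioo 0 T)) := by
    intro d hd
    refine MemLp.indicator measurableSet_Ioo ?_
    rw [memLp_two_iff_integrable_sq_norm (hmeasN d)]
    refine ((hN.integrable.add (MemLp.integrable_of_Ioo (hsol d).memLp_top).norm).const_mul K).mono'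
      ((hmeasN d).norm.pow 2) ?_
    filter_upwards [hptb d hd] with t ht
    rw [Real.norm_eq_abs, abs_of_nonneg (sq_nonneg _)]
    exact ht
  have hnormind : ∀ γ : ℝ → E, ∫ s in Ioo 0 T, ‖(Ioo a b).indicator γ s‖ ^ 2 =
      ∫ s in Ioo a b, ‖γ s‖ ^ 2 := by
    intro γ
    have h2 : ∀ s, ‖(Ioo a b).indicator γ s‖ ^ 2 = (Ioo a b).indicator (fun s => ‖γ s‖ ^ 2) s :=
      fun s => by by_cases hs : s ∈ Ioo a b <;> simp [hs]
    simp only [h2]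
    rw [setIntegral_indicator measurableSet_Ioo, inter_eq_right.2 hsub]
  classical
  let Ψ : Lp E 2 (volume.restrict (Ioo 0 T)) → Lp E 2 (volume.restrict (Ioo 0 T)) := fun d =>
    if hd : ‖d‖ ≤ 1 then (hmem d hd).toLp _ else 0
  have hΨ : ∀ d (hd : ‖d‖ ≤ 1), Ψ d = (hmem d hd).toLp _ := fun d hd => dif_pos hd
  have hsq : 0 ≤ √(b - a) := Real.sqrt_nonneg _
  have hΨb : ∀ d, ‖d‖ ≤ 1 → ‖Ψ d‖ ≤ 1 := by
    intro d hd
    refine abs_le_of_sq_le_sq' ?_ zero_le_one |>.2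
    rw [hΨ d hd, norm_toLp_sq, hnormind]
    have h2 : ∫ s in Ioo a b, ‖N s (V d s) (Γ d s)‖ ^ 2 ≤
        ∫ s in Ioo a b, K * (k s + ‖Γ d s‖) := by
      refine integral_mono_of_nonneg (Eventually.of_forall fun _ => sq_nonneg _)
        ((hkab.add (hnormab (hsol d).memLp_top)).const_mul K)
        (ae_restrict_of_ae_restrict_of_subset hsub (hptb d hd))
    rw [integral_const_mul, integral_add hkab (hnormab (hsol d).memLp_top)] at h2
    have h3 := integral_norm_le_sqrt_mul (hsol d).memLp_top ha hab hb (by linarith) (hΓb d hd)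
    have h4 : K * ((∫ s in Ioo a b, k s) + ∫ s in Ioo a b, ‖Γ d s‖) ≤
        K * ((∫ s in Ioo a b, k s) + √(b - a) * (ρ + 2)) :=
      mul_le_mul_of_nonneg_left (by nlinarith) hN.nonneg
    linarith
  have hΨl : ∀ d d', ‖d‖ ≤ 1 → ‖d'‖ ≤ 1 → ‖Ψ d - Ψ d'‖ ≤ 1 / 2 * ‖d - d'‖ := by
    intro d d' hd hd'
    set ε := ‖d - d'‖ with hε
    have hε0 : 0 ≤ ε := norm_nonneg _
    refine abs_le_of_sq_le_sq' ?_ (by positivity) |>.2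
    rw [hΨ d hd, hΨ d' hd', ← MemLp.toLp_sub, norm_toLp_sq, ← indicator_sub', hnormind]
    simp only [Pi.sub_apply]
    have hγ := (hsol d).memLp_top.sub (hsol d').memLp_top
    have h2 : ∫ s in Ioo a b, ‖N s (V d s) (Γ d s) - N s (V d' s) (Γ d' s)‖ ^ 2 ≤
        ∫ s in Ioo a b, K * ((k s + ‖Γ d' s‖) * ε ^ 2 + ε * ‖(Γ d - Γ d') s‖) := by
      refine integral_mono_of_nonneg (Eventually.of_forall fun _ => sq_nonneg _)
        ((((hkab.add (hnormab (hsol d').memLp_top)).mul_const _).add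
          ((hnormab hγ).const_mul ε)).const_mul K) ?_
      refine ae_restrict_of_ae_restrict_of_subset hsub ?_
      filter_upwards [hN.lipschitz, (hsol d).ae_eq, (hsol d').ae_eq,
        ae_restrict_mem measurableSet_Ioo] with t h2 h3 h4 ht
      have ht' := Ioo_subset_Icc_self ht
      have h5 := hVb d hd t ht'
      have h6 := hVb d' hd' t ht'
      have h7 : ‖V d t - V d' t‖ ≤ ε := abs_le_of_sq_le_sq'
        (by linarith [hdiff d d' t ht', hnn (fun s => Γ d s - Γ d' s) t ht']) hε0 |>.2
      rw [h3, h4, ← map_sub] at h7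
      rw [h3] at h5 ⊢
      rw [h4] at h6 ⊢
      refine (h2 _ _ h5 h6).trans (mul_le_mul_of_nonneg_left ?_ hN.nonneg)
      have h8 := hN.coeff_nonneg t
      gcongr
      rfl
    have hΓi : ∫ s in Ioo 0 T, ‖(Γ d - Γ d') s‖ ^ 2 ≤ ε ^ 2 := by
      rw [← hconv]
      have := hdiff d d' T hTm
      simp only [Pi.sub_apply]
      nlinarith [sq_nonneg ‖V d T - V d' T‖]
    have h3 := integral_norm_le_sqrt_mul hγ ha hab hb hε0 hΓi
    have h4 := integral_norm_le_sqrt_mul (hsol d').memLp_top ha hab hb (by linarith) (hΓb d' hd')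
    rw [integral_const_mul, integral_add
      (by exact (hkab.add (hnormab (hsol d').memLp_top)).mul_const _) ((hnormab hγ).const_mul ε),
      integral_const_mul, integral_mul_const,
      integral_add hkab (hnormab (hsol d').memLp_top)] at h2
    have h5 : K * (((∫ s in Ioo a b, k s) + ∫ s in Ioo a b, ‖Γ d' s‖) * ε ^ 2 +
        ε * ∫ s in Ioo a b, ‖(Γ d - Γ d') s‖) ≤
        K * ((∫ s in Ioo a b, k s) + √(b - a) * (ρ + 2)) * ε ^ 2 := by
      rw [mul_assoc]
      refine mul_le_mul_of_nonneg_left ?_ hN.nonneg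
      have h6 := mul_le_mul_of_nonneg_left h3 hε0
      have h7 := mul_le_mul_of_nonneg_right h4 (sq_nonneg ε)
      nlinarith
    have h6 := mul_le_mul_of_nonneg_right hsmall (sq_nonneg ε)
    nlinarith
  -- the fixed point
  have hmaps : MapsTo Ψ (Metric.closedBall 0 1) (Metric.closedBall 0 1) := by
    intro d hd
    rw [mem_closedBall_zero_iff] at hd ⊢
    exact hΨb d hd
  have hcontr : ContractingWith (1 / 2) (hmaps.restrict Ψ _ _) := by
    refine ⟨by norm_num, LipschitzWith.of_dist_le_mul ?_⟩
    rintro ⟨d, hd⟩ ⟨d', hd'⟩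
    rw [mem_closedBall_zero_iff] at hd hd'
    have := hΨl d d' hd hd'
    rw [← dist_eq_norm, ← dist_eq_norm] at this
    simpa [Subtype.dist_eq] using this
  obtain ⟨d, hd, hfix, -⟩ := hcontr.exists_fixedPoint' (Metric.isClosed_closedBall.isComplete) hmaps
    (Metric.mem_closedBall_self zero_le_one) (edist_ne_top _ _)
  rw [mem_closedBall_zero_iff] at hd
  have hfix' : d = (hmem d hd).toLp _ := by rw [← hΨ d hd]; exact hfix.symm
  have hdae : ∀ᵐ t ∂volume.restrict (Ioo 0 T),
      d t = (Ioo a b).indicator (fun t => N t (V d t) (Γ d t)) t := by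
    have := (hmem d hd).coeFn_toLp
    rw [← hfix'] at this
    exact this
  have hcausal := (hsol d).eq_of_forcing_eq hS h₁ (a := a) ⟨ha, hab.trans hb⟩
    (Eventually.of_forall fun t ht => by simp [ht.le.not_gt])
  refine ⟨_, _, _, hsol d, ?_⟩
  have hane : ∀ᵐ t ∂volume.restrict (Ioo 0 T), t ≠ a :=
    ae_restrict_of_ae (Measure.ae_ne volume a)
  filter_upwards [hf₁, hdae, hcausal.2, ae_restrict_mem measurableSet_Ioo, hane]
    with t h2 h3 h4 ht hta
  constructor
  · intro htb
    rcases lt_or_gt_of_ne hta with hlt | hgt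
    · rw [indicator_of_notMem (fun h => hlt.not_gt h.1), add_zero, h4 hlt,
        hcausal.1 t ⟨ht.1.le, hlt.le⟩]
      exact h2.1 hlt
    · have hI : t ∈ Ioo a b := ⟨hgt, htb⟩
      rw [indicator_of_mem hI, h2.2 hgt.le, zero_add, h3, indicator_of_mem hI]
  · intro hbt
    rw [indicator_of_notMem (fun h => hbt.not_gt h.2), add_zero]
    exact h2.2 (hab.trans hbt)

/-- Global solvability of the nonlinear equation, given an a priori bound for the solutions up to an
arbitrary time (continued by the linear equation without forcing). -/
theorem exists_nonlinear_solution [CompleteSpace E] [Countable ι] (hS : IsDiagonal S e μ)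
    (hT : 0 ≤ T) {N : ℝ → E → E → E} {k : ℝ → ℝ} {K ρ : ℝ} (hρ : 0 ≤ ρ)
    (hN : IsAdmissible S T N k K (ρ + 1)) (v₀ : E)
    (hap : ∀ f v g, IsLinearSolution S T v₀ f v g →
      (∀ᵐ t ∂volume.restrict (Ioo 0 T), f t = N t (v t) (g t) ∨ f t = 0) →
      ∀ t ∈ Icc 0 T, ‖v t‖ ^ 2 + ∫ s in (0 : ℝ)..t, ‖g s‖ ^ 2 ≤ ρ ^ 2) :
    ∃ f v g, IsLinearSolution S T v₀ f v g ∧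
      ∀ᵐ t ∂volume.restrict (Ioo 0 T), f t = N t (v t) (g t) := by
  have hTm : T ∈ Icc 0 T := right_mem_Icc.2 hT
  have hki := intervalIntegrable_of_Ioo hN.integrable hTm
  -- a uniform step length
  obtain ⟨σ, hσ, hstep⟩ : ∃ σ > 0, ∀ a b, 0 ≤ a → a ≤ b → b ≤ T → b - a < σ →
      K * ((∫ s in Ioo a b, k s) + √(b - a) * (ρ + 2)) ≤ 1 / 4 := by
    set J : ℝ → ℝ := fun t => ∫ s in (0 : ℝ)..t, k s with hJ
    have hJc : ContinuousOn J (Icc 0 T) := by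
      have := intervalIntegral.continuousOn_primitive_interval
        ((intervalIntegrable_iff_integrableOn_Icc_of_le hT).1 hki
          |>.mono_set (uIcc_of_le hT).subset)
      rwa [uIcc_of_le hT] at this
    set J₂ : ℝ × ℝ → ℝ := fun p => K * ((J p.2 - J p.1) + √(p.2 - p.1) * (ρ + 2)) with hJ₂
    have hJ₂c : ContinuousOn J₂ (Icc 0 T ×ˢ Icc 0 T) := by
      have h1 := hJc.comp (continuousOn_fst (s := Icc 0 T ×ˢ Icc 0 T)) (fun p hp => hp.1)
      have h2 := hJc.comp (continuousOn_snd (s := Icc 0 T ×ˢ Icc 0 T)) (fun p hp => hp.2)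
      exact ((h2.sub h1).add (by fun_prop)).const_mul K
    have huc := (isCompact_Icc.prod isCompact_Icc).uniformContinuousOn_of_continuous hJ₂c
    rw [Metric.uniformContinuousOn_iff] at huc
    obtain ⟨σ, hσ, h⟩ := huc (1 / 4) (by norm_num)
    refine ⟨σ, hσ, fun a b ha hab hb hlt => ?_⟩
    have haI : a ∈ Icc 0 T := ⟨ha, hab.trans hb⟩
    have hbI : b ∈ Icc 0 T := ⟨ha.trans hab, hb⟩
    have h1 := h (a, b) ⟨haI, hbI⟩ (a, a) ⟨haI, haI⟩ (by
      rw [Prod.dist_eq, dist_self, max_eq_right dist_nonneg, Real.dist_eq,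
        abs_of_nonneg (sub_nonneg.2 hab)]
      exact hlt)
    have h2 : J₂ (a, a) = 0 := by simp [hJ₂]
    have h3 : ∫ s in Ioo a b, k s = J b - J a := by
      rw [hJ, intervalIntegral.integral_interval_sub_left
        (intervalIntegrable_of_Ioo hN.integrable hbI) (intervalIntegrable_of_Ioo hN.integrable haI),
        intervalIntegral.integral_of_le hab, integral_Ioc_eq_integral_Ioo]
    rw [h2, Real.dist_eq, sub_zero] at h1
    rw [h3]
    exact (le_abs_self _).trans h1.le
  have hind : ∀ n : ℕ, ∃ f v g, IsLinearSolution S T v₀ f v g ∧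
      ∀ᵐ t ∂volume.restrict (Ioo 0 T), (t < min (n * (σ / 2)) T → f t = N t (v t) (g t)) ∧
        (min (n * (σ / 2)) T ≤ t → f t = 0) := by
    intro n
    induction n with
    | zero =>
      obtain ⟨v, g, h⟩ := exists_isLinearSolution_of_memLp hS hT v₀
        (MemLp.zero' (p := 2) (μ := volume.restrict (Ioo 0 T)) (ε := E))
      refine ⟨_, v, g, h, ?_⟩
      filter_upwards [ae_restrict_mem measurableSet_Ioo] with t ht
      refine ⟨fun h => absurd h ?_, fun _ => rfl⟩
      simp [hT, ht.1.le]
    | succ n ih =>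
      obtain ⟨f, v, g, h, hf⟩ := ih
      refine exists_extension hS hρ hN (a := min (n * (σ / 2)) T) (by positivity) ?_
        (min_le_right _ _) (hstep _ _ (by positivity) ?_ (min_le_right _ _) ?_) h hf
        (hap f v g h ?_)
      · push_cast; gcongr; linarith
      · push_cast; gcongr; linarith
      · have : min ((n + 1 : ℕ) * (σ / 2)) T ≤ min (n * (σ / 2)) T + σ / 2 := by
          rw [← min_add_add_right]
          push_cast
          exact min_le_min (by linarith) (by linarith)
        linarith
      · filter_upwards [hf] with t ht
        exact (lt_or_ge t (min (n * (σ / 2)) T)).imp ht.1 ht.2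
  obtain ⟨n, hn⟩ := exists_nat_ge (T / (σ / 2))
  obtain ⟨f, v, g, h, hf⟩ := hind n
  refine ⟨f, v, g, h, ?_⟩
  rw [min_eq_right ((div_le_iff₀ (by positivity)).1 hn)] at hf
  filter_upwards [hf, ae_restrict_mem measurableSet_Ioo] with t h1 h2
  exact h1.1 h2.2

end Continuation

/-! ### The controlled equation in abstract form -/

section Controlled

variable {E : Type*} [NormedAddCommGroup E] [InnerProductSpace ℝ E]
variable {K : Type*} [NormedAddCommGroup K] [InnerProductSpace ℝ K]
variable {ι : Type*} {S : E →L[ℝ] E} {e : HilbertBasis ι ℝ E} {μ : ι → ℝ} {T : ℝ}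

/-- Properties of the bilinear map `b f g = B(A⁻¹ f, A⁻¹ g)` of the two-dimensional periodic
Navier–Stokes equation. The bound is `|B(u, v)|² ≤ C ‖u‖ |A u| ‖v‖²`, and the second property is the
enstrophy balance `(B(u, u), A u) = 0`. -/
structure IsConvective (S : E →L[ℝ] E) (b : E →L[ℝ] E →L[ℝ] E) (C : ℝ) : Prop where
  nonneg : 0 ≤ C
  bound : ∀ f g, ‖b f g‖ ^ 2 ≤ C * ‖S f‖ * ‖f‖ * ‖S g‖ ^ 2
  enstrophy : ∀ g, inner ℝ (b g g) g = 0

/-- Lipschitz continuity and linear growth of the noise coefficient in the operator norm. -/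
structure IsLipschitzNoise (G : E → K →L[ℝ] E) (c : ℝ) : Prop where
  nonneg : 0 ≤ c
  lipschitz : ∀ u w, ‖G u - G w‖ ≤ c * ‖u - w‖
  growth : ∀ u, ‖G u‖ ≤ c * (1 + ‖u‖)

/-- The terms of the controlled equation other than `A y`, for `y = S v = A⁻¹ g` and
`u = S q = A⁻¹ p`. -/
def controlForce (S : E →L[ℝ] E) (b : E →L[ℝ] E →L[ℝ] E) (G : E → K →L[ℝ] E) (δ : ℝ) (h : ℝ → K)
    (q p : ℝ → E) (t : ℝ) (v g : E) : E :=
  G (δ • S (q t) + (1 - δ) • S v) (h t) - (1 - δ) • b g g - δ • b (p t) g - δ • b g (p t)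

variable {b : E →L[ℝ] E →L[ℝ] E} {G : E → K →L[ℝ] E} {C c : ℝ} {h : ℝ → K} {q p : ℝ → E}

lemma controlForce_zero (t : ℝ) (v g : E) :
    controlForce S b G 0 h q p t v g = G (S v) (h t) - b g g := by
  simp [controlForce]

lemma controlForce_one (t : ℝ) (v g : E) :
    controlForce S b G 1 h q p t v g = G (S (q t)) (h t) - b (p t) g - b g (p t) := by
  simp [controlForce]

lemma IsLipschitzNoise.norm_apply_sq_le (hG : IsLipschitzNoise G c) (u : E) (x : K) :
    ‖G u x‖ ^ 2 ≤ c ^ 2 * (1 + ‖u‖) ^ 2 * ‖x‖ ^ 2 := by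
  rw [← mul_pow, ← mul_pow]
  refine pow_le_pow_left₀ (norm_nonneg _) ?_ 2
  exact ((G u).le_opNorm x).trans (mul_le_mul_of_nonneg_right (hG.growth u) (norm_nonneg _))

lemma IsLipschitzNoise.norm_sub_apply_sq_le (hG : IsLipschitzNoise G c) (u w : E) (x : K) :
    ‖G u x - G w x‖ ^ 2 ≤ c ^ 2 * ‖u - w‖ ^ 2 * ‖x‖ ^ 2 := by
  rw [← mul_pow, ← mul_pow, ← sub_apply]
  refine pow_le_pow_left₀ (norm_nonneg _) ?_ 2
  exact ((G u - G w).le_opNorm x).trans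
    (mul_le_mul_of_nonneg_right (hG.lipschitz u w) (norm_nonneg _))

lemma IsLipschitzNoise.continuous (hG : IsLipschitzNoise G c) : Continuous G :=
  (LipschitzWith.of_dist_le_mul (K := ⟨c, hG.nonneg⟩) fun u w => by
    rw [dist_eq_norm, dist_eq_norm]; exact hG.lipschitz u w).continuous

/-- Absorption of the linearised convective terms into the dissipation `‖γ‖²`: by Young's inequality,
each of the three terms costs a quarter of it. -/
lemma IsConvective.two_inner_le (hb : IsConvective S b C) {R : ℝ} (hS : ∀ x, ‖S x‖ ≤ ‖x‖)
    {P Q : E} (hQ : ‖S Q‖ ≤ R) (z γ : E) :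
    2 * inner ℝ (z - b P γ - b γ Q) γ ≤
      ‖γ‖ ^ 2 + 4 * ‖z‖ ^ 2 + (4 * C * ‖P‖ ^ 2 + 128 * C ^ 2 * R ^ 2 * ‖Q‖ ^ 2) * ‖S γ‖ ^ 2 := by
  have hC := hb.nonneg
  have hx := norm_nonneg γ
  have ha := norm_nonneg (S γ)
  have hm := norm_nonneg (S Q)
  have h1 : 2 * inner ℝ z γ ≤ ‖γ‖ ^ 2 / 4 + 4 * ‖z‖ ^ 2 := by
    have := real_inner_le_norm z γ
    nlinarith [sq_nonneg (‖γ‖ / 2 - 2 * ‖z‖)]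
  have h2 : -(2 * inner ℝ (b P γ) γ) ≤ ‖γ‖ ^ 2 / 4 + 4 * C * ‖P‖ ^ 2 * ‖S γ‖ ^ 2 := by
    have h3 := neg_le_of_abs_le (abs_real_inner_le_norm (b P γ) γ)
    have h4 : ‖b P γ‖ ^ 2 ≤ C * ‖P‖ ^ 2 * ‖S γ‖ ^ 2 := by
      refine (hb.bound P γ).trans (mul_le_mul_of_nonneg_right ?_ (sq_nonneg _))
      rw [mul_assoc, sq]
      exact mul_le_mul_of_nonneg_left (mul_le_mul_of_nonneg_right (hS P) (norm_nonneg _)) hC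
    nlinarith [sq_nonneg (‖γ‖ / 2 - 2 * ‖b P γ‖)]
  -- `b γ Q` is only bounded by a multiple of `(‖S γ‖ ‖γ‖)^{1/2}`, whence a second use of
  -- Young's inequality
  have h5 : -(2 * inner ℝ (b γ Q) γ) ≤
      ‖γ‖ ^ 2 / 4 + 128 * C ^ 2 * R ^ 2 * ‖Q‖ ^ 2 * ‖S γ‖ ^ 2 := by
    have h3 := neg_le_of_abs_le (abs_real_inner_le_norm (b γ Q) γ)
    have h4 := hb.bound γ Q
    have h6 : 8 * (C * ‖S γ‖ * ‖γ‖ * ‖S Q‖ ^ 2) ≤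
        ‖γ‖ ^ 2 / 8 + 128 * (C * ‖S γ‖ * ‖S Q‖ ^ 2) ^ 2 := by
      nlinarith [sq_nonneg (‖γ‖ - 32 * (C * ‖S γ‖ * ‖S Q‖ ^ 2))]
    have h7 : (C * ‖S γ‖ * ‖S Q‖ ^ 2) ^ 2 ≤ C ^ 2 * R ^ 2 * ‖Q‖ ^ 2 * ‖S γ‖ ^ 2 := by
      have h8 : ‖S Q‖ ^ 2 ≤ R * ‖Q‖ := by
        rw [sq]; exact mul_le_mul hQ (hS Q) hm (hm.trans hQ)
      calc (C * ‖S γ‖ * ‖S Q‖ ^ 2) ^ 2 = (C * ‖S γ‖) ^ 2 * (‖S Q‖ ^ 2) ^ 2 := by ring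
        _ ≤ (C * ‖S γ‖) ^ 2 * (R * ‖Q‖) ^ 2 := by gcongr
        _ = _ := by ring
    nlinarith [sq_nonneg (‖γ‖ - 8 * ‖b γ Q‖)]
  rw [inner_sub_left, inner_sub_left]
  nlinarith

variable {v₀ : E} {f v g : ℝ → E}

lemma IsLinearSolution.exists_norm_le (hl : IsLinearSolution S T v₀ f v g) :
    ∃ R, 0 ≤ R ∧ ∀ t ∈ Icc 0 T, ‖v t‖ ≤ R := by
  obtain ⟨R, hR⟩ := isCompact_Icc.exists_bound_of_continuousOn hl.continuousOn
  exact ⟨max R 0, le_max_right _ _, fun t ht => (hR t ht).trans (le_max_left _ _)⟩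

/-- A priori bound for the controlled Navier–Stokes equation. The convective term drops out. The
alternative `f t = 0` admits solutions up to some time, continued without forcing. -/
theorem bound_of_controlForce_zero [CompleteSpace E] [Countable ι] (hS : IsDiagonal S e μ)
    (hb : IsConvective S b C) (hG : IsLipschitzNoise G c)
    (hh : MemLp h 2 (volume.restrict (Ioo 0 T)))
    (hl : IsLinearSolution S T v₀ f v g)
    (hf : ∀ᵐ t ∂volume.restrict (Ioo 0 T),
      f t = controlForce S b G 0 h q p t (v t) (g t) ∨ f t = 0) {t : ℝ} (ht : t ∈ Icc 0 T) :
    ‖v t‖ ^ 2 + ∫ s in (0 : ℝ)..t, ‖g s‖ ^ 2 ≤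
      (‖v₀‖ ^ 2 + 2 * c ^ 2 * ∫ s in Ioo 0 T, ‖h s‖ ^ 2) *
        Real.exp (2 * c ^ 2 * ∫ s in Ioo 0 T, ‖h s‖ ^ 2) := by
  have hhi := hh.integrable_norm_pow (p := 2) (by norm_num)
  rw [← integral_const_mul]
  refine hl.energy_le hS (hhi.const_mul _) (fun t => by positivity) (hhi.const_mul _)
    (fun t => by positivity) ?_ ht
  filter_upwards [hf] with s hs
  rcases hs with hs | hs
  · rw [hs, controlForce_zero, inner_sub_left, hb.enstrophy, sub_zero]
    have h1 := hG.norm_apply_sq_le (S (v s)) (h s)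
    have h2 := real_inner_le_norm (G (S (v s)) (h s)) (g s)
    have h3 : (1 + ‖S (v s)‖) ^ 2 ≤ 2 + 2 * ‖v s‖ ^ 2 := by
      have := hS.norm_apply_le (v s)
      nlinarith [norm_nonneg (S (v s)), sq_nonneg (1 - ‖v s‖)]
    have h4 : c ^ 2 * (1 + ‖S (v s)‖) ^ 2 * ‖h s‖ ^ 2 ≤
        c ^ 2 * (2 + 2 * ‖v s‖ ^ 2) * ‖h s‖ ^ 2 := by gcongr
    nlinarith [sq_nonneg (‖G (S (v s)) (h s)‖ - ‖g s‖)]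
  · rw [hs, inner_zero_left, mul_zero]
    positivity

/-- A priori bound for the controlled linearised equation, where the coefficient `q` is bounded by `R`.
The alternative `f t = 0` admits solutions up to some time, continued without forcing. -/
theorem bound_of_controlForce_one [CompleteSpace E] [Countable ι] (hS : IsDiagonal S e μ)
    (hb : IsConvective S b C) (hG : IsLipschitzNoise G c)
    (hh : MemLp h 2 (volume.restrict (Ioo 0 T)))
    {R : ℝ} (hq : ∀ t ∈ Icc 0 T, ‖q t‖ ≤ R) (hp : MemLp p 2 (volume.restrict (Ioo 0 T)))
    (hqp : ∀ᵐ t ∂volume.restrict (Ioo 0 T), q t = S (p t))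
    (hl : IsLinearSolution S T v₀ f v g)
    (hf : ∀ᵐ t ∂volume.restrict (Ioo 0 T),
      f t = controlForce S b G 1 h q p t (v t) (g t) ∨ f t = 0) {t : ℝ} (ht : t ∈ Icc 0 T) :
    ‖v t‖ ^ 2 + ∫ s in (0 : ℝ)..t, ‖g s‖ ^ 2 ≤
      (‖v₀‖ ^ 2 + 4 * c ^ 2 * (1 + R) ^ 2 * ∫ s in Ioo 0 T, ‖h s‖ ^ 2) *
        Real.exp ((4 * C + 128 * C ^ 2 * R ^ 2) * ∫ s in Ioo 0 T, ‖p s‖ ^ 2) := by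
  have hhi := hh.integrable_norm_pow (p := 2) (by norm_num)
  have hpi := hp.integrable_norm_pow (p := 2) (by norm_num)
  have hC := hb.nonneg
  rw [← integral_const_mul, ← integral_const_mul]
  refine hl.energy_le hS (hhi.const_mul _) (fun t => by positivity) (hpi.const_mul _)
    (fun t => by positivity) ?_ ht
  filter_upwards [hf, hqp, hl.ae_eq, ae_restrict_mem measurableSet_Ioo] with s hs hqs hvs hsI
  have hR := hq s (Ioo_subset_Icc_self hsI)
  rcases hs with hs | hs
  · rw [hs, controlForce_one]
    have h1 := hG.norm_apply_sq_le (S (q s)) (h s)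
    have h3 : (1 + ‖S (q s)‖) ^ 2 ≤ (1 + R) ^ 2 := by
      have := hS.norm_apply_le (q s)
      gcongr
      exact this.trans hR
    have h4 : c ^ 2 * (1 + ‖S (q s)‖) ^ 2 * ‖h s‖ ^ 2 ≤
        c ^ 2 * (1 + R) ^ 2 * ‖h s‖ ^ 2 := by gcongr
    have h5 := hb.two_inner_le hS.norm_apply_le (P := p s) (Q := p s) (R := R)
      (by rwa [← hqs]) (G (S (q s)) (h s)) (g s)
    rw [← hvs] at h5
    nlinarith
  · rw [hs, inner_zero_left, mul_zero]
    positivity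

/-- Uniqueness for the controlled equation, in either of its two forms. -/
theorem eqOn_of_controlForce [CompleteSpace E] [Countable ι] (hS : IsDiagonal S e μ)
    (hb : IsConvective S b C) (hG : IsLipschitzNoise G c)
    (hh : MemLp h 2 (volume.restrict (Ioo 0 T))) {δ : ℝ} (hδ : δ = 0 ∨ δ = 1)
    {R : ℝ} (hq : ∀ t ∈ Icc 0 T, ‖q t‖ ≤ R) (hp : MemLp p 2 (volume.restrict (Ioo 0 T)))
    (hqp : ∀ᵐ t ∂volume.restrict (Ioo 0 T), q t = S (p t)) {f' v' g' : ℝ → E}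
    (hl : IsLinearSolution S T v₀ f v g) (hl' : IsLinearSolution S T v₀ f' v' g')
    (hf : ∀ᵐ t ∂volume.restrict (Ioo 0 T), f t = controlForce S b G δ h q p t (v t) (g t))
    (hf' : ∀ᵐ t ∂volume.restrict (Ioo 0 T), f' t = controlForce S b G δ h q p t (v' t) (g' t)) :
    EqOn v v' (Icc 0 T) := by
  obtain ⟨R', hR'0, hR'⟩ := hl'.exists_norm_le
  have hhi := hh.integrable_norm_pow (p := 2) (by norm_num)
  have hC := hb.nonneg
  -- the difference solves a linearised equation with coefficients `P` and `Q`
  obtain ⟨P, Q, R₁, hP, hQ, hQR, hPQ⟩ : ∃ (P Q : ℝ → E) (R₁ : ℝ),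
      MemLp P 2 (volume.restrict (Ioo 0 T)) ∧ MemLp Q 2 (volume.restrict (Ioo 0 T)) ∧
      (∀ᵐ t ∂volume.restrict (Ioo 0 T), ‖S (Q t)‖ ≤ R₁) ∧
      ∀ᵐ t ∂volume.restrict (Ioo 0 T), ∃ z, ‖z‖ ^ 2 ≤ c ^ 2 * ‖v t - v' t‖ ^ 2 * ‖h t‖ ^ 2 ∧
        f t - f' t = z - b (P t) (g t - g' t) - b (g t - g' t) (Q t) := by
    rcases hδ with rfl | rfl
    · refine ⟨g, g', R', hl.memLp_top, hl'.memLp_top, ?_, ?_⟩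
      · filter_upwards [hl'.ae_eq, ae_restrict_mem measurableSet_Ioo] with t h1 h2
        rw [← h1]; exact hR' t (Ioo_subset_Icc_self h2)
      · filter_upwards [hf, hf'] with t h1 h2
        refine ⟨G (S (v t)) (h t) - G (S (v' t)) (h t), ?_, ?_⟩
        · refine (hG.norm_sub_apply_sq_le _ _ _).trans ?_
          rw [← map_sub]
          gcongr
          exact hS.norm_apply_le _
        · rw [h1, h2, controlForce_zero, controlForce_zero]
          simp only [map_sub, sub_apply]
          abel
    · refine ⟨p, p, R, hp, hp, ?_, ?_⟩
      · filter_upwards [hqp, ae_restrict_mem measurableSet_Ioo] with t h1 h2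
        rw [← h1]; exact hq t (Ioo_subset_Icc_self h2)
      · filter_upwards [hf, hf'] with t h1 h2
        refine ⟨0, by rw [norm_zero, zero_pow two_ne_zero]; positivity, ?_⟩
        rw [h1, h2, controlForce_one, controlForce_one]
        simp only [map_sub, sub_apply]
        abel
  have hPi := hP.integrable_norm_pow (p := 2) (by norm_num)
  have hQi := hQ.integrable_norm_pow (p := 2) (by norm_num)
  intro t ht
  have hd := hl.sub hl'
  have h1 := hd.energy_le hS (α := 0)
    (β := fun t => 4 * c ^ 2 * ‖h t‖ ^ 2 + (4 * C * ‖P t‖ ^ 2 + 128 * C ^ 2 * R₁ ^ 2 * ‖Q t‖ ^ 2))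
    (integrable_zero _ _ _) (fun _ => le_rfl)
    ((hhi.const_mul _).add ((hPi.const_mul _).add (hQi.const_mul _))) (fun t => by positivity)
    (by
      filter_upwards [hPQ, hQR, hd.ae_eq] with s ⟨z, hz, hs⟩ hs2 hs3
      have h5 := hb.two_inner_le hS.norm_apply_le (P := P s) hs2 z (g s - g' s)
      rw [← hs3] at h5
      rw [hs, Pi.zero_apply]
      linarith) ht
  simp only [sub_self, norm_zero, Pi.zero_apply, integral_zero] at h1
  have h2 : 0 ≤ ∫ s in (0 : ℝ)..t, ‖g s - g' s‖ ^ 2 :=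
    intervalIntegral.integral_nonneg ht.1 fun _ _ => sq_nonneg _
  have h3 : ‖v t - v' t‖ ^ 2 = 0 := le_antisymm (by linarith) (sq_nonneg _)
  exact sub_eq_zero.1 (norm_eq_zero.1 (pow_eq_zero_iff two_ne_zero |>.1 h3))

lemma norm_sub_sub_sq_le {F : Type*} [NormedAddCommGroup F] (x y z : F) :
    ‖x - y - z‖ ^ 2 ≤ 3 * (‖x‖ ^ 2 + ‖y‖ ^ 2 + ‖z‖ ^ 2) := by
  have h1 := (norm_sub_le (x - y) z).trans (add_le_add_left (norm_sub_le x y) _)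
  have h2 := pow_le_pow_left₀ (norm_nonneg _) h1 2
  nlinarith [sq_nonneg (‖x‖ - ‖y‖), sq_nonneg (‖x‖ - ‖z‖), sq_nonneg (‖y‖ - ‖z‖)]

/-- The estimate `|B(u, v)|² ≤ C ‖u‖ |A u| ‖v‖²` is linear in `|A u|`, which makes the terms of the
controlled equation admissible for the continuation argument. -/
lemma isAdmissible_controlForce (hS : IsDiagonal S e μ)
    (hb : IsConvective S b C) (hG : IsLipschitzNoise G c)
    (hh : MemLp h 2 (volume.restrict (Ioo 0 T))) {δ : ℝ} (hδ : δ = 0 ∨ δ = 1)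
    {R : ℝ} (hR : 0 ≤ R) (hqc : ContinuousOn q (Icc 0 T)) (hq : ∀ t ∈ Icc 0 T, ‖q t‖ ≤ R)
    (hp : MemLp p 2 (volume.restrict (Ioo 0 T)))
    (hqp : ∀ᵐ t ∂volume.restrict (Ioo 0 T), q t = S (p t)) {R' : ℝ} (hRR : R' ≤ R) :
    IsAdmissible S T (controlForce S b G δ h q p) (fun t => ‖h t‖ ^ 2 + ‖p t‖)
      (3 * (c ^ 2 * (1 + R) ^ 2 + C * (R + R ^ 2 + R ^ 3))) R' where
  nonneg := by have := hb.nonneg; positivity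
  integrable := (hh.integrable_norm_pow (p := 2) (by norm_num)).add
    (MemLp.integrable_of_Ioo hp).norm
  coeff_nonneg t := by positivity
  measurable v g hv hg := by
    have hyc : ContinuousOn (fun t => δ • S (q t) + (1 - δ) • S (v t)) (Ioo 0 T) :=
      ContinuousOn.mono (by fun_prop) Ioo_subset_Icc_self
    have h1 : AEStronglyMeasurable (fun t => G (δ • S (q t) + (1 - δ) • S (v t)))
        (volume.restrict (Ioo 0 T)) :=
      (hG.continuous.comp_continuousOn hyc).aestronglyMeasurable measurableSet_Ioo
    have h2 : AEStronglyMeasurable (fun t => G (δ • S (q t) + (1 - δ) • S (v t)) (h t))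
        (volume.restrict (Ioo 0 T)) :=
      isBoundedBilinearMap_apply.continuous.comp_aestronglyMeasurable (h1.prodMk hh.1)
    have h3 : ∀ {x y : ℝ → E}, AEStronglyMeasurable x (volume.restrict (Ioo 0 T)) →
        AEStronglyMeasurable y (volume.restrict (Ioo 0 T)) →
        AEStronglyMeasurable (fun t => b (x t) (y t)) (volume.restrict (Ioo 0 T)) := by
      intro x y hx hy
      have hc : Continuous fun z : E × E => b z.1 z.2 := by fun_prop
      exact hc.comp_aestronglyMeasurable (hx.prodMk hy)
    exact ((h2.sub ((h3 hg.1 hg.1).const_smul _)).sub ((h3 hp.1 hg.1).const_smul _)).sub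
      ((h3 hg.1 hp.1).const_smul _)
  bound := by
    have hC := hb.nonneg
    filter_upwards [hqp, ae_restrict_mem measurableSet_Ioo] with t h1 h2 g hg
    have hg' := hg.trans hRR
    have hqt := hq t (Ioo_subset_Icc_self h2)
    have hSp : ‖S (p t)‖ ≤ R := by rwa [← h1]
    have hH := sq_nonneg ‖h t‖
    have hbd : ∀ x y : E, ‖S x‖ ≤ R → ‖S y‖ ≤ R → ‖b x y‖ ^ 2 ≤ C * R ^ 3 * ‖x‖ := by
      intro x y hx hy
      calc ‖b x y‖ ^ 2 ≤ C * ‖S x‖ * ‖x‖ * ‖S y‖ ^ 2 := hb.bound x y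
        _ ≤ C * R * ‖x‖ * R ^ 2 := by gcongr
        _ = _ := by ring
    have hGb : ∀ w : E, ‖w‖ ≤ R → ‖G (S w) (h t)‖ ^ 2 ≤ c ^ 2 * (1 + R) ^ 2 * ‖h t‖ ^ 2 := by
      intro w hw
      refine (hG.norm_apply_sq_le _ _).trans ?_
      have := (hS.norm_apply_le w).trans hw
      gcongr
    have hx : 0 ≤ C * (R + R ^ 2) * (‖h t‖ ^ 2 + ‖p t‖ + ‖g‖) +
        c ^ 2 * (1 + R) ^ 2 * (‖p t‖ + ‖g‖) + C * R ^ 3 * ‖h t‖ ^ 2 := by positivity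
    have hx2 : 0 ≤ C * R ^ 3 * ‖p t‖ := by positivity
    rcases hδ with rfl | rfl
    · rw [controlForce_zero]
      have h3 := norm_sub_sub_sq_le (G (S (S g)) (h t)) (b g g) 0
      have h4 := hbd g g hg' hg'
      have h5 := hGb (S g) hg'
      rw [sub_zero, norm_zero] at h3
      nlinarith
    · rw [controlForce_one]
      have h3 := norm_sub_sub_sq_le (G (S (q t)) (h t)) (b (p t) g) (b g (p t))
      have h4 := hbd g (p t) hg' hSp
      have h5 := hbd (p t) g hSp hg'
      have h6 := hGb (q t) hqt
      nlinarith
  lipschitz := by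
    have hC := hb.nonneg
    filter_upwards [hqp, ae_restrict_mem measurableSet_Ioo] with t h1 h2 g g' hg hg'
    have hgR := hg.trans hRR
    have hgR' := hg'.trans hRR
    have hqt := hq t (Ioo_subset_Icc_self h2)
    have hSp : ‖S (p t)‖ ≤ R := by rwa [← h1]
    set γ := g - g' with hγ
    set a := ‖S γ‖ with ha
    have ha0 : 0 ≤ a := norm_nonneg _
    have hb1 : ∀ x, ‖S x‖ ≤ R → ‖b x γ‖ ^ 2 ≤ C * R * (‖x‖ * a ^ 2) := by
      intro x hx
      calc ‖b x γ‖ ^ 2 ≤ C * ‖S x‖ * ‖x‖ * a ^ 2 := hb.bound x γ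
        _ ≤ C * R * ‖x‖ * a ^ 2 := by gcongr
        _ = _ := by ring
    have hb2 : ∀ x, ‖S x‖ ≤ R → ‖b γ x‖ ^ 2 ≤ C * R ^ 2 * (a * ‖γ‖) := by
      intro x hx
      calc ‖b γ x‖ ^ 2 ≤ C * a * ‖γ‖ * ‖S x‖ ^ 2 := hb.bound γ x
        _ ≤ C * a * ‖γ‖ * R ^ 2 := by gcongr
        _ = _ := by ring
    have hG1 : ‖G (S (S g)) (h t) - G (S (S g')) (h t)‖ ^ 2 ≤
        c ^ 2 * (1 + R) ^ 2 * (‖h t‖ ^ 2 * a ^ 2) := by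
      refine (hG.norm_sub_apply_sq_le _ _ _).trans ?_
      rw [← map_sub, ← map_sub]
      have h3 := hS.norm_apply_le (S γ)
      have h4 : (1 : ℝ) ≤ (1 + R) ^ 2 := one_le_pow₀ (by linarith)
      calc c ^ 2 * ‖S (S γ)‖ ^ 2 * ‖h t‖ ^ 2 ≤ c ^ 2 * a ^ 2 * ‖h t‖ ^ 2 := by gcongr
        _ ≤ (c ^ 2 * a ^ 2 * ‖h t‖ ^ 2) * (1 + R) ^ 2 := le_mul_of_one_le_right (by positivity) h4
        _ = _ := by ring
    have hx1 : 0 ≤ ‖h t‖ ^ 2 * a ^ 2 := by positivity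
    have hx2 : 0 ≤ ‖p t‖ * a ^ 2 := by positivity
    have hx3 : 0 ≤ ‖g'‖ * a ^ 2 := by positivity
    have hx4 : 0 ≤ a * ‖γ‖ := by positivity
    have hc1 : 0 ≤ c ^ 2 * (1 + R) ^ 2 := by positivity
    have hc2 : 0 ≤ C * R := by positivity
    have hc3 : 0 ≤ C * R ^ 2 := by positivity
    have hc4 : 0 ≤ C * R ^ 3 := by positivity
    rcases hδ with rfl | rfl
    · have he : controlForce S b G 0 h q p t (S g) g - controlForce S b G 0 h q p t (S g') g' =
          (G (S (S g)) (h t) - G (S (S g')) (h t)) - b g' γ - b γ g := by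
        rw [controlForce_zero, controlForce_zero, hγ]
        simp only [map_sub, sub_apply]
        abel
      rw [he]
      have h3 := norm_sub_sub_sq_le (G (S (S g)) (h t) - G (S (S g')) (h t)) (b g' γ) (b γ g)
      have h4 := hb1 g' hgR'
      have h5 := hb2 g hgR
      refine h3.trans ?_
      rw [mul_assoc]
      refine mul_le_mul_of_nonneg_left ?_ (by norm_num)
      refine (add_le_add (add_le_add hG1 h4) h5).trans ?_
      generalize c ^ 2 * (1 + R) ^ 2 = c1 at *
      linarith [mul_nonneg hc1 hx2, mul_nonneg hc1 hx3, mul_nonneg hc1 hx4, mul_nonneg hc2 hx1,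
        mul_nonneg hc2 hx2, mul_nonneg hc2 hx4, mul_nonneg hc3 hx1, mul_nonneg hc3 hx2,
        mul_nonneg hc3 hx3, mul_nonneg hc4 hx1, mul_nonneg hc4 hx2, mul_nonneg hc4 hx3,
        mul_nonneg hc4 hx4]
    · have he : controlForce S b G 1 h q p t (S g) g - controlForce S b G 1 h q p t (S g') g' =
          0 - b (p t) γ - b γ (p t) := by
        rw [controlForce_one, controlForce_one, hγ]
        simp only [map_sub, sub_apply]
        abel
      rw [he]
      have h3 := norm_sub_sub_sq_le 0 (b (p t) γ) (b γ (p t))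
      have h4 := hb1 (p t) hSp
      have h5 := hb2 (p t) hSp
      rw [norm_zero] at h3
      refine h3.trans ?_
      rw [mul_assoc]
      refine mul_le_mul_of_nonneg_left ?_ (by norm_num)
      rw [zero_pow two_ne_zero, zero_add]
      refine (add_le_add h4 h5).trans ?_
      generalize c ^ 2 * (1 + R) ^ 2 = c1 at *
      linarith [mul_nonneg hc1 hx2, mul_nonneg hc1 hx3, mul_nonneg hc1 hx4, mul_nonneg hc2 hx1,
        mul_nonneg hc2 hx3, mul_nonneg hc2 hx4, mul_nonneg hc3 hx1, mul_nonneg hc3 hx2,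
        mul_nonneg hc3 hx3, mul_nonneg hc4 hx1, mul_nonneg hc4 hx2, mul_nonneg hc4 hx3,
        mul_nonneg hc4 hx4, mul_nonneg hc1 hx1]

/-- Existence for the controlled equation, in either of its two forms. -/
theorem exists_controlForce_solution [CompleteSpace E] [Countable ι] (hS : IsDiagonal S e μ)
    (hb : IsConvective S b C) (hG : IsLipschitzNoise G c) (hT : 0 ≤ T)
    (hh : MemLp h 2 (volume.restrict (Ioo 0 T))) {δ : ℝ} (hδ : δ = 0 ∨ δ = 1)
    (hqc : ContinuousOn q (Icc 0 T)) (hp : MemLp p 2 (volume.restrict (Ioo 0 T)))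
    (hqp : ∀ᵐ t ∂volume.restrict (Ioo 0 T), q t = S (p t)) (v₀ : E) :
    ∃ f v g, IsLinearSolution S T v₀ f v g ∧
      ∀ᵐ t ∂volume.restrict (Ioo 0 T), f t = controlForce S b G δ h q p t (v t) (g t) := by
  obtain ⟨R₀, hR₀⟩ := isCompact_Icc.exists_bound_of_continuousOn hqc
  have hhn : 0 ≤ ∫ s in Ioo 0 T, ‖h s‖ ^ 2 := integral_nonneg fun _ => sq_nonneg _
  obtain ⟨ρ, hρ, hap⟩ : ∃ ρ, 0 ≤ ρ ∧ ∀ f v g, IsLinearSolution S T v₀ f v g →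
      (∀ᵐ t ∂volume.restrict (Ioo 0 T),
        f t = controlForce S b G δ h q p t (v t) (g t) ∨ f t = 0) →
      ∀ t ∈ Icc 0 T, ‖v t‖ ^ 2 + ∫ s in (0 : ℝ)..t, ‖g s‖ ^ 2 ≤ ρ ^ 2 := by
    rcases hδ with rfl | rfl
    · refine ⟨√((‖v₀‖ ^ 2 + 2 * c ^ 2 * ∫ s in Ioo 0 T, ‖h s‖ ^ 2) *
        Real.exp (2 * c ^ 2 * ∫ s in Ioo 0 T, ‖h s‖ ^ 2)), Real.sqrt_nonneg _,
        fun f v g hl hf t ht => ?_⟩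
      rw [Real.sq_sqrt (by positivity)]
      exact bound_of_controlForce_zero hS hb hG hh hl hf ht
    · refine ⟨√((‖v₀‖ ^ 2 + 4 * c ^ 2 * (1 + R₀) ^ 2 * ∫ s in Ioo 0 T, ‖h s‖ ^ 2) *
        Real.exp ((4 * C + 128 * C ^ 2 * R₀ ^ 2) * ∫ s in Ioo 0 T, ‖p s‖ ^ 2)),
        Real.sqrt_nonneg _, fun f v g hl hf t ht => ?_⟩
      rw [Real.sq_sqrt (by positivity)]
      exact bound_of_controlForce_one hS hb hG hh hR₀ hp hqp hl hf ht
  exact exists_nonlinear_solution hS hT hρ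
    (isAdmissible_controlForce hS hb hG hh hδ (R := max R₀ (ρ + 1))
      (le_trans (by linarith) (le_max_right _ _)) hqc
      (fun t ht => (hR₀ t ht).trans (le_max_left _ _)) hp hqp (le_max_right _ _)) v₀ hap

end Controlled

/-! ### Periodic test functions -/

section TestFunctions

variable {φ ψ : Plane → ℝ}

lemma IsTest.continuous (hφ : IsTest φ) : Continuous φ := hφ.smooth.continuous

lemma IsTest.differentiable (hφ : IsTest φ) : Differentiable ℝ φ :=
  hφ.smooth.differentiable (by simp)

lemma IsTest.add (hφ : IsTest φ) (hψ : IsTest ψ) : IsTest (fun x => φ x + ψ x) :=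
  ⟨hφ.smooth.add hψ.smooth, fun i x => by rw [hφ.periodic, hψ.periodic]⟩

lemma IsTest.mul (hφ : IsTest φ) (hψ : IsTest ψ) : IsTest (fun x => φ x * ψ x) :=
  ⟨hφ.smooth.mul hψ.smooth, fun i x => by rw [hφ.periodic, hψ.periodic]⟩

lemma isTest_const (c : ℝ) : IsTest fun _ => c := ⟨contDiff_const, fun _ _ => rfl⟩

lemma IsTest.const_mul (c : ℝ) (hφ : IsTest φ) : IsTest (fun x => c * φ x) :=
  (isTest_const c).mul hφ

lemma IsTest.partialD (hφ : IsTest φ) (j : Fin 2) : IsTest (partialD j φ) := by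
  refine ⟨?_, fun i x => ?_⟩
  · have h : ContDiff ℝ ∞ (fderiv ℝ φ) := hφ.smooth.fderiv_right (by simp)
    unfold TorusNS.partialD
    fun_prop
  · unfold TorusNS.partialD
    have h : φ = fun y => φ (y + EuclideanSpace.single i (2 * Real.pi)) :=
      funext fun y => (hφ.periodic i y).symm
    conv_rhs => rw [h]
    rw [fderiv_comp_add_right]

lemma partialD_add (hφ : IsTest φ) (hψ : IsTest ψ) (j : Fin 2) (x : Plane) :
    partialD j (fun x => φ x + ψ x) x = partialD j φ x + partialD j ψ x := by
  unfold partialD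
  rw [fderiv_fun_add (hφ.differentiable x) (hψ.differentiable x)]
  rfl

lemma partialD_mul (hφ : IsTest φ) (hψ : IsTest ψ) (j : Fin 2) (x : Plane) :
    partialD j (fun x => φ x * ψ x) x = φ x * partialD j ψ x + partialD j φ x * ψ x := by
  unfold partialD
  rw [fderiv_fun_mul (hφ.differentiable x) (hψ.differentiable x)]
  simp [mul_comm]

lemma partialD_const_mul (c : ℝ) (hφ : IsTest φ) (j : Fin 2) (x : Plane) :
    partialD j (fun x => c * φ x) x = c * partialD j φ x := by
  unfold partialD
  rw [fderiv_const_mul (hφ.differentiable x)]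
  rfl

lemma partialD_comm (hφ : IsTest φ) (i j : Fin 2) (x : Plane) :
    partialD i (partialD j φ) x = partialD j (partialD i φ) x := by
  have h : ContDiff ℝ ∞ (fderiv ℝ φ) := hφ.smooth.fderiv_right (by simp)
  have hd : DifferentiableAt ℝ (fderiv ℝ φ) x := h.differentiable (by simp) x
  have hsymm := (hφ.smooth.contDiffAt (x := x)).isSymmSndFDerivAt
    (by rw [minSmoothness_of_isRCLikeNormedField]; exact WithTop.coe_le_coe.2 (le_top : (2 : ℕ∞) ≤ ⊤))
  have key : ∀ a b : Fin 2, partialD a (partialD b φ) x =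
      fderiv ℝ (fderiv ℝ φ) x (EuclideanSpace.single a 1) (EuclideanSpace.single b 1) := by
    intro a b
    change fderiv ℝ (fun y => fderiv ℝ φ y (EuclideanSpace.single b 1)) x _ = _
    rw [fderiv_clm_apply hd (differentiableAt_const _)]
    simp
  rw [key, key, hsymm]

lemma measurableSet_cell : MeasurableSet cell := isCompact_cell.measurableSet

lemma integrable_of_continuous {F : Type*} [NormedAddCommGroup F] {f : Plane → F}
    (hf : Continuous f) : Integrable f cellMeasure :=
  hf.continuousOn.integrableOn_compact isCompact_cell

/-- The integral over a period of the derivative of a periodic function vanishes. -/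
lemma integral_partialD (hφ : IsTest φ) (j : Fin 2) : ∫ x, partialD j φ x ∂cellMeasure = 0 := by
  have hpre : (WithLp.toLp 2 : (Fin 2 → ℝ) → Plane) ⁻¹' cell =
      Icc (fun _ => 0) (fun _ => 2 * Real.pi) := by
    ext x
    simp [cell, Pi.le_def, forall_and]
  have h1 : ∫ x, partialD j φ x ∂cellMeasure =
      ∫ x in Icc (fun _ : Fin 2 => (0 : ℝ)) (fun _ => 2 * Real.pi),
        partialD j φ (WithLp.toLp 2 x) := by
    rw [← hpre, cellMeasure]
    exact ((PiLp.volume_preserving_toLp (Fin 2)).setIntegral_preimage_emb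
      (MeasurableEquiv.toLp 2 (Fin 2 → ℝ)).measurableEmbedding _ _).symm
  let L : (Fin 2 → ℝ) →L[ℝ] Plane := (PiLp.continuousLinearEquiv 2 ℝ (fun _ : Fin 2 => ℝ)).symm
  have hL : ∀ x, L x = WithLp.toLp 2 x := fun _ => rfl
  have hLs : ∀ i : Fin 2, L (Pi.single i 1) = EuclideanSpace.single i 1 := fun i => rfl
  have hd := hφ.partialD j
  have hdiv := integral_divergence_of_hasFDerivAt_off_countable' (E := ℝ)
    (fun _ : Fin 2 => (0 : ℝ)) (fun _ => 2 * Real.pi) (fun _ => by positivity)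
    (fun i x => if i = j then φ (L x) else 0)
    (fun i x => if i = j then (fderiv ℝ φ (L x)).comp L else 0) ∅ countable_empty
    (fun i => by
      split_ifs
      · exact (hφ.continuous.comp L.continuous).continuousOn
      · exact continuousOn_const)
    (fun x _ i => by
      split_ifs
      · exact (hφ.differentiable (L x)).hasFDerivAt.comp x L.hasFDerivAt
      · exact hasFDerivAt_const _ _)
    (by
      refine Continuous.integrableOn_Icc ?_
      refine continuous_finsetSum _ fun i _ => ?_
      by_cases hij : i = j
      · simp only [hij, if_true, ContinuousLinearMap.comp_apply, hLs]
        exact hd.continuous.comp L.continuous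
      · simpa [hij] using continuous_const)
  have hper : ∀ y : Fin 1 → ℝ, φ (L (Fin.insertNth j (2 * Real.pi) y)) =
      φ (L (Fin.insertNth (α := fun _ => ℝ) j 0 y)) := by
    intro y
    rw [← hφ.periodic j (L (Fin.insertNth (α := fun _ => ℝ) j 0 y))]
    congr 1
    ext i
    rcases Fin.eq_self_or_eq_succAbove j i with rfl | ⟨k, rfl⟩ <;> simp [hL]
  rw [h1]
  have h2 : ∀ x, ∑ i, (if i = j then (fderiv ℝ φ (L x)).comp L else 0) (Pi.single i 1) =
      partialD j φ (WithLp.toLp 2 x) := by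
    intro x
    rw [Finset.sum_eq_single j (fun i _ hi => by simp [hi]) (by simp)]
    simp [hLs, partialD, hL]
  simp only [h2] at hdiv
  rw [hdiv, Finset.sum_eq_single j (fun i _ hi => by simp [hi]) (by simp)]
  simp only [if_true, hper, sub_self]

/-- Integration by parts for periodic functions. -/
lemma integral_mul_partialD (hφ : IsTest φ) (hψ : IsTest ψ) (j : Fin 2) :
    ∫ x, partialD j φ x * ψ x ∂cellMeasure = -∫ x, φ x * partialD j ψ x ∂cellMeasure := by
  have h := integral_partialD (hφ.mul hψ) j
  simp only [partialD_mul hφ hψ] at h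
  have h1 : Integrable (fun x => φ x * partialD j ψ x) cellMeasure :=
    integrable_of_continuous (hφ.continuous.mul (hψ.partialD j).continuous)
  have h2 : Integrable (fun x => partialD j φ x * ψ x) cellMeasure :=
    integrable_of_continuous ((hφ.partialD j).continuous.mul hψ.continuous)
  rw [integral_add h1 h2] at h
  linarith

end TestFunctions

/-! ### The real trigonometric system `cos (k · x) + sin (k · x)` -/

section Cas

/-- The phase `k · x`. -/
def phase (k : Fin 2 → ℤ) (x : Plane) : ℝ := ∑ j, (k j : ℝ) * x j

/-- The function `cos (k · x) + sin (k · x)`. Over `k ∈ ℤ²` these functions form a real orthogonal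
basis of `L²` of the cell, and differentiation maps each to a multiple of the one for `-k`. -/
def cas (k : Fin 2 → ℤ) (x : Plane) : ℝ := Real.cos (phase k x) + Real.sin (phase k x)

@[fun_prop]
lemma contDiff_phase (k : Fin 2 → ℤ) : ContDiff ℝ ∞ (phase k) := by
  unfold phase; fun_prop

lemma phase_add_single (k : Fin 2 → ℤ) (i : Fin 2) (x : Plane) :
    phase k (x + EuclideanSpace.single i (2 * Real.pi)) = phase k x + k i * (2 * Real.pi) := by
  fin_cases i <;> simp [phase, Fin.sum_univ_two] <;> ring

lemma phase_neg (k : Fin 2 → ℤ) (x : Plane) : phase (-k) x = -phase k x := by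
  simp [phase]

lemma phase_add (k l : Fin 2 → ℤ) (x : Plane) : phase (k + l) x = phase k x + phase l x := by
  simp [phase, add_mul, Finset.sum_add_distrib]

lemma isTest_cos (k : Fin 2 → ℤ) : IsTest fun x => Real.cos (phase k x) :=
  ⟨by fun_prop, fun i x => by rw [phase_add_single, Real.cos_add_int_mul_two_pi]⟩

lemma isTest_sin (k : Fin 2 → ℤ) : IsTest fun x => Real.sin (phase k x) :=
  ⟨by fun_prop, fun i x => by rw [phase_add_single, Real.sin_add_int_mul_two_pi]⟩

lemma isTest_cas (k : Fin 2 → ℤ) : IsTest (cas k) := (isTest_cos k).add (isTest_sin k)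

lemma hasFDerivAt_phase (k : Fin 2 → ℤ) (x : Plane) :
    HasFDerivAt (phase k) (∑ j, (k j : ℝ) • (EuclideanSpace.proj j : Plane →L[ℝ] ℝ)) x := by
  have h : phase k = (∑ j, (k j : ℝ) • (EuclideanSpace.proj j : Plane →L[ℝ] ℝ) :
      Plane →L[ℝ] ℝ) := by
    ext y
    simp [phase]
  rw [h]
  exact ContinuousLinearMap.hasFDerivAt _

lemma sum_smul_proj_single (k : Fin 2 → ℤ) (j : Fin 2) :
    (∑ i, (k i : ℝ) • (EuclideanSpace.proj i : Plane →L[ℝ] ℝ)) (EuclideanSpace.single j 1) =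
      k j := by
  fin_cases j <;> simp [Fin.sum_univ_two]

lemma partialD_cos (k : Fin 2 → ℤ) (j : Fin 2) (x : Plane) :
    partialD j (fun x => Real.cos (phase k x)) x = -(k j * Real.sin (phase k x)) := by
  unfold partialD
  rw [(hasFDerivAt_phase k x).cos.fderiv, smul_apply, sum_smul_proj_single]
  simp [mul_comm]

lemma partialD_sin (k : Fin 2 → ℤ) (j : Fin 2) (x : Plane) :
    partialD j (fun x => Real.sin (phase k x)) x = k j * Real.cos (phase k x) := by
  unfold partialD
  rw [(hasFDerivAt_phase k x).sin.fderiv, smul_apply, sum_smul_proj_single]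
  simp [mul_comm]

lemma partialD_cas (k : Fin 2 → ℤ) (j : Fin 2) (x : Plane) :
    partialD j (cas k) x = k j * cas (-k) x := by
  change partialD j (fun x => Real.cos (phase k x) + Real.sin (phase k x)) x = _
  rw [partialD_add (isTest_cos k) (isTest_sin k), partialD_cos, partialD_sin, cas, phase_neg,
    Real.cos_neg, Real.sin_neg]
  ring

lemma abs_cas_le (k : Fin 2 → ℤ) (x : Plane) : |cas k x| ≤ 2 := by
  have h1 := Real.abs_cos_le_one (phase k x)
  have h2 := Real.abs_sin_le_one (phase k x)
  exact (abs_add_le _ _).trans (by linarith)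

lemma integral_cos_phase {k : Fin 2 → ℤ} (hk : k ≠ 0) :
    ∫ x, Real.cos (phase k x) ∂cellMeasure = 0 := by
  obtain ⟨j, hj⟩ := Function.ne_iff.1 hk
  have h := integral_partialD (isTest_sin k) j
  simp only [partialD_sin] at h
  rw [integral_const_mul] at h
  exact (mul_eq_zero.1 h).resolve_left (by exact_mod_cast hj)

lemma integral_sin_phase (k : Fin 2 → ℤ) : ∫ x, Real.sin (phase k x) ∂cellMeasure = 0 := by
  by_cases hk : k = 0
  · simp [hk, phase]
  obtain ⟨j, hj⟩ := Function.ne_iff.1 hk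
  have h := integral_partialD (isTest_cos k) j
  simp only [partialD_cos] at h
  rw [integral_neg, integral_const_mul, neg_eq_zero] at h
  exact (mul_eq_zero.1 h).resolve_left (by exact_mod_cast hj)

lemma cellMeasure_eq_map : cellMeasure =
    (volume.restrict (Icc (fun _ : Fin 2 => (0 : ℝ)) fun _ => 2 * Real.pi)).map
      (WithLp.toLp 2) := by
  have hpre : (WithLp.toLp 2 : (Fin 2 → ℝ) → Plane) ⁻¹' cell =
      Icc (fun _ => 0) (fun _ => 2 * Real.pi) := by
    ext x
    simp [cell, Pi.le_def, forall_and]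
  rw [← hpre, cellMeasure]
  exact ((PiLp.volume_preserving_toLp (Fin 2)).restrict_preimage measurableSet_cell).map_eq.symm

lemma cellMeasure_real_univ : cellMeasure.real univ = (2 * Real.pi) ^ 2 := by
  rw [cellMeasure_eq_map, measureReal_def, Measure.map_apply (by fun_prop) MeasurableSet.univ,
    preimage_univ, Measure.restrict_apply_univ, Real.volume_Icc_pi_toReal
    (fun _ => by positivity)]
  simp

lemma integral_cas_mul_cas (k l : Fin 2 → ℤ) :
    ∫ x, cas k x * cas l x ∂cellMeasure = if k = l then (2 * Real.pi) ^ 2 else 0 := by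
  have h : ∀ x, cas k x * cas l x =
      Real.cos (phase (k + -l) x) + Real.sin (phase (k + l) x) := by
    intro x
    rw [phase_add, phase_add, phase_neg, ← sub_eq_add_neg, Real.cos_sub, Real.sin_add, cas, cas]
    ring
  simp only [h]
  rw [integral_add (integrable_of_continuous (isTest_cos _).continuous)
    (integrable_of_continuous (isTest_sin _).continuous), integral_sin_phase, add_zero]
  split_ifs with hkl
  · simp [hkl, phase, cellMeasure_real_univ]
  · exact integral_cos_phase (by rwa [← sub_eq_add_neg, sub_ne_zero])

end Cas

/-! ### Completeness of the trigonometric system -/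

section Completeness

/-- The normalised Haar measure, as in Mathlib's theory of multivariate Fourier series. -/
local instance : MeasureSpace UnitAddCircle := ⟨AddCircle.haarAddCircle⟩

/-- The map from the unit torus onto the (half-open) periodic cell. -/
def torusToCell (z : UnitAddTorus (Fin 2)) : Plane :=
  (2 * Real.pi) • WithLp.toLp 2 (UnitAddTorus.measurableEquivPiIoc (fun _ : Fin 2 => (0 : ℝ)) z).1

lemma measurable_torusToCell : Measurable torusToCell := by
  unfold torusToCell
  have h : Measurable fun z : UnitAddTorus (Fin 2) =>
      (UnitAddTorus.measurableEquivPiIoc (fun _ : Fin 2 => (0 : ℝ)) z).1 :=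
    measurable_subtype_coe.comp (MeasurableEquiv.measurable _)
  have h2 : Measurable fun x : Fin 2 → ℝ => (2 * Real.pi) • (WithLp.toLp 2 x : Plane) := by
    fun_prop
  exact h2.comp h

lemma restrict_Ioc_eq_cellMeasure :
    (volume : Measure Plane).restrict {x | ∀ i, x i ∈ Ioc 0 (2 * Real.pi)} = cellMeasure := by
  refine Measure.restrict_congr_set ?_
  have h := (PiLp.volume_preserving_ofLp (Fin 2)).quasiMeasurePreserving.preimage_ae_eq
    (Measure.univ_pi_Ioc_ae_eq_Icc (μ := fun _ : Fin 2 => (volume : Measure ℝ))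
      (f := fun _ => 0) (g := fun _ => 2 * Real.pi))
  have h1 : {x : Plane | ∀ i, x i ∈ Ioc 0 (2 * Real.pi)} =
      WithLp.ofLp ⁻¹' univ.pi fun _ : Fin 2 => Ioc 0 (2 * Real.pi) := by ext x; simp
  have h2 : cell = WithLp.ofLp ⁻¹' Icc (fun _ : Fin 2 => (0 : ℝ)) fun _ => 2 * Real.pi := by
    ext x; simp [cell, Pi.le_def, forall_and]
  rw [h1, h2]
  exact h

lemma map_torusToCell : (volume : Measure (UnitAddTorus (Fin 2))).map torusToCell =
    ENNReal.ofReal ((2 * Real.pi) ^ 2)⁻¹ • cellMeasure := by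
  have hpi : (0 : ℝ) < 2 * Real.pi := by positivity
  let r : UnitAddTorus (Fin 2) → Fin 2 → ℝ := fun z =>
    (UnitAddTorus.measurableEquivPiIoc (fun _ : Fin 2 => (0 : ℝ)) z).1
  have hr : Measurable r := measurable_subtype_coe.comp (MeasurableEquiv.measurable _)
  have hA : MeasurableSet {x : Fin 2 → ℝ | ∀ i, x i ∈ Ioc (0 : ℝ) (0 + 1)} :=
    MeasurableSet.univ_pi' fun _ => measurableSet_Ioc
  have hA2 : MeasurableSet {x : Plane | ∀ i, x i ∈ Ioc (0 : ℝ) (2 * Real.pi)} := by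
    have := (PiLp.volume_preserving_ofLp (Fin 2)).measurable
      (MeasurableSet.univ_pi' (t := fun _ : Fin 2 => Ioc (0 : ℝ) (2 * Real.pi))
        fun _ => measurableSet_Ioc)
    exact this
  have h1 : (volume : Measure (UnitAddTorus (Fin 2))).map r =
      volume.restrict {x : Fin 2 → ℝ | ∀ i, x i ∈ Ioc (0 : ℝ) (0 + 1)} := by
    have h := (UnitAddTorus.measurePreserving_equivPiIoc (fun _ : Fin 2 => (0 : ℝ))).map_eq
    have h2 := congrArg (Measure.map Subtype.val) h
    rw [Measure.map_map measurable_subtype_coe (MeasurableEquiv.measurable _)] at h2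
    exact h2.trans (map_comap_subtype_coe hA volume)
  have h2 : (volume.restrict {x : Fin 2 → ℝ | ∀ i, x i ∈ Ioc (0 : ℝ) (0 + 1)}).map
      (WithLp.toLp 2 : (Fin 2 → ℝ) → Plane) =
      volume.restrict ((fun x : Plane => (2 * Real.pi) • x) ⁻¹'
        {x : Plane | ∀ i, x i ∈ Ioc (0 : ℝ) (2 * Real.pi)}) := by
    have h := ((PiLp.volume_preserving_toLp (Fin 2)).restrict_preimage
      (s := (fun x : Plane => (2 * Real.pi) • x) ⁻¹'
        {x : Plane | ∀ i, x i ∈ Ioc (0 : ℝ) (2 * Real.pi)})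
      (hA2.preimage (by fun_prop))).map_eq
    rw [← h]
    congr 2
    ext x
    refine forall_congr' fun i => ?_
    simp only [mem_Ioc, PiLp.smul_apply, smul_eq_mul, zero_add]
    constructor
    · intro h
      exact ⟨by nlinarith [h.1], by nlinarith [h.2]⟩
    · intro h
      exact ⟨by by_contra h'; nlinarith [h.1], by by_contra h'; nlinarith [h.2]⟩
  have h3 : torusToCell = (fun x : Plane => (2 * Real.pi) • x) ∘
      (WithLp.toLp 2 : (Fin 2 → ℝ) → Plane) ∘ r := rfl
  rw [h3, ← Measure.map_map (by fun_prop)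
      ((PiLp.volume_preserving_toLp (Fin 2)).measurable.comp hr),
    ← Measure.map_map (PiLp.volume_preserving_toLp (Fin 2)).measurable hr, h1, h2,
    ← Measure.restrict_map (by fun_prop) hA2, Measure.map_addHaar_smul _ hpi.ne',
    Measure.restrict_smul, restrict_Ioc_eq_cellMeasure]
  congr 2
  rw [finrank_euclideanSpace_fin, abs_of_pos (by positivity)]

lemma mFourier_eq (n : Fin 2 → ℤ) (z : UnitAddTorus (Fin 2)) :
    UnitAddTorus.mFourier n z = Complex.exp (phase n (torusToCell z) * Complex.I) := by
  have hpi : (2 * Real.pi : ℝ) ≠ 0 := by positivity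
  have h : ∀ i, fourier (n i) (z i) =
      Complex.exp ((n i * (torusToCell z) i : ℝ) * Complex.I) := by
    intro i
    have h1 : z i = (((UnitAddTorus.measurableEquivPiIoc (fun _ : Fin 2 => (0 : ℝ)) z).1 i : ℝ) :
        UnitAddCircle) := by
      rw [UnitAddTorus.coe_measurableEquivPiIoc_apply]
      exact (AddCircle.coe_equivIoc).symm
    rw [h1, fourier_coe_apply]
    congr 1
    simp only [torusToCell, PiLp.smul_apply, smul_eq_mul]
    push_cast
    ring
  simp only [UnitAddTorus.mFourier, ContinuousMap.coe_mk, h]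
  rw [← Complex.exp_sum, ← Finset.sum_mul, ← Complex.ofReal_sum]
  rfl

/-- A square integrable function orthogonal to the trigonometric system vanishes. -/
theorem ae_eq_zero_of_integral_cas {f : Plane → ℝ} (hf : MemLp f 2 cellMeasure)
    (h : ∀ k, ∫ x, cas k x * f x ∂cellMeasure = 0) : ∀ᵐ x ∂cellMeasure, f x = 0 := by
  set κ := ENNReal.ofReal ((2 * Real.pi) ^ 2)⁻¹ with hκ
  have hκ0 : κ ≠ 0 := by simp [hκ]
  have hfi : Integrable f cellMeasure := hf.integrable (by norm_num)
  have hfκ : MemLp f 2 ((volume : Measure (UnitAddTorus (Fin 2))).map torusToCell) := by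
    rw [map_torusToCell]
    exact hf.smul_measure ENNReal.ofReal_ne_top
  let F : UnitAddTorus (Fin 2) → ℂ := fun z => (f (torusToCell z) : ℂ)
  have hF : MemLp F 2 volume :=
    (hfκ.comp_of_map measurable_torusToCell.aemeasurable).ofReal
  have hci : ∀ k, Integrable (fun x => cas k x * f x) cellMeasure := fun k =>
    hfi.bdd_mul (c := 2) (isTest_cas k).continuous.aestronglyMeasurable
      (Eventually.of_forall fun x => abs_cas_le k x)
  have hcoeff : ∀ n : Fin 2 → ℤ, UnitAddTorus.mFourierCoeff (hF.toLp F) n = 0 := by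
    intro n
    have h1 : UnitAddTorus.mFourierCoeff (hF.toLp F) n =
        ∫ z, (fun x : Plane => Complex.exp (phase (-n) x * Complex.I) * (f x : ℂ))
          (torusToCell z) := by
      rw [UnitAddTorus.mFourierCoeff]
      refine integral_congr_ae ?_
      filter_upwards [hF.coeFn_toLp] with z hz
      rw [hz, mFourier_eq, smul_eq_mul]
    have hcf : ∀ k, ∫ x, ((cas k x * f x : ℝ) : ℂ) ∂cellMeasure = 0 := fun k => by
      rw [integral_complex_ofReal, h k, Complex.ofReal_zero]
    have h2 : ∀ x, Complex.exp (phase (-n) x * Complex.I) * (f x : ℂ) =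
        ((1 - Complex.I) / 2) * ((cas n x * f x : ℝ) : ℂ) +
        ((1 + Complex.I) / 2) * ((cas (-n) x * f x : ℝ) : ℂ) := by
      intro x
      rw [Complex.exp_mul_I, ← Complex.ofReal_cos, ← Complex.ofReal_sin, cas, cas, phase_neg,
        Real.cos_neg, Real.sin_neg]
      push_cast
      ring
    rw [h1, ← integral_map measurable_torusToCell.aemeasurable (f := fun x : Plane =>
      Complex.exp (phase (-n) x * Complex.I) * (f x : ℂ)), map_torusToCell, integral_smul_measure]
    · simp only [h2]
      rw [integral_add ((hci n).ofReal.const_mul _) ((hci (-n)).ofReal.const_mul _),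
        integral_const_mul, integral_const_mul, hcf, hcf]
      simp
    · refine AEStronglyMeasurable.mul ?_ (Complex.continuous_ofReal.comp_aestronglyMeasurable
        hfκ.1)
      have hc : Continuous (phase (-n)) := (contDiff_phase (-n)).continuous
      exact Continuous.aestronglyMeasurable (by fun_prop)
  have hzero : hF.toLp F = 0 := by
    refine UnitAddTorus.mFourierBasis.repr.injective ?_
    ext n
    rw [UnitAddTorus.mFourierBasis_repr, hcoeff, map_zero]
    rfl
  have hF0 : ∀ᵐ z, f (torusToCell z) = 0 := by
    have h1 := hF.coeFn_toLp
    rw [hzero] at h1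
    filter_upwards [h1, Lp.coeFn_zero ℂ 2 (volume : Measure (UnitAddTorus (Fin 2)))] with z h2 h3
    rw [h3] at h2
    simpa [F] using h2.symm
  have h5 : ∀ᵐ x ∂κ • cellMeasure, f x = 0 := by
    rw [← map_torusToCell]
    have h6 : ∫ z, (fun x => f x ^ 2) (torusToCell z) = 0 := by
      refine integral_eq_zero_of_ae ?_
      filter_upwards [hF0] with z hz
      simp [hz]
    rw [← integral_map (f := fun x => f x ^ 2) measurable_torusToCell.aemeasurable
      (hfκ.1.pow 2), integral_eq_zero_iff_of_nonneg (fun _ => sq_nonneg _) hfκ.integrable_sq] at h6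
    filter_upwards [h6] with x hx
    simpa using hx
  exact (Measure.ae_ennreal_smul_measure_iff hκ0).1 h5

end Completeness

/-! ### Operators acting on coefficients -/

section Coefficients

variable {E : Type*} [NormedAddCommGroup E] [InnerProductSpace ℝ E] {ι : Type*}

lemma exists_inner_basis_eq (e : HilbertBasis ι ℝ E) {c : ι → ℝ} (hc : Summable fun i => c i ^ 2) :
    ∃ y, ∀ i, inner ℝ (e i) y = c i := by
  have hm : Memℓp c 2 := by
    refine memℓp_gen ?_
    simpa using hc
  refine ⟨e.repr.symm ⟨c, hm⟩, fun i => ?_⟩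
  rw [← e.repr_apply_apply, LinearIsometryEquiv.apply_symm_apply]

/-- A permutation of the coefficients followed by multiplication with bounded weights. -/
lemma exists_weightedPerm (e : HilbertBasis ι ℝ E) (σ : ι ≃ ι) {a : ι → ℝ} (ha : ∀ i, |a i| ≤ 1) :
    ∃ L : E →L[ℝ] E, ∀ i x, inner ℝ (e i) (L x) = a i * inner ℝ (e (σ i)) x := by
  have hs : ∀ x, HasSum (fun i => inner ℝ (e (σ i)) x ^ 2) (‖x‖ ^ 2) := fun x =>
    (Equiv.hasSum_iff σ).2 (hasSum_inner_sq e x)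
  have hle : ∀ x i, (a i * inner ℝ (e (σ i)) x) ^ 2 ≤ inner ℝ (e (σ i)) x ^ 2 := fun x i => by
    rw [mul_pow, ← sq_abs (a i)]
    exact mul_le_of_le_one_left (sq_nonneg _) (pow_le_one₀ (abs_nonneg _) (ha i))
  have hex : ∀ x, ∃ y, ∀ i, inner ℝ (e i) y = a i * inner ℝ (e (σ i)) x := fun x =>
    exists_inner_basis_eq e (Summable.of_nonneg_of_le (fun _ => sq_nonneg _) (hle x)
      (hs x).summable)
  choose F hF using hex
  refine ⟨LinearMap.mkContinuous ⟨⟨F, fun x y => ?_⟩, fun r x => ?_⟩ 1 fun x => ?_, fun i x => hF x i⟩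
  · exact eq_of_inner_basis e fun i => by
      rw [hF, inner_add_right, inner_add_right, hF, hF, mul_add]
  · refine eq_of_inner_basis e fun i => ?_
    simp only [RingHom.id_apply, hF, inner_smul_right]
    ring
  · rw [one_mul, ← sq_le_sq₀ (norm_nonneg _) (norm_nonneg _)]
    refine hasSum_le (fun i => ?_) (hasSum_inner_sq e _) (hs x)
    exact (congrArg (· ^ 2) (hF x i)).trans_le (hle x i)

end Coefficients

/-! ### The Stokes eigenfunctions -/

section Modes

/-- The indices of the eigenfunctions: nonzero wave vectors. -/
abbrev Mode : Type := {k : Fin 2 → ℤ // k ≠ 0}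

/-- The reflection `k ↦ -k`. -/
def Mode.reflect : Mode ≃ Mode where
  toFun k := ⟨-k.1, neg_ne_zero.2 k.2⟩
  invFun k := ⟨-k.1, neg_ne_zero.2 k.2⟩
  left_inv k := by simp
  right_inv k := by simp

/-- The length `|k|` of a wave vector. -/
def waveLength (k : Mode) : ℝ := √((k.1 0 : ℝ) ^ 2 + (k.1 1 : ℝ) ^ 2)

lemma one_le_sum_sq (k : Mode) : 1 ≤ (k.1 0 : ℝ) ^ 2 + (k.1 1 : ℝ) ^ 2 := by
  have h : (1 : ℤ) ≤ k.1 0 ^ 2 + k.1 1 ^ 2 := by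
    by_contra hlt
    have h0 : k.1 0 ^ 2 = 0 := by nlinarith [sq_nonneg (k.1 0), sq_nonneg (k.1 1)]
    have h1 : k.1 1 ^ 2 = 0 := by nlinarith [sq_nonneg (k.1 0), sq_nonneg (k.1 1)]
    refine k.2 (funext fun i => ?_)
    fin_cases i
    · exact pow_eq_zero_iff two_ne_zero |>.1 h0
    · exact pow_eq_zero_iff two_ne_zero |>.1 h1
  exact_mod_cast h

lemma waveLength_sq (k : Mode) : waveLength k ^ 2 = (k.1 0 : ℝ) ^ 2 + (k.1 1 : ℝ) ^ 2 :=
  Real.sq_sqrt (by positivity)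

lemma one_le_waveLength (k : Mode) : 1 ≤ waveLength k :=
  Real.one_le_sqrt.2 (one_le_sum_sq k)

lemma waveLength_pos (k : Mode) : 0 < waveLength k := zero_lt_one.trans_le (one_le_waveLength k)

lemma waveLength_reflect (k : Mode) : waveLength k.reflect = waveLength k := by
  simp [waveLength, Mode.reflect]

/-- The unit vector orthogonal to `k`, divided by `2π`: the amplitude of the eigenfunction. -/
def amplitude (k : Mode) : Plane :=
  ((2 * Real.pi)⁻¹ * (waveLength k)⁻¹) • !₂[-(k.1 1 : ℝ), (k.1 0 : ℝ)]

lemma amplitude_reflect (k : Mode) : amplitude k.reflect = -amplitude k := by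
  unfold amplitude
  rw [waveLength_reflect]
  ext i
  fin_cases i <;> simp [Mode.reflect]

lemma inner_amplitude_self (k : Mode) :
    inner ℝ (amplitude k) (amplitude k) = ((2 * Real.pi) ^ 2)⁻¹ := by
  have h := waveLength_sq k
  have hp := (waveLength_pos k).ne'
  have hpi : (2 * Real.pi : ℝ) ≠ 0 := by positivity
  simp only [amplitude, inner_smul_left, inner_smul_right, PiLp.inner_apply, Fin.sum_univ_two]
  simp
  field_simp
  linarith

lemma norm_amplitude_le (k : Mode) : ‖amplitude k‖ ≤ 1 := by
  refine abs_le_of_sq_le_sq' ?_ zero_le_one |>.2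
  rw [← real_inner_self_eq_norm_sq, inner_amplitude_self]
  have : (1 : ℝ) ≤ 2 * Real.pi := by linarith [Real.pi_gt_three]
  simpa using inv_le_one_of_one_le₀ (one_le_pow₀ this (n := 2))

/-- The eigenfunctions of the Stokes operator. -/
def modeField (k : Mode) (x : Plane) : Plane := cas k.1 x • amplitude k

lemma continuous_modeField (k : Mode) : Continuous (modeField k) :=
  (isTest_cas k.1).continuous.smul continuous_const

/-- The eigenfunctions of the Stokes operator, as elements of `𝐋²`. -/
def modeL2 (k : Mode) : L2 := (memLp_of_continuous (continuous_modeField k)).toLp _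

lemma integrable_L2 (u : L2) : Integrable u cellMeasure :=
  (Lp.memLp u).integrable (by norm_num)

lemma IsTest.integrable_smul {φ : Plane → ℝ} (hφ : IsTest φ) (u : L2) :
    Integrable (fun x => φ x • u x) cellMeasure := by
  obtain ⟨c, hc⟩ := isCompact_cell.exists_bound_of_continuousOn hφ.continuous.continuousOn
  exact (integrable_L2 u).bdd_smul c hφ.continuous.aestronglyMeasurable
    (ae_restrict_of_forall_mem measurableSet_cell hc)

/-- The vector valued coefficient of a field with respect to `cas k`. -/
def casCoeff (k : Fin 2 → ℤ) (u : L2) : Plane := ∫ x, cas k x • u x ∂cellMeasure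

lemma inner_modeL2 (k : Mode) (u : L2) :
    inner ℝ (modeL2 k) u = inner ℝ (amplitude k) (casCoeff k.1 u) := by
  rw [modeL2, inner_toLp (continuous_modeField k), casCoeff,
    ← integral_inner ((isTest_cas k.1).integrable_smul u)]
  refine integral_congr_ae (Eventually.of_forall fun x => ?_)
  simp only [modeField, inner_smul_left, inner_smul_right]
  simp

lemma casCoeff_modeL2 (k : Fin 2 → ℤ) (l : Mode) :
    casCoeff k (modeL2 l) = (if k = l.1 then (2 * Real.pi) ^ 2 else 0) • amplitude l := by
  rw [← integral_cas_mul_cas, casCoeff, ← integral_smul_const]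
  refine integral_congr_ae ?_
  filter_upwards [(memLp_of_continuous (continuous_modeField l)).coeFn_toLp] with x hx
  rw [modeL2, hx, modeField, smul_smul]

lemma orthonormal_modeL2 : Orthonormal ℝ modeL2 := by
  classical
  rw [orthonormal_iff_ite]
  intro k l
  rw [inner_modeL2, casCoeff_modeL2, inner_smul_right]
  have hpi : (2 * Real.pi : ℝ) ≠ 0 := by positivity
  by_cases h : k = l
  · subst h
    rw [inner_amplitude_self]
    simp [hpi]
  · rw [if_neg h, if_neg fun h' => h (Subtype.ext h'), zero_mul]

/-- Square integrable fields are determined by their coefficients. -/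
lemma eq_zero_of_casCoeff {u : L2} (h : ∀ k, casCoeff k u = 0) : u = 0 := by
  have hi : ∀ i : Fin 2, ∀ᵐ x ∂cellMeasure, u x i = 0 := by
    intro i
    have hm : MemLp (fun x => u x i) 2 cellMeasure :=
      (EuclideanSpace.proj i : Plane →L[ℝ] ℝ).comp_memLp' (Lp.memLp u)
    refine ae_eq_zero_of_integral_cas hm fun k => ?_
    have h1 := congrArg (EuclideanSpace.proj i : Plane →L[ℝ] ℝ) (h k)
    rw [casCoeff, ← ContinuousLinearMap.integral_comp_comm _ ((isTest_cas k).integrable_smul u)]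
      at h1
    simpa using h1
  refine Lp.ext ?_
  filter_upwards [ae_all_iff.2 hi, Lp.coeFn_zero Plane 2 cellMeasure] with x hx h0
  rw [h0]
  ext i
  exact hx i

lemma isSolenoidal_modeL2 (k : Mode) : IsSolenoidal (modeL2 k) := by
  constructor
  · have h := casCoeff_modeL2 0 k
    rw [if_neg (fun h' => k.2 h'.symm), zero_smul] at h
    rw [← h, casCoeff]
    simp [cas, phase]
  · intro φ hφ
    have h1 : ∀ j, ∫ x, partialD j φ x * cas k.1 x ∂cellMeasure =
        -(k.1 j * ∫ x, φ x * cas (-k.1) x ∂cellMeasure) := by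
      intro j
      rw [integral_mul_partialD hφ (isTest_cas k.1) j, ← integral_const_mul]
      congr 1
      refine integral_congr_ae (Eventually.of_forall fun x => ?_)
      simp only [partialD_cas]
      ring
    have hint : ∀ j, Integrable (fun x => partialD j φ x * cas k.1 x) cellMeasure := fun j =>
      integrable_of_continuous ((hφ.partialD j).continuous.mul (isTest_cas k.1).continuous)
    have h2 : ∫ x, inner ℝ (gradField φ x) (modeL2 k x) ∂cellMeasure =
        ∫ x, (partialD 0 φ x * cas k.1 x) * amplitude k 0 +
          (partialD 1 φ x * cas k.1 x) * amplitude k 1 ∂cellMeasure := by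
      refine integral_congr_ae ?_
      filter_upwards [(memLp_of_continuous (continuous_modeField k)).coeFn_toLp] with x hx
      rw [modeL2, hx]
      simp [modeField, gradField, PiLp.inner_apply, Fin.sum_univ_two]
      ring
    rw [h2, integral_add ((hint 0).mul_const _) ((hint 1).mul_const _), integral_mul_const,
      integral_mul_const, h1, h1]
    simp [amplitude]
    ring

/-- The eigenfunctions of the Stokes operator, as elements of `𝐇`. -/
def modeH (k : Mode) : H := ⟨modeL2 k, isSolenoidal_modeL2 k⟩

lemma inner_modeH (k : Mode) (u : H) :
    inner ℝ (modeH k) u = inner ℝ (amplitude k) (casCoeff k.1 u) := inner_modeL2 k u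

lemma orthonormal_modeH : Orthonormal ℝ modeH := by
  have h := orthonormal_modeL2
  rw [orthonormal_iff_ite] at h ⊢
  exact h

/-- The coefficients of a divergence free field are orthogonal to the wave vector. -/
lemma inner_wave_casCoeff (k : Fin 2 → ℤ) (u : H) :
    (k 0 : ℝ) * casCoeff k u 0 + (k 1 : ℝ) * casCoeff k u 1 = 0 := by
  have h := u.2.2 (cas (-k)) (isTest_cas _)
  have h1 : ∀ x, inner ℝ (gradField (cas (-k)) x) ((u : L2) x) =
      inner ℝ (-!₂[(k 0 : ℝ), (k 1 : ℝ)]) (cas k x • (u : L2) x) := by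
    intro x
    simp [gradField, PiLp.inner_apply, Fin.sum_univ_two, partialD_cas]
    ring
  simp only [h1] at h
  rw [integral_inner ((isTest_cas k).integrable_smul _)] at h
  change inner ℝ _ (casCoeff k u) = _ at h
  simp [PiLp.inner_apply, Fin.sum_univ_two] at h
  linarith

lemma eq_zero_of_inner_modeH {u : H} (h : ∀ k, inner ℝ (modeH k) u = 0) : u = 0 := by
  refine Subtype.ext (eq_zero_of_casCoeff fun k => ?_)
  by_cases hk : k = 0
  · have := u.2.1
    rw [hk, casCoeff]
    simpa [cas, phase] using this
  · have h1 := h ⟨k, hk⟩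
    have h2 := inner_wave_casCoeff k u
    rw [inner_modeH, amplitude, inner_smul_left] at h1
    have hp := waveLength_pos ⟨k, hk⟩
    have h3 := (mul_eq_zero.1 h1).resolve_left (by simpa using hp.ne')
    simp [PiLp.inner_apply, Fin.sum_univ_two] at h3
    have h4 := one_le_sum_sq ⟨k, hk⟩
    simp only at h4
    set a := casCoeff k u 0
    set b := casCoeff k u 1
    have ha : ((k 0 : ℝ) ^ 2 + (k 1 : ℝ) ^ 2) * a = 0 := by
      linear_combination (k 0 : ℝ) * h2 - (k 1 : ℝ) * h3
    have hb : ((k 0 : ℝ) ^ 2 + (k 1 : ℝ) ^ 2) * b = 0 := by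
      linear_combination (k 1 : ℝ) * h2 + (k 0 : ℝ) * h3
    ext i
    fin_cases i
    · exact (mul_eq_zero.1 ha).resolve_left (by linarith)
    · exact (mul_eq_zero.1 hb).resolve_left (by linarith)

/-- The orthonormal basis of `𝐇` of eigenfunctions of the Stokes operator. -/
def modeBasis : HilbertBasis Mode ℝ H :=
  HilbertBasis.mkOfOrthogonalEqBot orthonormal_modeH (by
    rw [eq_bot_iff]
    intro u hu
    rw [Submodule.mem_orthogonal] at hu
    exact eq_zero_of_inner_modeH fun k => hu _ (Submodule.subset_span ⟨k, rfl⟩))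

@[simp] lemma modeBasis_apply (k : Mode) : modeBasis k = modeH k := by
  simp [modeBasis]

end Modes

/-! ### The square root of the Stokes operator and the Riesz transforms -/

section Riesz

lemma abs_inv_waveLength_le (k : Mode) : |(waveLength k)⁻¹| ≤ 1 := by
  rw [abs_of_pos (inv_pos.2 (waveLength_pos k))]
  exact inv_le_one_of_one_le₀ (one_le_waveLength k)

lemma abs_div_waveLength_le (j : Fin 2) (k : Mode) : |(k.1 j : ℝ) / waveLength k| ≤ 1 := by
  rw [abs_div, abs_of_pos (waveLength_pos k), div_le_one (waveLength_pos k)]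
  refine abs_le_of_sq_le_sq ?_ (waveLength_pos k).le
  rw [waveLength_sq]
  fin_cases j
  · exact le_add_of_nonneg_right (sq_nonneg _)
  · exact le_add_of_nonneg_left (sq_nonneg _)

/-- The operator `A^{-1/2}` on `𝐇`. -/
def invSqrtStokes : H →L[ℝ] H :=
  (exists_weightedPerm modeBasis (Equiv.refl Mode) abs_inv_waveLength_le).choose

/-- The operator `∂ⱼ A^{-1/2}` on `𝐇`. -/
def riesz (j : Fin 2) : H →L[ℝ] H :=
  (exists_weightedPerm modeBasis Mode.reflect (abs_div_waveLength_le j)).choose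

lemma inner_invSqrtStokes (k : Mode) (v : H) :
    inner ℝ (modeH k) (invSqrtStokes v) = (waveLength k)⁻¹ * inner ℝ (modeH k) v := by
  have h := (exists_weightedPerm modeBasis (Equiv.refl Mode) abs_inv_waveLength_le).choose_spec k v
  rwa [Equiv.refl_apply, modeBasis_apply] at h

lemma inner_riesz (j : Fin 2) (k : Mode) (v : H) :
    inner ℝ (modeH k) (riesz j v) = k.1 j / waveLength k * inner ℝ (modeH k.reflect) v := by
  have h := (exists_weightedPerm modeBasis Mode.reflect (abs_div_waveLength_le j)).choose_spec k v
  rwa [modeBasis_apply, modeBasis_apply] at h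

lemma isDiagonal_invSqrtStokes :
    IsDiagonal invSqrtStokes modeBasis fun k => (waveLength k)⁻¹ where
  pos k := inv_pos.2 (waveLength_pos k)
  le_one k := inv_le_one_of_one_le₀ (one_le_waveLength k)
  inner_apply k v := by simpa using inner_invSqrtStokes k v

lemma eq_of_inner_modeH {u v : H} (h : ∀ k, inner ℝ (modeH k) u = inner ℝ (modeH k) v) : u = v :=
  eq_of_inner_basis modeBasis fun k => by simpa using h k

lemma hasSum_inner_modeH_sq (v : H) : HasSum (fun k => inner ℝ (modeH k) v ^ 2) (‖v‖ ^ 2) := by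
  simpa using hasSum_inner_sq modeBasis v

lemma invSqrtStokes_injective : Function.Injective invSqrtStokes := by
  refine fun u v h => eq_of_inner_modeH fun k => ?_
  have h1 := congrArg (inner ℝ (modeH k)) h
  rw [inner_invSqrtStokes, inner_invSqrtStokes] at h1
  exact mul_left_cancel₀ (inv_pos.2 (waveLength_pos k)).ne' h1

lemma Mode.reflect_reflect (k : Mode) : k.reflect.reflect = k := Mode.reflect.left_inv k

@[simp] lemma Mode.reflect_apply (k : Mode) (j : Fin 2) : k.reflect.1 j = -k.1 j := rfl

lemma invSqrtStokes_riesz (j : Fin 2) (v : H) :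
    invSqrtStokes (riesz j v) = riesz j (invSqrtStokes v) := by
  refine eq_of_inner_modeH fun k => ?_
  rw [inner_invSqrtStokes, inner_riesz, inner_riesz, inner_invSqrtStokes, waveLength_reflect]
  ring

/-- `∑ⱼ ∂ⱼ A^{-1/2} ∂ⱼ A^{-1/2} = Δ A⁻¹ = -1`. -/
lemma sum_riesz_riesz (v : H) : ∑ j, riesz j (riesz j v) = -v := by
  refine eq_of_inner_modeH fun k => ?_
  simp only [Fin.sum_univ_two, inner_add_right, inner_riesz, inner_neg_right,
    Mode.reflect_reflect, waveLength_reflect, Mode.reflect_apply]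
  have h := waveLength_sq k
  have hp := (waveLength_pos k).ne'
  push_cast
  field_simp
  rw [h]
  ring

lemma sum_norm_riesz_sq (v : H) : ∑ j, ‖riesz j v‖ ^ 2 = ‖v‖ ^ 2 := by
  have h := (hasSum_inner_modeH_sq (riesz 0 v)).add (hasSum_inner_modeH_sq (riesz 1 v))
  rw [Fin.sum_univ_two]
  refine h.unique ?_
  convert (Equiv.hasSum_iff Mode.reflect).2 (hasSum_inner_modeH_sq v) using 2 with k
  have h := waveLength_sq k
  have hp := (waveLength_pos k).ne'
  rw [inner_riesz, inner_riesz, Function.comp]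
  field_simp
  rw [h]
  ring

lemma norm_riesz_le (j : Fin 2) (v : H) : ‖riesz j v‖ ≤ ‖v‖ := by
  refine abs_le_of_sq_le_sq' ?_ (norm_nonneg v) |>.2
  rw [← sum_norm_riesz_sq v]
  exact Finset.single_le_sum (f := fun j => ‖riesz j v‖ ^ 2) (fun _ _ => sq_nonneg _)
    (Finset.mem_univ j)

lemma invSqrtStokes_modeH (k : Mode) : invSqrtStokes (modeH k) = (waveLength k)⁻¹ • modeH k := by
  simpa using isDiagonal_invSqrtStokes.apply_basis k

lemma inner_modeH_modeH (k l : Mode) [Decidable (k = l)] :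
    inner ℝ (modeH k) (modeH l) = if k = l then 1 else 0 := by
  classical
  convert orthonormal_iff_ite.1 orthonormal_modeH k l

/-- `real_inner_smul_right` for the scalar multiplication that `H` has as a subspace. -/
lemma inner_modeH_smul (k : Mode) (r : ℝ) (v : H) :
    inner ℝ (modeH k) (r • v) = r * inner ℝ (modeH k) v :=
  real_inner_smul_right (modeH k) v r

lemma riesz_modeH (j : Fin 2) (k : Mode) :
    riesz j (modeH k) = (-(k.1 j / waveLength k)) • modeH k.reflect := by
  classical
  refine eq_of_inner_modeH fun l => ?_
  rw [inner_riesz, inner_modeH_smul, inner_modeH_modeH, inner_modeH_modeH]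
  by_cases h : l = k.reflect
  · subst h
    simp [Mode.reflect_reflect, waveLength_reflect]
    ring
  · have h' : l.reflect ≠ k := fun h' => h (by rw [← h', Mode.reflect_reflect])
    simp [h, h']

end Riesz

/-! ### Weak derivatives -/

section WeakDerivatives

variable {j : Fin 2} {f g : L2}

lemma continuous_smul_const {φ : Plane → ℝ} (hφ : IsTest φ) (c : Plane) :
    Continuous fun x => φ x • c := hφ.continuous.smul continuous_const

/-- The scalar product of the integral of `φ u` with a constant vector. -/
lemma inner_integral_smul {φ : Plane → ℝ} (hφ : IsTest φ) (c : Plane) (u : L2) :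
    inner ℝ c (∫ x, φ x • u x ∂cellMeasure) =
      inner ℝ ((memLp_of_continuous (continuous_smul_const hφ c)).toLp _) u := by
  rw [inner_toLp (continuous_smul_const hφ c), ← integral_inner (hφ.integrable_smul u)]
  refine integral_congr_ae (Eventually.of_forall fun x => ?_)
  simp [inner_smul_left, inner_smul_right]

/-- Weak derivatives in terms of scalar products in `𝐋²`, which are continuous. -/
lemma hasWeakPartial_iff : HasWeakPartial j f g ↔ ∀ (φ : Plane → ℝ) (hφ : IsTest φ) (c : Plane),
    inner ℝ ((memLp_of_continuous (continuous_smul_const (hφ.partialD j) c)).toLp _) f +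
      inner ℝ ((memLp_of_continuous (continuous_smul_const hφ c)).toLp _) g = 0 := by
  refine forall₂_congr fun φ hφ => ?_
  have h1 : ∀ c : Plane,
      inner ℝ ((memLp_of_continuous (continuous_smul_const (hφ.partialD j) c)).toLp _) f +
        inner ℝ ((memLp_of_continuous (continuous_smul_const hφ c)).toLp _) g =
      inner ℝ c (∫ x, partialD j φ x • f x ∂cellMeasure + ∫ x, φ x • g x ∂cellMeasure) :=
    fun c => by
      rw [inner_add_right, inner_integral_smul (hφ.partialD j), inner_integral_smul hφ]
  rw [eq_neg_iff_add_eq_zero]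
  exact ⟨fun h c => by rw [h1, h, inner_zero_right],
    fun h => inner_self_eq_zero.1 ((h1 _).symm.trans (h _))⟩

lemma HasWeakPartial.casCoeff (h : HasWeakPartial j f g) (k : Fin 2 → ℤ) :
    casCoeff k g = -((k j : ℝ) • casCoeff (-k) f) := by
  have h1 := h (cas k) (isTest_cas k)
  rw [TorusNS.casCoeff, TorusNS.casCoeff, ← integral_smul]
  rw [eq_neg_iff_add_eq_zero, add_comm, ← eq_neg_iff_add_eq_zero, ← h1]
  refine integral_congr_ae (Eventually.of_forall fun x => ?_)
  simp only [partialD_cas, smul_smul]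

lemma casCoeff_sub (k : Fin 2 → ℤ) (f g : L2) :
    casCoeff k (f - g) = casCoeff k f - casCoeff k g := by
  rw [casCoeff, casCoeff, casCoeff, ← integral_sub ((isTest_cas k).integrable_smul f)
    ((isTest_cas k).integrable_smul g)]
  refine integral_congr_ae ?_
  filter_upwards [Lp.coeFn_sub f g] with x hx
  rw [hx, Pi.sub_apply, smul_sub]

lemma HasWeakPartial.weakPartial_eq (h : HasWeakPartial j f g) : weakPartial j f = g := by
  have hex : ∃ g, HasWeakPartial j f g := ⟨g, h⟩
  rw [weakPartial, dif_pos hex, ← sub_eq_zero]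
  refine eq_zero_of_casCoeff fun k => ?_
  rw [casCoeff_sub, hex.choose_spec.casCoeff, h.casCoeff, sub_self]

lemma hasWeakPartial_modeL2 (j : Fin 2) (k : Mode) :
    HasWeakPartial j (modeL2 k) ((-(k.1 j : ℝ)) • modeL2 k.reflect) := by
  intro φ hφ
  have h1 : ∀ (ψ : Plane → ℝ) (l : Mode), ∫ x, ψ x • modeL2 l x ∂cellMeasure =
      (∫ x, ψ x * cas l.1 x ∂cellMeasure) • amplitude l := by
    intro ψ l
    rw [← integral_smul_const]
    refine integral_congr_ae ?_
    filter_upwards [(memLp_of_continuous (continuous_modeField l)).coeFn_toLp] with x hx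
    rw [modeL2, hx, modeField, smul_smul]
  have h2 : ∫ x, φ x • ((-(k.1 j : ℝ)) • modeL2 k.reflect : L2) x ∂cellMeasure =
      (-(k.1 j : ℝ)) • ∫ x, φ x • modeL2 k.reflect x ∂cellMeasure := by
    rw [← integral_smul]
    refine integral_congr_ae ?_
    filter_upwards [Lp.coeFn_smul (-(k.1 j : ℝ)) (modeL2 k.reflect)] with x hx
    rw [hx, Pi.smul_apply, smul_comm]
  rw [h1, h2, h1, integral_mul_partialD hφ (isTest_cas k.1) j, amplitude_reflect]
  have h3 : ∫ x, φ x * partialD j (cas k.1) x ∂cellMeasure =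
      k.1 j * ∫ x, φ x * cas k.reflect.1 x ∂cellMeasure := by
    rw [← integral_const_mul]
    refine integral_congr_ae (Eventually.of_forall fun x => ?_)
    simp only [partialD_cas]
    change φ x * (_ * cas (-k.1) x) = _ * (φ x * cas (-k.1) x)
    ring
  rw [h3]
  module

/-- The Riesz transforms are the partial derivatives of the range of `A^{-1/2}`. -/
lemma hasWeakPartial_invSqrtStokes (j : Fin 2) (v : H) :
    HasWeakPartial j (invSqrtStokes v : L2) (riesz j v : L2) := by
  refine hasWeakPartial_iff.2 fun φ hφ c => ?_
  set a : L2 := (memLp_of_continuous (continuous_smul_const (hφ.partialD j) c)).toLp _ with ha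
  set b : L2 := (memLp_of_continuous (continuous_smul_const hφ c)).toLp _ with hb
  have hL : ((innerSL ℝ a).comp (H.subtypeL.comp invSqrtStokes)) +
      (innerSL ℝ b).comp (H.subtypeL.comp (riesz j)) = 0 := by
    refine ContinuousLinearMap.ext_on (s := range modeH) ?_ ?_
    · have h := modeBasis.dense_span
      have h' : (range fun k => modeBasis k) = range modeH := by simp
      rw [h'] at h
      rw [dense_iff_closure_eq, ← Submodule.topologicalClosure_coe, h]
      rfl
    · rintro _ ⟨k, rfl⟩
      have h := hasWeakPartial_iff.1 (hasWeakPartial_modeL2 j k) φ hφ c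
      rw [← ha, ← hb, inner_smul_right] at h
      simp only [add_apply, ContinuousLinearMap.comp_apply, innerSL_apply_apply,
        Submodule.subtypeL_apply, invSqrtStokes_modeH, riesz_modeH, Submodule.coe_smul,
        inner_smul_right, zero_apply]
      change _ * inner ℝ a (modeL2 k) + _ * inner ℝ b (modeL2 k.reflect) = 0
      linear_combination (waveLength k)⁻¹ * h
  exact congrArg (fun L : H →L[ℝ] ℝ => L v) hL

@[simp] lemma weakPartial_invSqrtStokes (j : Fin 2) (v : H) :
    weakPartial j (invSqrtStokes v : L2) = (riesz j v : L2) :=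
  (hasWeakPartial_invSqrtStokes j v).weakPartial_eq

lemma normV_invSqrtStokes (v : H) : normV (invSqrtStokes v) = ‖v‖ := by
  rw [normV]
  simp only [weakPartial_invSqrtStokes]
  change √(∑ j, ‖riesz j v‖ ^ 2) = _
  rw [sum_norm_riesz_sq, Real.sqrt_sq (norm_nonneg v)]

lemma memH1_invSqrtStokes (v : H) : MemH1 (invSqrtStokes v : L2) := fun j =>
  ⟨_, hasWeakPartial_invSqrtStokes j v⟩

/-- `𝐕` is the range of `A^{-1/2}`: the weak derivatives of `u` control, by Bessel's inequality,
the coefficients of `u` multiplied by the wave length. -/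
lemma memH1_iff (u : H) : MemH1 (u : L2) ↔ ∃ v, u = invSqrtStokes v := by
  refine ⟨fun h => ?_, ?_⟩
  swap
  · rintro ⟨v, rfl⟩
    exact memH1_invSqrtStokes v
  choose g hg using h
  have h1 : ∀ j (k : Mode), inner ℝ (modeL2 k) (g j) = k.1 j * inner ℝ (modeH k.reflect) u := by
    intro j k
    rw [inner_modeL2, (hg j).casCoeff, inner_modeH, amplitude_reflect, inner_neg_right,
      inner_smul_right, inner_neg_left]
    change _ = _ * -(inner ℝ _ (casCoeff (-k.1) _))
    ring
  have h2 : ∀ j, Summable fun k : Mode => (k.1 j * inner ℝ (modeH k.reflect) u) ^ 2 := by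
    intro j
    refine (orthonormal_modeL2.inner_products_summable (g j)).congr fun k => ?_
    rw [h1, Real.norm_eq_abs, sq_abs]
  have h3 : Summable fun k : Mode => (waveLength k * inner ℝ (modeH k) u) ^ 2 := by
    rw [← Equiv.summable_iff Mode.reflect]
    refine ((h2 0).add (h2 1)).congr fun k => ?_
    rw [Function.comp, waveLength_reflect, mul_pow, mul_pow, mul_pow, waveLength_sq]
    ring
  obtain ⟨v, hv⟩ := exists_inner_basis_eq modeBasis h3
  refine ⟨v, eq_of_inner_modeH fun k => ?_⟩
  have hk := hv k
  rw [modeBasis_apply] at hk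
  rw [inner_invSqrtStokes, hk, inv_mul_cancel_left₀ (waveLength_pos k).ne']

/-- `D(A)` is the range of `A⁻¹`. If the derivatives `∂ⱼ u` lie in the range of `A^{-1/2}`, say
`∂ⱼ u = A^{-1/2} wⱼ`, then `u = -A⁻¹ ∑ⱼ ∂ⱼ A^{-1/2} wⱼ`. -/
lemma memH2_iff (u : H) : MemH2 (u : L2) ↔ ∃ g, u = invSqrtStokes (invSqrtStokes g) := by
  refine ⟨fun ⟨h1, h2⟩ => ?_, ?_⟩
  · obtain ⟨v, rfl⟩ := (memH1_iff u).1 h1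
    simp only [weakPartial_invSqrtStokes, memH1_iff] at h2
    choose w hw using h2
    refine ⟨-∑ j, riesz j (w j), ?_⟩
    rw [map_neg, map_sum]
    simp only [invSqrtStokes_riesz, ← hw, sum_riesz_riesz, neg_neg]
  · rintro ⟨g, rfl⟩
    refine ⟨memH1_invSqrtStokes _, fun j => ?_⟩
    rw [weakPartial_invSqrtStokes, ← invSqrtStokes_riesz]
    exact memH1_invSqrtStokes _

lemma weakPartial_weakPartial (i j : Fin 2) (g : H) :
    weakPartial i (weakPartial j (invSqrtStokes (invSqrtStokes g) : L2)) =
      (riesz i (riesz j g) : L2) := by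
  rw [weakPartial_invSqrtStokes, ← invSqrtStokes_riesz, weakPartial_invSqrtStokes]

lemma leray_coe (u : H) : leray (u : L2) = u :=
  Submodule.orthogonalProjectionOnto_mem_subspace_eq_self u

lemma stokes_invSqrtStokes (g : H) : stokes (invSqrtStokes (invSqrtStokes g)) = g := by
  rw [stokes]
  simp only [weakPartial_weakPartial]
  rw [← Submodule.coe_sum, sum_riesz_riesz, leray_coe, neg_neg]

end WeakDerivatives

/-! ### The supremum of a field in `D(A)` -/

section SupBound

/-- The value `∑ₖ |k|⁻³` of the lattice sum. -/
def latticeSum : ℝ := ∑' k : Mode, (waveLength k ^ 3)⁻¹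

lemma summable_inv_waveLength_cube : Summable fun k : Mode => (waveLength k ^ 3)⁻¹ := by
  have h := (EisensteinSeries.summable_one_div_norm_rpow (k := 3) (by norm_num)).comp_injective
    (Subtype.val_injective (p := fun k : Fin 2 → ℤ => k ≠ 0))
  refine Summable.of_nonneg_of_le (fun k => inv_nonneg.2 (pow_nonneg (waveLength_pos k).le 3))
    (fun k => ?_) h
  have h1 : ‖k.1‖ ≤ waveLength k := by
    refine (pi_norm_le_iff_of_nonneg (waveLength_pos k).le).2 fun j => ?_
    have h2 := abs_div_waveLength_le j k
    rw [abs_div, abs_of_pos (waveLength_pos k), div_le_one (waveLength_pos k)] at h2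
    simpa [Int.norm_eq_abs] using h2
  have h3 : 0 < ‖k.1‖ := norm_pos_iff.2 k.2
  have h4 : ‖k.1‖ ^ (-3 : ℝ) = (‖k.1‖ ^ 3)⁻¹ := by
    rw [Real.rpow_neg h3.le]
    norm_cast
  rw [Function.comp, h4]
  gcongr

lemma latticeSum_nonneg : 0 ≤ latticeSum :=
  tsum_nonneg fun k => inv_nonneg.2 (pow_nonneg (waveLength_pos k).le 3)

lemma norm_modeField_le (k : Mode) (x : Plane) : ‖modeField k x‖ ≤ 2 := by
  rw [modeField, norm_smul]
  have h1 := abs_cas_le k.1 x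
  have h2 := norm_amplitude_le k
  rw [Real.norm_eq_abs]
  nlinarith [abs_nonneg (cas k.1 x), norm_nonneg (amplitude k)]

/-- A bound on the sum of the coefficients of a field is a bound on its values. -/
lemma ae_norm_le_of_sum_le {w : H} {a : ℝ}
    (h : ∀ s : Finset Mode, ∑ k ∈ s, |inner ℝ (modeH k) w| ≤ a) :
    ∀ᵐ x ∂cellMeasure, ‖(w : L2) x‖ ≤ 2 * a := by
  have h1 : HasSum (fun k => inner ℝ (modeH k) w • modeH k) w := by
    simpa [HilbertBasis.repr_apply_apply] using modeBasis.hasSum_repr w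
  have h2 : Tendsto (fun s : Finset Mode => ((∑ k ∈ s, inner ℝ (modeH k) w • modeH k : H) : L2))
      atTop (𝓝 (w : L2)) := (continuous_subtype_val.tendsto w).comp h1
  obtain ⟨ns, -, hns⟩ := (tendstoInMeasure_of_tendsto_Lp h2).exists_seq_tendsto_ae'
  have h3 : ∀ s : Finset Mode, ∀ᵐ x ∂cellMeasure,
      ‖((∑ k ∈ s, inner ℝ (modeH k) w • modeH k : H) : L2) x‖ ≤ 2 * a := by
    intro s
    have h4 : ((∑ k ∈ s, inner ℝ (modeH k) w • modeH k : H) : L2) =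
        ∑ k ∈ s, inner ℝ (modeH k) w • modeL2 k := by
      rw [Submodule.coe_sum]
      rfl
    rw [h4]
    have h5 : ∀ᵐ x ∂cellMeasure, ∀ k : Mode,
        (inner ℝ (modeH k) w • modeL2 k : L2) x = inner ℝ (modeH k) w • modeField k x := by
      refine ae_all_iff.2 fun k => ?_
      filter_upwards [Lp.coeFn_smul (inner ℝ (modeH k) w) (modeL2 k),
        (memLp_of_continuous (continuous_modeField k)).coeFn_toLp] with x hx hx'
      rw [hx, Pi.smul_apply, modeL2, hx']
    filter_upwards [h5, Lp.coeFn_fun_finsetSum s fun k => inner ℝ (modeH k) w • modeL2 k]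
      with x hx hx'
    rw [hx', Finset.sum_congr rfl fun k _ => hx k]
    refine (norm_sum_le _ _).trans ((Finset.sum_le_sum fun k _ => ?_).trans
      ((Finset.mul_sum _ _ 2).symm.le.trans (mul_le_mul_of_nonneg_left (h s) zero_le_two)))
    rw [norm_smul, mul_comm, Real.norm_eq_abs]
    exact mul_le_mul_of_nonneg_right (norm_modeField_le k x) (abs_nonneg _)
  filter_upwards [hns, ae_all_iff.2 fun n => h3 (ns n)] with x hx hx'
  exact le_of_tendsto hx.norm (Eventually.of_forall hx')

/-- The inequality `|u|_∞² ≤ C |A^{1/2} u| |A u|` for `u = A⁻¹ f`. By Cauchy–Schwarz, the sum of the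
coefficients `|k|⁻² |fₖ|` of `u` is at most `(∑ |k|⁻³)^{1/2} (A^{-1/2} f, f)^{1/2}`. -/
lemma ae_norm_le (f : H) : ∀ᵐ x ∂cellMeasure,
    ‖(invSqrtStokes (invSqrtStokes f) : L2) x‖ ≤
      2 * √(latticeSum * (‖invSqrtStokes f‖ * ‖f‖)) := by
  refine ae_norm_le_of_sum_le fun s => Real.le_sqrt_of_sq_le ?_
  have hp := fun k : Mode => inv_pos.2 (waveLength_pos k)
  have h1 := Finset.sum_sq_le_sum_mul_sum_of_sq_le_mul s
    (r := fun k => |inner ℝ (modeH k) (invSqrtStokes (invSqrtStokes f))|)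
    (f := fun k => (waveLength k ^ 3)⁻¹)
    (g := fun k => inner ℝ (modeH k) (invSqrtStokes f) * inner ℝ (modeH k) f)
    (fun k _ => by rw [← inv_pow]; exact pow_nonneg (hp k).le 3)
    (fun k _ => by
      rw [inner_invSqrtStokes, mul_assoc]
      exact mul_nonneg (hp k).le (mul_self_nonneg _))
    (fun k _ => by
      simp only [inner_invSqrtStokes, sq_abs]
      rw [← inv_pow]
      exact le_of_eq (by ring))
  refine h1.trans (mul_le_mul ?_ ?_ ?_ latticeSum_nonneg)
  · exact summable_inv_waveLength_cube.sum_le_tsum s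
      fun k _ => by rw [← inv_pow]; exact pow_nonneg (hp k).le 3
  · have h2 := hasSum_inner_mul modeBasis (invSqrtStokes f) f
    simp only [modeBasis_apply] at h2
    refine (sum_le_hasSum s (fun k _ => ?_) h2).trans (real_inner_le_norm _ _)
    rw [inner_invSqrtStokes, mul_assoc]
    exact mul_nonneg (hp k).le (mul_self_nonneg _)
  · refine Finset.sum_nonneg fun k _ => ?_
    rw [inner_invSqrtStokes, mul_assoc]
    exact mul_nonneg (hp k).le (mul_self_nonneg _)

end SupBound

/-! ### The convective term as a bounded bilinear map -/

section Convection

lemma memLp_convection_term {u v : L2} {a : ℝ} (hu : ∀ᵐ x ∂cellMeasure, ‖u x‖ ≤ a) (j : Fin 2) :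
    MemLp (fun x => u x j • v x) 2 cellMeasure ∧
      ∀ᵐ x ∂cellMeasure, ‖u x j • v x‖ ≤ a * ‖v x‖ := by
  have h : ∀ᵐ x ∂cellMeasure, ‖u x j • v x‖ ≤ a * ‖v x‖ := by
    filter_upwards [hu] with x hx
    rw [norm_smul]
    exact mul_le_mul_of_nonneg_right ((PiLp.norm_apply_le (u x) j).trans hx) (norm_nonneg _)
  refine ⟨(Lp.memLp v).of_le_mul ?_ h, h⟩
  exact ((EuclideanSpace.proj j : Plane →L[ℝ] ℝ).continuous.comp_aestronglyMeasurable
    (Lp.aestronglyMeasurable u)).smul (Lp.aestronglyMeasurable v)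

lemma convection_eq_add (u v : H) : convection u v =
    (fun x => (u : L2) x 0 • (weakPartial 0 (v : L2)) x) +
      fun x => (u : L2) x 1 • (weakPartial 1 (v : L2)) x := by
  ext1 x
  simp [convection, Fin.sum_univ_two]

lemma memLp_convection {u v : H} {a : ℝ} (hu : ∀ᵐ x ∂cellMeasure, ‖(u : L2) x‖ ≤ a) :
    MemLp (convection u v) 2 cellMeasure := by
  rw [convection_eq_add]
  exact (memLp_convection_term hu 0).1.add (memLp_convection_term hu 1).1

lemma norm_B_le {u v : H} {a : ℝ} (hu : ∀ᵐ x ∂cellMeasure, ‖(u : L2) x‖ ≤ a) :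
    ‖B u v‖ ≤ a * ∑ j, ‖weakPartial j (v : L2)‖ := by
  have hm := memLp_convection (v := v) hu
  rw [B, dif_pos hm]
  refine (Submodule.norm_orthogonalProjectionOnto_apply_le _ _).trans ?_
  have h : ∀ j, ‖(memLp_convection_term (v := weakPartial j (v : L2)) hu j).1.toLp _‖ ≤
      a * ‖weakPartial j (v : L2)‖ := fun j => by
    refine Lp.norm_le_mul_norm_of_ae_le_mul ?_
    filter_upwards [(memLp_convection_term (v := weakPartial j (v : L2)) hu j).1.coeFn_toLp,
      (memLp_convection_term (v := weakPartial j (v : L2)) hu j).2] with x hx hx'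
    rwa [hx]
  have h2 : hm.toLp _ = (memLp_convection_term (v := weakPartial 0 (v : L2)) hu 0).1.toLp _ +
      (memLp_convection_term (v := weakPartial 1 (v : L2)) hu 1).1.toLp _ := by
    rw [← MemLp.toLp_add]
    exact MemLp.toLp_congr _ _ (by rw [convection_eq_add])
  rw [h2, Fin.sum_univ_two, mul_add]
  exact (norm_add_le _ _).trans (add_le_add (h 0) (h 1))

lemma memLp_convection_invStokes (f : H) (v : H) :
    MemLp (convection (invSqrtStokes (invSqrtStokes f)) v) 2 cellMeasure :=
  memLp_convection (ae_norm_le f)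

/-- The identity for `B` corresponding to an identity for `(u · ∇) v`. -/
lemma B_eq_of_ae {f f' f'' v v' v'' : H} {r : ℝ}
    (h : ∀ᵐ x ∂cellMeasure, convection (invSqrtStokes (invSqrtStokes f)) v x =
      r • convection (invSqrtStokes (invSqrtStokes f')) v' x +
        convection (invSqrtStokes (invSqrtStokes f'')) v'' x) :
    B (invSqrtStokes (invSqrtStokes f)) v = r • B (invSqrtStokes (invSqrtStokes f')) v' +
      B (invSqrtStokes (invSqrtStokes f'')) v'' := by
  have h1 := memLp_convection_invStokes f v
  have h2 := memLp_convection_invStokes f' v'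
  have h3 := memLp_convection_invStokes f'' v''
  rw [B, B, B, dif_pos h1, dif_pos h2, dif_pos h3, ← map_smul, ← map_add, ← MemLp.toLp_const_smul,
    ← MemLp.toLp_add]
  congr 1
  exact MemLp.toLp_congr _ _ h

lemma B_add_smul_left (r : ℝ) (f f' v : H) :
    B (invSqrtStokes (invSqrtStokes (r • f + f'))) v =
      r • B (invSqrtStokes (invSqrtStokes f)) v + B (invSqrtStokes (invSqrtStokes f')) v := by
  refine B_eq_of_ae ?_
  rw [map_add, map_smul, map_add, map_smul]
  filter_upwards [Lp.coeFn_add (r • (invSqrtStokes (invSqrtStokes f) : L2))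
    (invSqrtStokes (invSqrtStokes f') : L2),
    Lp.coeFn_smul r (invSqrtStokes (invSqrtStokes f) : L2)] with x hx hx'
  simp only [convection, Submodule.coe_add, Submodule.coe_smul, hx, Pi.add_apply, hx',
    Pi.smul_apply, Fin.sum_univ_two, PiLp.add_apply, PiLp.smul_apply, smul_eq_mul]
  module

lemma B_add_smul_right (r : ℝ) (f v v' : H) :
    B (invSqrtStokes (invSqrtStokes f)) (invSqrtStokes (r • v + v')) =
      r • B (invSqrtStokes (invSqrtStokes f)) (invSqrtStokes v) +
        B (invSqrtStokes (invSqrtStokes f)) (invSqrtStokes v') := by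
  refine B_eq_of_ae ?_
  have h : ∀ j, ∀ᵐ x ∂cellMeasure, (riesz j (r • v + v') : L2) x =
      r • (riesz j v : L2) x + (riesz j v' : L2) x := by
    intro j
    rw [map_add, map_smul, Submodule.coe_add, Submodule.coe_smul]
    filter_upwards [Lp.coeFn_add (r • (riesz j v : L2)) (riesz j v' : L2),
      Lp.coeFn_smul r (riesz j v : L2)] with x hx hx'
    rw [hx, Pi.add_apply, hx', Pi.smul_apply]
  filter_upwards [h 0, h 1] with x h0 h1
  simp only [convection, weakPartial_invSqrtStokes, Fin.sum_univ_two, h0, h1]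
  module

lemma norm_B_invStokes_le (f v : H) :
    ‖B (invSqrtStokes (invSqrtStokes f)) (invSqrtStokes v)‖ ≤
      4 * √(latticeSum * (‖invSqrtStokes f‖ * ‖f‖)) * ‖v‖ := by
  refine (norm_B_le (ae_norm_le f)).trans ?_
  simp only [weakPartial_invSqrtStokes, Fin.sum_univ_two]
  have h0 := norm_riesz_le 0 v
  have h1 := norm_riesz_le 1 v
  change _ * (‖riesz 0 v‖ + ‖riesz 1 v‖) ≤ _
  nlinarith [Real.sqrt_nonneg (latticeSum * (‖invSqrtStokes f‖ * ‖f‖))]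

lemma map_smul_of_map_smul_add {φ : H → H} (h : ∀ (r : ℝ) x y, φ (r • x + y) = r • φ x + φ y)
    (r : ℝ) (x : H) : φ (r • x) = r • φ x := by
  have h0 : φ 0 = 0 := by simpa using h (-1) x x
  simpa [h0] using h r x 0

/-- The bilinear map `(f, g) ↦ B(A⁻¹ f, A⁻¹ g)`. -/
def convectiveMap : H →L[ℝ] H →L[ℝ] H :=
  LinearMap.mkContinuous₂ (LinearMap.mk₂ ℝ
    (fun f g => B (invSqrtStokes (invSqrtStokes f)) (invSqrtStokes (invSqrtStokes g)))
    (fun f f' g => by simpa using B_add_smul_left 1 f f' _)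
    (fun r f g => map_smul_of_map_smul_add
      (φ := fun f => B (invSqrtStokes (invSqrtStokes f)) (invSqrtStokes (invSqrtStokes g)))
      (fun r f f' => B_add_smul_left r f f' _) r f)
    (fun f g g' => by simpa using B_add_smul_right 1 f (invSqrtStokes g) (invSqrtStokes g'))
    (fun r f g => map_smul_of_map_smul_add
      (φ := fun g => B (invSqrtStokes (invSqrtStokes f)) (invSqrtStokes (invSqrtStokes g)))
      (fun r g g' => by
        simpa using B_add_smul_right r f (invSqrtStokes g) (invSqrtStokes g')) r g))
  (4 * √latticeSum) (fun f g => by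
    refine (norm_B_invStokes_le f _).trans ?_
    have h1 := isDiagonal_invSqrtStokes.norm_apply_le f
    have h2 := isDiagonal_invSqrtStokes.norm_apply_le g
    rw [Real.sqrt_mul latticeSum_nonneg, ← mul_assoc]
    have h3 : √(‖invSqrtStokes f‖ * ‖f‖) ≤ ‖f‖ := by
      refine Real.sqrt_le_iff.2 ⟨norm_nonneg f, ?_⟩
      rw [sq]
      exact mul_le_mul_of_nonneg_right h1 (norm_nonneg f)
    gcongr)

lemma convectiveMap_apply (f g : H) : convectiveMap f g =
    B (invSqrtStokes (invSqrtStokes f)) (invSqrtStokes (invSqrtStokes g)) := rfl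

lemma norm_convectiveMap_sq_le (f g : H) : ‖convectiveMap f g‖ ^ 2 ≤
    16 * latticeSum * ‖invSqrtStokes f‖ * ‖f‖ * ‖invSqrtStokes g‖ ^ 2 := by
  refine (pow_le_pow_left₀ (norm_nonneg _) (norm_B_invStokes_le f (invSqrtStokes g)) 2).trans ?_
  rw [mul_pow, mul_pow, Real.sq_sqrt (mul_nonneg latticeSum_nonneg (by positivity))]
  exact le_of_eq (by ring)

end Convection

/-! ### Orthogonality of the convective term to the Stokes operator -/

section Enstrophy

variable {U : Fin 2 → Plane → ℝ}

/-- The vector field with the given components. -/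
def vecField (U : Fin 2 → Plane → ℝ) (x : Plane) : Plane := WithLp.toLp 2 fun i => U i x

lemma continuous_vecField (hU : ∀ i, IsTest (U i)) : Continuous (vecField U) := by
  have h := fun i => (hU i).continuous
  unfold vecField
  fun_prop

/-- Classical derivatives are weak derivatives. -/
lemma weakPartial_vecField (hU : ∀ i, IsTest (U i)) {f : L2}
    (hf : ∀ᵐ x ∂cellMeasure, f x = vecField U x) (j : Fin 2) :
    ∀ᵐ x ∂cellMeasure, weakPartial j f x = vecField (fun i => partialD j (U i)) x := by
  have hc := continuous_vecField fun i => (hU i).partialD j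
  have h : HasWeakPartial j f ((memLp_of_continuous hc).toLp _) := by
    intro φ hφ
    have h1 : ∫ x, partialD j φ x • f x ∂cellMeasure =
        ∫ x, partialD j φ x • vecField U x ∂cellMeasure := by
      refine integral_congr_ae ?_
      filter_upwards [hf] with x hx
      rw [hx]
    have h2 : ∫ x, φ x • (memLp_of_continuous hc).toLp _ x ∂cellMeasure =
        ∫ x, φ x • vecField (fun i => partialD j (U i)) x ∂cellMeasure := by
      refine integral_congr_ae ?_
      filter_upwards [(memLp_of_continuous hc).coeFn_toLp] with x hx
      rw [hx]
    rw [h1, h2]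
    ext i
    have h3 := ContinuousLinearMap.integral_comp_comm (EuclideanSpace.proj i : Plane →L[ℝ] ℝ)
      (integrable_of_continuous
        ((hφ.partialD j).continuous.smul (continuous_vecField hU)))
    have h4 := ContinuousLinearMap.integral_comp_comm (EuclideanSpace.proj i : Plane →L[ℝ] ℝ)
      (integrable_of_continuous (hφ.continuous.smul hc))
    refine h3.symm.trans (Eq.trans ?_ (congrArg Neg.neg h4))
    exact integral_mul_partialD hφ (hU i) j
  rw [h.weakPartial_eq]
  exact (memLp_of_continuous hc).coeFn_toLp

lemma partialD_mul_mul {a b c : Plane → ℝ} (ha : IsTest a) (hb : IsTest b) (hc : IsTest c)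
    (k : Fin 2) (x : Plane) : partialD k (fun x => a x * b x * c x) x =
      partialD k a x * b x * c x + a x * partialD k b x * c x + a x * b x * partialD k c x := by
  rw [partialD_mul (ha.mul hb) hc, partialD_mul ha hb]
  ring

/-- The identity `((u · ∇) u, A u) = 0` for smooth divergence free fields in two dimensions: the
integrand is the sum of the derivatives
`-∂ₖ(uⱼ ∂ⱼuᵢ ∂ₖuᵢ) + ½ ∂ⱼ(uⱼ |∂ₖuᵢ|²)` and of the cubic form `∂ₖuⱼ ∂ⱼuᵢ ∂ₖuᵢ` of the gradient,
which is a multiple of the divergence. -/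
lemma integral_convection_laplacian (hU : ∀ i, IsTest (U i))
    (hdiv : ∀ x, partialD 0 (U 0) x + partialD 1 (U 1) x = 0) :
    ∫ x, ∑ i, (∑ j, U j x * partialD j (U i) x) * -∑ k, partialD k (partialD k (U i)) x
      ∂cellMeasure = 0 := by
  have hP : ∀ i j, IsTest (partialD j (U i)) := fun i j => (hU i).partialD j
  have hF : ∀ i j k, IsTest fun x => U j x * partialD j (U i) x * partialD k (U i) x :=
    fun i j k => ((hU j).mul (hP i j)).mul (hP i k)
  have hE : ∀ i j k, IsTest fun x => U j x * partialD k (U i) x * partialD k (U i) x :=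
    fun i j k => ((hU j).mul (hP i k)).mul (hP i k)
  have hpt : ∀ x, ∑ i, (∑ j, U j x * partialD j (U i) x) *
      -∑ k, partialD k (partialD k (U i)) x = ∑ i, ∑ j, ∑ k,
        (1 / 2 * partialD j (fun x => U j x * partialD k (U i) x * partialD k (U i) x) x -
          partialD k (fun x => U j x * partialD j (U i) x * partialD k (U i) x) x) := by
    intro x
    simp only [partialD_mul_mul (hU _) (hP _ _) (hP _ _), Fin.sum_univ_two,
      partialD_comm (hU _) 1 0]
    have h := hdiv x
    have h' : partialD 1 (U 1) x = -partialD 0 (U 0) x := by linarith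
    rw [h']
    ring
  simp only [hpt]
  have hi : ∀ i j k, Integrable (fun x =>
      1 / 2 * partialD j (fun x => U j x * partialD k (U i) x * partialD k (U i) x) x -
        partialD k (fun x => U j x * partialD j (U i) x * partialD k (U i) x) x)
      cellMeasure := fun i j k =>
    integrable_of_continuous ((((hE i j k).partialD j).continuous.const_mul _).sub
      ((hF i j k).partialD k).continuous)
  rw [integral_finsetSum _ fun i _ => integrable_finsetSum _ fun j _ =>
    integrable_finsetSum _ fun k _ => hi i j k]
  refine Finset.sum_eq_zero fun i _ => ?_
  rw [integral_finsetSum _ fun j _ => integrable_finsetSum _ fun k _ => hi i j k]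
  refine Finset.sum_eq_zero fun j _ => ?_
  rw [integral_finsetSum _ fun k _ => hi i j k]
  refine Finset.sum_eq_zero fun k _ => ?_
  rw [integral_sub (integrable_of_continuous (((hE i j k).partialD j).continuous.const_mul _))
    (integrable_of_continuous ((hF i j k).partialD k).continuous), integral_const_mul,
    integral_partialD (hF i j k), integral_partialD (hE i j k)]
  ring

/-- Finite combinations of eigenfunctions are smooth and divergence free. -/
lemma exists_vecField_of_mem_span {g : H} (hg : g ∈ Submodule.span ℝ (range modeH)) :
    ∃ U : Fin 2 → Plane → ℝ, (∀ i, IsTest (U i)) ∧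
      (∀ x, partialD 0 (U 0) x + partialD 1 (U 1) x = 0) ∧
      ∀ᵐ x ∂cellMeasure, (invSqrtStokes (invSqrtStokes g) : L2) x = vecField U x := by
  induction hg using Submodule.span_induction with
  | mem g hg =>
    obtain ⟨k, rfl⟩ := hg
    set r := (waveLength k)⁻¹ * (waveLength k)⁻¹
    refine ⟨fun i x => r * amplitude k i * cas k.1 x, fun i => (isTest_cas k.1).const_mul _,
      fun x => ?_, ?_⟩
    · rw [partialD_const_mul _ (isTest_cas k.1), partialD_const_mul _ (isTest_cas k.1),
        partialD_cas, partialD_cas]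
      simp [amplitude]
      ring
    · have h : (invSqrtStokes (invSqrtStokes (modeH k)) : L2) = r • modeL2 k := by
        rw [invSqrtStokes_modeH, map_smul, invSqrtStokes_modeH, smul_smul]
        rfl
      rw [h]
      filter_upwards [Lp.coeFn_smul r (modeL2 k),
        (memLp_of_continuous (continuous_modeField k)).coeFn_toLp] with x hx hx'
      rw [hx, Pi.smul_apply, modeL2, hx']
      ext i
      simp [vecField, modeField]
      ring
  | zero =>
    refine ⟨fun _ _ => 0, fun _ => isTest_const 0, fun x => ?_, ?_⟩
    · simp [partialD]
    · rw [map_zero, map_zero]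
      filter_upwards [Lp.coeFn_zero Plane 2 cellMeasure] with x hx
      exact hx
  | add g g' _ _ h h' =>
    obtain ⟨U, hU, hd, hf⟩ := h
    obtain ⟨U', hU', hd', hf'⟩ := h'
    refine ⟨fun i x => U i x + U' i x, fun i => (hU i).add (hU' i), fun x => ?_, ?_⟩
    · rw [partialD_add (hU _) (hU' _), partialD_add (hU _) (hU' _)]
      linarith [hd x, hd' x]
    · rw [map_add, map_add, Submodule.coe_add]
      filter_upwards [hf, hf', Lp.coeFn_add (invSqrtStokes (invSqrtStokes g) : L2)
        (invSqrtStokes (invSqrtStokes g') : L2)] with x h1 h2 h3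
      rw [h3, Pi.add_apply, h1, h2]
      rfl
  | smul r g _ h =>
    obtain ⟨U, hU, hd, hf⟩ := h
    refine ⟨fun i x => r * U i x, fun i => (hU i).const_mul r, fun x => ?_, ?_⟩
    · rw [partialD_const_mul _ (hU _), partialD_const_mul _ (hU _), ← mul_add, hd, mul_zero]
    · rw [map_smul, map_smul, Submodule.coe_smul]
      filter_upwards [hf, Lp.coeFn_smul r (invSqrtStokes (invSqrtStokes g) : L2)] with x h1 h2
      rw [h2, Pi.smul_apply, h1]
      rfl

/-- The enstrophy balance `(B(u, u), A u) = 0` for finite combinations of eigenfunctions, which are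
smooth. -/
lemma inner_convectiveMap_of_mem_span {g : H} (hg : g ∈ Submodule.span ℝ (range modeH)) :
    inner ℝ (convectiveMap g g) g = 0 := by
  obtain ⟨U, hU, hd, hf⟩ := exists_vecField_of_mem_span hg
  have hm := memLp_convection_invStokes g (invSqrtStokes (invSqrtStokes g))
  have h1 : inner ℝ (convectiveMap g g) g = inner ℝ (hm.toLp _) (g : L2) := by
    rw [convectiveMap_apply, B, dif_pos hm]
    exact Submodule.inner_orthogonalProjectionOnto_eq_of_mem_right g _
  rw [h1, L2.inner_def, ← integral_convection_laplacian hU hd]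
  have hw := weakPartial_vecField hU hf
  have hww := fun j => weakPartial_vecField (fun i => (hU i).partialD j) (hw j) j
  have hg' : (g : L2) = -(weakPartial 0 (weakPartial 0
      (invSqrtStokes (invSqrtStokes g) : L2)) + weakPartial 1 (weakPartial 1
      (invSqrtStokes (invSqrtStokes g) : L2))) := by
    rw [weakPartial_weakPartial, weakPartial_weakPartial, ← Submodule.coe_add,
      ← Fin.sum_univ_two (fun j => riesz j (riesz j g)), sum_riesz_riesz, Submodule.coe_neg,
      neg_neg]
  have hgx : ∀ᵐ x ∂cellMeasure, (g : L2) x =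
      -(vecField (fun i => partialD 0 (partialD 0 (U i))) x +
        vecField (fun i => partialD 1 (partialD 1 (U i))) x) := by
    rw [hg']
    filter_upwards [hww 0, hww 1, Lp.coeFn_neg (weakPartial 0 (weakPartial 0
      (invSqrtStokes (invSqrtStokes g) : L2)) + weakPartial 1 (weakPartial 1
      (invSqrtStokes (invSqrtStokes g) : L2))), Lp.coeFn_add (weakPartial 0 (weakPartial 0
      (invSqrtStokes (invSqrtStokes g) : L2))) (weakPartial 1 (weakPartial 1
      (invSqrtStokes (invSqrtStokes g) : L2)))] with x h0 h1 h2 h3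
    rw [h2, Pi.neg_apply, h3, Pi.add_apply, h0, h1]
  refine integral_congr_ae ?_
  filter_upwards [hm.coeFn_toLp, hf, hw 0, hw 1, hgx] with x hx hx0 hx1 hx2 hx3
  rw [hx, hx3, convection, Fin.sum_univ_two, hx0, hx1, hx2]
  simp [vecField, PiLp.inner_apply, Fin.sum_univ_two]
  ring

/-- The enstrophy balance, by density and continuity. -/
lemma inner_convectiveMap (g : H) : inner ℝ (convectiveMap g g) g = 0 := by
  have hd : Dense (Submodule.span ℝ (range modeH) : Set H) := by
    have h := modeBasis.dense_span
    have h' : (range fun k => modeBasis k) = range modeH := by simp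
    rw [h'] at h
    rw [dense_iff_closure_eq, ← Submodule.topologicalClosure_coe, h]
    rfl
  have hc : Continuous fun g : H => inner ℝ (convectiveMap g g) g := by fun_prop
  exact congrFun (hc.ext_on hd continuous_const fun g hg => inner_convectiveMap_of_mem_span hg) g

lemma isConvective_convectiveMap :
    IsConvective invSqrtStokes convectiveMap (16 * latticeSum) where
  nonneg := mul_nonneg (by norm_num) latticeSum_nonneg
  bound := norm_convectiveMap_sq_le
  enstrophy := inner_convectiveMap

end Enstrophy

/-! ### The noise coefficient in the operator norm -/

section NoiseNorm

variable {K : Type*} [NormedAddCommGroup K] [InnerProductSpace ℝ K] [CompleteSpace K]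

/-- The operator norm is bounded by the Hilbert–Schmidt norm. -/
lemma norm_le_of_hsNorm_le {L : K →L[ℝ] H} {a : ℝ} (ha : 0 ≤ a)
    (h : hsNorm norm L ≤ ENNReal.ofReal a) : ‖L‖ ≤ a := by
  have hs : ∀ s : Finset (basisSet K), ∑ i ∈ s, ‖L (onb K i)‖ ^ 2 ≤ a ^ 2 := by
    intro s
    rw [hsNorm, one_div, ENNReal.rpow_inv_le_iff (by norm_num)] at h
    have h1 := (ENNReal.sum_le_tsum s).trans h
    have h2 : ∑ i ∈ s, ENNReal.ofReal ‖L (onb K i)‖ ^ 2 =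
        ENNReal.ofReal (∑ i ∈ s, ‖L (onb K i)‖ ^ 2) := by
      rw [ENNReal.ofReal_sum_of_nonneg fun i _ => sq_nonneg _]
      exact Finset.sum_congr rfl fun i _ => (ENNReal.ofReal_pow (norm_nonneg _) 2).symm
    rw [h2, ENNReal.ofReal_rpow_of_nonneg ha zero_le_two] at h1
    have h3 := (ENNReal.ofReal_le_ofReal_iff (by positivity)).1 h1
    exact_mod_cast h3
  refine ContinuousLinearMap.opNorm_le_bound _ ha fun x => ?_
  have h1 : HasSum (fun i => inner ℝ (onb K i) x • L (onb K i)) (L x) := by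
    simpa [HilbertBasis.repr_apply_apply] using L.hasSum ((onb K).hasSum_repr x)
  refine le_of_tendsto (Tendsto.norm h1) (Eventually.of_forall fun s => ?_)
  have h2 : ‖∑ i ∈ s, inner ℝ (onb K i) x • L (onb K i)‖ ≤
      ∑ i ∈ s, |inner ℝ (onb K i) x| * ‖L (onb K i)‖ :=
    (norm_sum_le _ _).trans (Finset.sum_le_sum fun i _ => by rw [norm_smul, Real.norm_eq_abs])
  refine h2.trans (abs_le_of_sq_le_sq' ?_ (by positivity)).2
  refine (Finset.sum_mul_sq_le_sq_mul_sq s _ _).trans ?_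
  rw [mul_pow, mul_comm]
  refine mul_le_mul (hs s) ?_ (Finset.sum_nonneg fun _ _ => sq_nonneg _) (sq_nonneg a)
  simp only [sq_abs]
  exact sum_le_hasSum s (fun _ _ => sq_nonneg _) (hasSum_inner_sq (onb K) x)

lemma NoiseAssumption.exists_isLipschitzNoise {G : H → K →L[ℝ] H} (hG : NoiseAssumption G) :
    ∃ c, IsLipschitzNoise G c := by
  obtain ⟨-, c, hc, h1, h2⟩ := hG
  exact ⟨c, hc.le,
    fun u v => norm_le_of_hsNorm_le (by positivity) (le_add_self.trans (h1 u v)),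
    fun u => norm_le_of_hsNorm_le (by positivity) (le_add_self.trans (h2 u))⟩

end NoiseNorm

/-! ### Paths in the solution space -/

section Lift

variable {T : ℝ} {y v g : ℝ → H}

/-- `v = A^{1/2} y` on `[0, T]` and `g = A y` almost everywhere, where `v` is continuous and `g`
square integrable. -/
structure IsLift (T : ℝ) (y v g : ℝ → H) : Prop where
  continuousOn : ContinuousOn v (Icc 0 T)
  memLp : MemLp g 2 (volume.restrict (Ioo 0 T))
  eq : ∀ t ∈ Icc 0 T, y t = invSqrtStokes (v t)
  ae_eq_top : ∀ᵐ t ∂volume.restrict (Ioo 0 T), y t = invSqrtStokes (invSqrtStokes (g t))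

lemma IsLift.ae_eq (h : IsLift T y v g) :
    ∀ᵐ t ∂volume.restrict (Ioo 0 T), v t = invSqrtStokes (g t) := by
  filter_upwards [h.ae_eq_top, ae_restrict_mem measurableSet_Ioo] with t h1 h2
  exact invSqrtStokes_injective ((h.eq t (Ioo_subset_Icc_self h2)).symm.trans h1)

lemma isLift_zero (T : ℝ) : IsLift T (fun _ => 0) (fun _ => 0) (fun _ => 0) where
  continuousOn := continuousOn_const
  memLp := MemLp.zero
  eq _ _ := (map_zero _).symm
  ae_eq_top := Eventually.of_forall fun _ => by rw [map_zero, map_zero]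

lemma InSolutionSpace.exists_isLift (h : InSolutionSpace T y) : ∃ v g, IsLift T y v g := by
  have h1 : ∀ t, ∃ v, t ∈ Icc 0 T → y t = invSqrtStokes v := by
    intro t
    by_cases ht : t ∈ Icc 0 T
    · obtain ⟨v, hv⟩ := (memH1_iff _).1 (h.memH1 t ht)
      exact ⟨v, fun _ => hv⟩
    · exact ⟨0, fun h => absurd h ht⟩
  choose v hv using h1
  refine ⟨v, fun t => stokes (y t), ?_, ?_, hv, ?_⟩
  · have h2 : ∀ j, ContinuousOn (fun t => riesz j (v t)) (Icc 0 T) := by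
      intro j
      rw [Topology.IsInducing.subtypeVal.continuousOn_iff]
      refine (h.continuousOn_partial j).congr fun t ht => ?_
      change (riesz j (v t) : L2) = weakPartial j (y t : L2)
      rw [hv t ht, weakPartial_invSqrtStokes]
    have h3 : ∀ t, v t = -∑ j, riesz j (riesz j (v t)) := fun t => by
      rw [sum_riesz_riesz, neg_neg]
    have h4 : ContinuousOn (fun t => -∑ j, riesz j (riesz j (v t))) (Icc 0 T) :=
      (continuousOn_finsetSum _ fun j _ => (riesz j).continuous.comp_continuousOn (h2 j)).neg
    exact h4.congr fun t _ => h3 t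
  · exact (leray.comp_memLp' (memLp_finsetSum _ fun j _ => h.memLp_second j j)).neg
  · filter_upwards [h.memH2] with t ht
    obtain ⟨g, hg⟩ := (memH2_iff _).1 ht
    rw [hg, stokes_invSqrtStokes]

lemma IsLift.inSolutionSpace (h : IsLift T y v g) : InSolutionSpace T y where
  memH1 t ht := (memH1_iff _).2 ⟨v t, h.eq t ht⟩
  continuousOn := (invSqrtStokes.continuous.comp_continuousOn h.continuousOn).congr h.eq
  continuousOn_partial j := by
    refine ((H.subtypeL.comp (riesz j)).continuous.comp_continuousOn h.continuousOn).congr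
      fun t ht => ?_
    rw [h.eq t ht, weakPartial_invSqrtStokes]
    rfl
  memH2 := by
    filter_upwards [h.ae_eq_top] with t ht
    exact (memH2_iff _).2 ⟨g t, ht⟩
  memLp_second i j := by
    refine ((H.subtypeL.comp ((riesz i).comp (riesz j))).comp_memLp' h.memLp).ae_eq ?_
    filter_upwards [h.ae_eq_top] with t ht
    rw [ht, weakPartial_weakPartial]
    rfl

end Lift

/-! ### Concrete and abstract solutions -/

section Correspondence

variable {K : Type*} [NormedAddCommGroup K] [InnerProductSpace ℝ K]
variable {G : H → K →L[ℝ] H} {c T δ : ℝ} {u q p y v g : ℝ → H} {h : ℝ → K} {v₀ : H}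

/-- The terms of the equation, along a path in the solution space. -/
lemma force_ae_eq (hu : IsLift T u q p) (hy : IsLift T y v g) :
    ∀ᵐ s ∂volume.restrict (Ioo 0 T), G (δ • u s + (1 - δ) • y s) (h s) - stokes (y s)
      - (1 - δ) • B (y s) (y s) - δ • B (u s) (y s) - δ • B (y s) (u s) =
      controlForce invSqrtStokes convectiveMap G δ h q p s (v s) (g s) - g s := by
  filter_upwards [hu.ae_eq_top, hy.ae_eq_top, ae_restrict_mem measurableSet_Ioo] with s h1 h2 h3
  have h4 := Ioo_subset_Icc_self h3
  rw [controlForce, ← hu.eq s h4, ← hy.eq s h4, convectiveMap_apply, convectiveMap_apply,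
    convectiveMap_apply, ← h1, ← h2]
  have h5 : stokes (y s) = g s := by rw [h2, stokes_invSqrtStokes]
  rw [h5]
  abel

lemma memLp_controlForce (hG : IsLipschitzNoise G c) (hδ : δ = 0 ∨ δ = 1)
    (hh : MemLp h 2 (volume.restrict (Ioo 0 T))) (hu : IsLift T u q p) (hy : IsLift T y v g) :
    MemLp (fun t => controlForce invSqrtStokes convectiveMap G δ h q p t (v t) (g t)) 2
      (volume.restrict (Ioo 0 T)) := by
  obtain ⟨R, hR⟩ := isCompact_Icc.exists_bound_of_continuousOn hu.continuousOn
  obtain ⟨R', hR'⟩ := isCompact_Icc.exists_bound_of_continuousOn hy.continuousOn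
  have hN := isAdmissible_controlForce isDiagonal_invSqrtStokes isConvective_convectiveMap hG hh hδ
    (le_max_right (max R R') 0) hu.continuousOn
    (fun t ht => (hR t ht).trans ((le_max_left _ _).trans (le_max_left _ _))) hu.memLp hu.ae_eq
    ((le_max_right R R').trans (le_max_left _ 0))
  exact hN.memLp hy.continuousOn hy.memLp hy.ae_eq hR'

/-- Passage from a path `y` to the pair `v = A^{1/2} y`, `g = A y`. -/
lemma isControlledSolution_iff (hT : 0 ≤ T) (hG : IsLipschitzNoise G c) (hδ : δ = 0 ∨ δ = 1)
    (hh : MemLp h 2 (volume.restrict (Ioo 0 T))) (hu : IsLift T u q p) (hy : IsLift T y v g) :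
    IsControlledSolution G T δ (invSqrtStokes v₀) u h y ↔
      IsLinearSolution invSqrtStokes T ((1 - δ) • v₀)
        (fun t => controlForce invSqrtStokes convectiveMap G δ h q p t (v t) (g t)) v g := by
  have hF := force_ae_eq (G := G) (δ := δ) (h := h) hu hy
  have hf := memLp_controlForce hG hδ hh hu hy
  have hI : ∀ t ∈ Icc 0 T, (∫ s in (0 : ℝ)..t, (G (δ • u s + (1 - δ) • y s) (h s) - stokes (y s)
      - (1 - δ) • B (y s) (y s) - δ • B (u s) (y s) - δ • B (y s) (u s))) =
      ∫ s in (0 : ℝ)..t, (controlForce invSqrtStokes convectiveMap G δ h q p s (v s) (g s) - g s) :=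
    fun t ht => intervalIntegral_eq_of_ae_Ioo ht (hF.mono fun s hs _ => hs)
  constructor
  · intro hs
    refine ⟨hy.continuousOn, hf, hy.memLp, fun t ht => ?_, hy.ae_eq⟩
    rw [← hy.eq t ht, hs.equation.2 t ht, hI t ht, map_smul]
  · intro hs
    refine ⟨hy.inSolutionSpace, ?_, fun t ht => ?_⟩
    · rw [intervalIntegrable_iff_integrableOn_Ioo_of_le hT]
      exact Integrable.congr hs.integrable_sub (hF.mono fun s hs => hs.symm)
    · rw [hy.eq t ht, hI t ht, hs.equation t ht, map_smul]

lemma exists_isControlledSolution (hT : 0 ≤ T) (hG : IsLipschitzNoise G c) (hδ : δ = 0 ∨ δ = 1)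
    (hh : MemLp h 2 (volume.restrict (Ioo 0 T))) (hu : IsLift T u q p) (v₀ : H) :
    ∃ y, IsControlledSolution G T δ (invSqrtStokes v₀) u h y := by
  obtain ⟨f, v, g, hl, hf⟩ := exists_controlForce_solution isDiagonal_invSqrtStokes
    isConvective_convectiveMap hG hT hh hδ hu.continuousOn hu.memLp hu.ae_eq ((1 - δ) • v₀)
  have hy : IsLift T (fun t => invSqrtStokes (v t)) v g :=
    ⟨hl.continuousOn, hl.memLp_top, fun _ _ => rfl, hl.ae_eq.mono fun t ht => by rw [ht]⟩
  exact ⟨_, (isControlledSolution_iff hT hG hδ hh hu hy).2 (hl.congr_forcing hf)⟩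

lemma eqOn_of_isControlledSolution (hT : 0 ≤ T) (hG : IsLipschitzNoise G c) (hδ : δ = 0 ∨ δ = 1)
    (hh : MemLp h 2 (volume.restrict (Ioo 0 T))) (hu : IsLift T u q p) {y' : ℝ → H}
    (hy : IsControlledSolution G T δ (invSqrtStokes v₀) u h y)
    (hy' : IsControlledSolution G T δ (invSqrtStokes v₀) u h y') : EqOn y' y (Icc 0 T) := by
  obtain ⟨v, g, hl⟩ := hy.space.exists_isLift
  obtain ⟨v', g', hl'⟩ := hy'.space.exists_isLift
  obtain ⟨R, hR⟩ := isCompact_Icc.exists_bound_of_continuousOn hu.continuousOn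
  have h1 := eqOn_of_controlForce isDiagonal_invSqrtStokes isConvective_convectiveMap hG hh hδ
    hR hu.memLp hu.ae_eq ((isControlledSolution_iff hT hG hδ hh hu hl').1 hy')
    ((isControlledSolution_iff hT hG hδ hh hu hl).1 hy) (Eventually.of_forall fun _ => rfl)
    (Eventually.of_forall fun _ => rfl)
  intro t ht
  rw [hl.eq t ht, hl'.eq t ht, h1 ht]

/-- The Navier–Stokes equation is the controlled equation with `δ = 0` and control `0`. -/
lemma isNSESolution_iff (G : H → K →L[ℝ] H) {ξ : H} {u : ℝ → H} : IsNSESolution T ξ u ↔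
    IsControlledSolution G T 0 ξ (fun _ => 0) (fun _ => 0) u := by
  have h1 : (fun s => G ((0 : ℝ) • (0 : H) + (1 - (0 : ℝ)) • u s) 0 - stokes (u s)
      - (1 - (0 : ℝ)) • B (u s) (u s) - (0 : ℝ) • B 0 (u s) - (0 : ℝ) • B (u s) 0) =
      fun s => -stokes (u s) - B (u s) (u s) := by
    funext s
    simp
  constructor
  · intro h
    refine ⟨h.space, ?_⟩
    rw [h1, sub_zero, one_smul]
    exact h.equation
  · intro h
    refine ⟨h.space, ?_⟩
    have h2 := h.equation
    rwa [h1, sub_zero, one_smul] at h2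

/-- From the bound on `v = A^{1/2} y` and `g = A y` to the bound on `y`; the Poincaré inequality has
constant `1`. -/
lemma IsLift.bound (hy : IsLift T y v g) {a : ℝ}
    (ha : ∀ t ∈ Icc 0 T, ‖v t‖ ^ 2 + ∫ s in (0 : ℝ)..t, ‖g s‖ ^ 2 ≤ a) {t : ℝ}
    (ht : t ∈ Icc 0 T) :
    (‖y t‖ ^ 2 + normV (y t) ^ 2) +
      ∫ s in (0 : ℝ)..T, (normV (y s) ^ 2 + ‖stokes (y s)‖ ^ 2) ≤ 4 * a := by
  have hT : T ∈ Icc 0 T := right_mem_Icc.2 (ht.1.trans ht.2)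
  have hn := isDiagonal_invSqrtStokes.norm_apply_le
  have h1 : ∫ s in (0 : ℝ)..T, (normV (y s) ^ 2 + ‖stokes (y s)‖ ^ 2) =
      ∫ s in (0 : ℝ)..T, (‖invSqrtStokes (g s)‖ ^ 2 + ‖g s‖ ^ 2) := by
    refine intervalIntegral_eq_of_ae_Ioo hT ?_
    filter_upwards [hy.ae_eq_top] with s hs _
    rw [hs, normV_invSqrtStokes, stokes_invSqrtStokes]
  have hg2 := hy.memLp.integrable_norm_pow (p := 2) (by norm_num)
  have hSg := (invSqrtStokes.comp_memLp' hy.memLp).integrable_norm_pow (p := 2) (by norm_num)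
  have h2 : ∫ s in (0 : ℝ)..T, (‖invSqrtStokes (g s)‖ ^ 2 + ‖g s‖ ^ 2) ≤
      ∫ s in (0 : ℝ)..T, 2 * ‖g s‖ ^ 2 := by
    refine intervalIntegral_mono_of_ae_Ioo hT (hSg.add hg2) (hg2.const_mul 2)
      (Eventually.of_forall fun s => ?_)
    have := pow_le_pow_left₀ (norm_nonneg _) (hn (g s)) 2
    linarith
  rw [intervalIntegral.integral_const_mul] at h2
  have h3 := pow_le_pow_left₀ (norm_nonneg _) (hn (v t)) 2
  have h4 : 0 ≤ ∫ s in (0 : ℝ)..t, ‖g s‖ ^ 2 :=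
    intervalIntegral.integral_nonneg ht.1 fun _ _ => sq_nonneg _
  have h5 := ha t ht
  have h6 := ha T hT
  have h7 := sq_nonneg ‖v T‖
  rw [h1, hy.eq t ht, normV_invSqrtStokes]
  linarith

end Correspondence

/-! ### A priori bounds -/

/-- The bound in terms of `M` and `r = ‖ξ‖`: the sum of the a priori bounds for the nonlinear and for
the linearised equation, where `c` comes from the noise and `κ` from the convective term. -/
def solutionBound (c κ M r : ℝ) : ℝ :=
  4 * ((r ^ 2 + 2 * c ^ 2 * |M|) * Real.exp (2 * c ^ 2 * |M|) +
    4 * c ^ 2 * (1 + r) ^ 2 * |M| * Real.exp ((4 * κ + 128 * κ ^ 2 * r ^ 2) * r ^ 2)) + 1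

lemma solutionBound_pos (c κ M r : ℝ) : 0 < solutionBound c κ M r := by
  unfold solutionBound
  positivity

section Bound

variable {K : Type*} [NormedAddCommGroup K] [InnerProductSpace ℝ K]
variable {G : H → K →L[ℝ] H} {c T δ : ℝ} {u q p y v g : ℝ → H} {h : ℝ → K} {v₀ : H}

/-- The a priori bound, given that `u` satisfies the one without control. -/
lemma bound_of_isControlledSolution (hT : 0 ≤ T) (hG : IsLipschitzNoise G c) (hδ : δ = 0 ∨ δ = 1)
    (hh : MemLp h 2 (volume.restrict (Ioo 0 T))) (hu : IsLift T u q p)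
    (hup : ∀ t ∈ Icc 0 T, ‖q t‖ ^ 2 + ∫ s in (0 : ℝ)..t, ‖p s‖ ^ 2 ≤ ‖v₀‖ ^ 2)
    (hy : IsControlledSolution G T δ (invSqrtStokes v₀) u h y) {M : ℝ}
    (hM : ∫ s in (0 : ℝ)..T, ‖h s‖ ^ 2 ≤ M) {t : ℝ} (ht : t ∈ Icc 0 T) :
    (‖y t‖ ^ 2 + normV (y t) ^ 2) +
      ∫ s in (0 : ℝ)..T, (normV (y s) ^ 2 + ‖stokes (y s)‖ ^ 2) ≤
      solutionBound c (16 * latticeSum) M ‖v₀‖ := by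
  obtain ⟨v, g, hl⟩ := hy.space.exists_isLift
  have hs := (isControlledSolution_iff hT hG hδ hh hu hl).1 hy
  have hIoo : ∀ f : ℝ → ℝ, ∫ s in (0 : ℝ)..T, f s = ∫ s in Ioo 0 T, f s := fun f => by
    rw [intervalIntegral.integral_of_le hT, integral_Ioc_eq_integral_Ioo]
  rw [hIoo] at hM
  replace hM := hM.trans (le_abs_self M)
  have hTm : T ∈ Icc 0 T := right_mem_Icc.2 hT
  have hκ := isConvective_convectiveMap.nonneg
  have hA : 0 ≤ (‖v₀‖ ^ 2 + 2 * c ^ 2 * |M|) * Real.exp (2 * c ^ 2 * |M|) := by positivity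
  have hB : 0 ≤ 4 * c ^ 2 * (1 + ‖v₀‖) ^ 2 * |M| * Real.exp ((4 * (16 * latticeSum) +
    128 * (16 * latticeSum) ^ 2 * ‖v₀‖ ^ 2) * ‖v₀‖ ^ 2) := by positivity
  rcases hδ with rfl | rfl
  · refine (hl.bound (fun t ht => (bound_of_controlForce_zero isDiagonal_invSqrtStokes
      isConvective_convectiveMap hG hh hs (Eventually.of_forall fun _ => Or.inl rfl) ht).trans
      (?_ : _ ≤ (‖v₀‖ ^ 2 + 2 * c ^ 2 * |M|) * Real.exp (2 * c ^ 2 * |M|))) ht).trans ?_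
    · rw [sub_zero, one_smul]
      gcongr
    · unfold solutionBound
      linarith
  · have hq : ∀ t ∈ Icc 0 T, ‖q t‖ ≤ ‖v₀‖ := fun t ht => by
      refine (abs_le_of_sq_le_sq' ?_ (norm_nonneg v₀)).2
      have h1 : 0 ≤ ∫ s in (0 : ℝ)..t, ‖p s‖ ^ 2 :=
        intervalIntegral.integral_nonneg ht.1 fun _ _ => sq_nonneg _
      linarith [hup t ht]
    have hp : ∫ s in Ioo 0 T, ‖p s‖ ^ 2 ≤ ‖v₀‖ ^ 2 := by
      rw [← hIoo]
      linarith [hup T hTm, sq_nonneg ‖q T‖]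
    refine (hl.bound (fun t ht => (bound_of_controlForce_one isDiagonal_invSqrtStokes
      isConvective_convectiveMap hG hh hq hu.memLp hu.ae_eq hs
      (Eventually.of_forall fun _ => Or.inl rfl) ht).trans
      (?_ : _ ≤ 4 * c ^ 2 * (1 + ‖v₀‖) ^ 2 * |M| * Real.exp ((4 * (16 * latticeSum) +
        128 * (16 * latticeSum) ^ 2 * ‖v₀‖ ^ 2) * ‖v₀‖ ^ 2))) ht).trans ?_
    · rw [sub_self, zero_smul, norm_zero, zero_pow two_ne_zero, zero_add]
      gcongr
    · unfold solutionBound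
      linarith

/-- Without control, the enstrophy balance bounds `u` by its initial value. -/
lemma norm_sq_le_of_isNSESolution (hT : 0 ≤ T) (hG : IsLipschitzNoise G c)
    (hu : IsNSESolution T (invSqrtStokes v₀) u) (hl : IsLift T u q p) {t : ℝ}
    (ht : t ∈ Icc 0 T) : ‖q t‖ ^ 2 + ∫ s in (0 : ℝ)..t, ‖p s‖ ^ 2 ≤ ‖v₀‖ ^ 2 := by
  have h0 : MemLp (fun _ => (0 : K)) 2 (volume.restrict (Ioo 0 T)) := MemLp.zero
  have hs := (isControlledSolution_iff hT hG (Or.inl rfl) h0 (isLift_zero T) hl).1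
    ((isNSESolution_iff G).1 hu)
  have h1 := bound_of_controlForce_zero isDiagonal_invSqrtStokes isConvective_convectiveMap hG h0
    hs (Eventually.of_forall fun _ => Or.inl rfl) ht
  simpa using h1

end Bound

end TorusNS

end

theorem mainTheorem7 {K : Type*} [NormedAddCommGroup K] [InnerProductSpace ℝ K] [CompleteSpace K]
    [TopologicalSpace.SeparableSpace K]
    (G : TorusNS.H → K →L[ℝ] TorusNS.H) (hG : TorusNS.NoiseAssumption G) :
    ∃ C : ℝ → ℝ → ℝ, (∀ M r, 0 < C M r) ∧
      ∀ T : ℝ, 0 < T → ∀ ξ : TorusNS.H, TorusNS.MemH1 (ξ : TorusNS.L2) →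
        ∃ u : ℝ → TorusNS.H, TorusNS.IsNSESolution T ξ u ∧
          (∀ u' : ℝ → TorusNS.H, TorusNS.IsNSESolution T ξ u' → Set.EqOn u' u (Set.Icc 0 T)) ∧
          ∀ δ : ℝ, (δ = 0 ∨ δ = 1) → ∀ h : ℝ → K,
            MeasureTheory.MemLp h 2 (MeasureTheory.volume.restrict (Set.Ioo 0 T)) →
            ∃ y : ℝ → TorusNS.H, TorusNS.IsControlledSolution G T δ ξ u h y ∧
              (∀ y' : ℝ → TorusNS.H, TorusNS.IsControlledSolution G T δ ξ u h y' →
                Set.EqOn y' y (Set.Icc 0 T)) ∧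
              ∀ M : ℝ, 0 < M → ∫ s in (0 : ℝ)..T, ‖h s‖ ^ 2 ≤ M →
                ∀ t ∈ Set.Icc 0 T,
                  (‖y t‖ ^ 2 + TorusNS.normV (y t) ^ 2) +
                    ∫ s in (0 : ℝ)..T, (TorusNS.normV (y s) ^ 2 + ‖TorusNS.stokes (y s)‖ ^ 2)
                  ≤ C M (TorusNS.normV ξ) := by
  obtain ⟨c, hc⟩ := hG.exists_isLipschitzNoise
  refine ⟨TorusNS.solutionBound c (16 * TorusNS.latticeSum),
    TorusNS.solutionBound_pos c _, fun T hT ξ hξ => ?_⟩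
  obtain ⟨v₀, rfl⟩ := (TorusNS.memH1_iff ξ).1 hξ
  have h0 : MeasureTheory.MemLp (fun _ => (0 : K)) 2
      (MeasureTheory.volume.restrict (Set.Ioo 0 T)) := MeasureTheory.MemLp.zero
  have hz := TorusNS.isLift_zero T
  obtain ⟨u, hu⟩ := TorusNS.exists_isControlledSolution hT.le hc (Or.inl rfl) h0 hz v₀
  obtain ⟨q, p, hl⟩ := hu.space.exists_isLift
  refine ⟨u, (TorusNS.isNSESolution_iff G).2 hu, fun u' hu' =>
    TorusNS.eqOn_of_isControlledSolution hT.le hc (Or.inl rfl) h0 hz hu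
      ((TorusNS.isNSESolution_iff G).1 hu'), fun δ hδ h hh => ?_⟩
  obtain ⟨y, hy⟩ := TorusNS.exists_isControlledSolution hT.le hc hδ hh hl v₀
  refine ⟨y, hy, fun y' hy' => TorusNS.eqOn_of_isControlledSolution hT.le hc hδ hh hl hy hy',
    fun M _ hM t ht => ?_⟩
  rw [TorusNS.normV_invSqrtStokes]
  exact TorusNS.bound_of_isControlledSolution hT.le hc hδ hh hl
    (fun t ht => TorusNS.norm_sq_le_of_isNSESolution hT.le hc
      ((TorusNS.isNSESolution_iff G).2 hu) hl ht) hy hM ht
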